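/- **Data.** Let $\mathfrak t$ be the Lie algebra of a maximal torus of a compact, simple, connected and simply connected Lie group, $n=\dim\mathfrak t$; equivalently, $\mathfrak t$ is a real vector space with a (finite) irreducible reduced crystallographic root system, with roots in $\mathfrak t^*$ and coroots in $\mathfrak t$. Let $\Lambda\subset\mathfrak t$ be the lattice generated by the coroots, and let $B$ be the basic inner product, i.e. the Weyl-invariant inner product with $B(\alpha^\vee,\alpha^\vee)=2$ for every long root $\alpha$; $\Lambda^*$ is regarded as a subset of $\mathfrak t$ through $B$. Points of $\mathfrak t^2$ are written $x=(p,q)$. Let $\omega=2\pi B(dp,dq)$, and let $T^2=\mathfrak t^2/\Lambda^2$. The prequantum bundle $L\to T^2$ is the quotient of $\mathfrak t^2\times\mathbb C$, with the trivial metric and the connection $d+\frac{\pi}{i}(B(p,dq)-B(q,dp))$, by the action $\gamma\cdot(x,u)=(x+\gamma,\ e^{i\pi B(\gamma_1,\gamma_2)}e^{\frac i2\omega(\gamma,x)}u)$ of $\gamma=(\gamma_1,\gamma_2)\in\Lambda^2$. **Quantum spaces.** For $\tau$ in the upper half-plane $\mathbb H$ let $j_\tau$ be the complex structure of $T^2$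 with complex coordinate $\zeta=p+\tau q\in\mathfrak t\otimes\mathbb C$, and give tangent vectors of type $(1,0)$ the Hermitian product $\frac1i\omega(X,\overline Y)$. Let $\Omega_\tau$ be the translation-invariant holomorphic $n$-form with $\Omega_\tau(\gamma_1,\dots,\gamma_n)=1$ on a basis of $\Lambda$ (the $(1,0)$ tangent space being identified with $\mathfrak t\otimes\mathbb C$ by $d\zeta$). The half-form bundle $\delta_\tau$ is the trivial line bundle with frame $\Omega^{1/2}$ whose square is $\Omega_\tau$; thus $\Omega^{1/2}$ is holomorphic and $|\Omega^{1/2}|^2=|\Omega_\tau|$. Let $H_{\tau,k}=H^0_\tau(T^2,L^k\otimes\delta_\tau)$ be the space of holomorphic sections, with the scalar product obtained by integrating the pointwise one against $|\omega^n|/n!$. **Operators.** For $A=\begin{pmatrix}a&b\\c&d\end{pmatrix}\in SL(2,\mathbb Z)$ put $A(p,q)=(ap+bq,cp+dq)$, lifted trivially to $L$ (the prequantum lift of $A$), and $A\tau=\frac{a\tau-b}{-c\tau+d}$. Let $\mathrm{Mo}_2$ be the set of pairs $(A,e)$ with $A\in SL(2,\mathbb Z)$ and $e:\mathbb H\to\mathbb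 C$ continuous, $e(\tau)^2=(-c\tau+d)^n$. For $k\ge1$ and $\mu\in k^{-1}\Lambda^*$ let $s_\tau=e^{i\pi B(\zeta,q)}$, $\Theta^\tau_{\mu,k}=\sum_{\gamma\in\mu+\Lambda}\exp\bigl(2i\pi k(\tfrac\tau2B(\gamma,\gamma)-B(\zeta,\gamma))\bigr)$, and let $\Psi_{\tau_1,\tau_2,k}:H_{\tau_1,k}\to H_{\tau_2,k}$ be the linear map with $\Psi_{\tau_1,\tau_2,k}(\Theta^{\tau_1}_{\mu,k}s_{\tau_1}^k\otimes\Omega^{1/2})=\Theta^{\tau_2}_{\mu,k}s_{\tau_2}^k\otimes\Omega^{1/2}$ for all $\mu$. Let $R_2(A,e)$ be the operator of $H_{\tau,k}$ given by $$R_2(A,e)(\sigma)(x)=e(A^{-1}\tau)\,(\Psi_{\tau,A^{-1}\tau,k}\,\sigma)(A^{-1}x)$$ (coefficients with respect to $\Omega^{1/2}$, on $\mathfrak t^2$). **Fourier integral operators.** The Schwartz kernel $S_k(x,y)$ of $S_k\in\operatorname{End}H_{\tau,k}$ is the section of $(L^k\otimes\delta_\tau)\boxtimes(\overline L^k\otimes\overline\delta_\tau)\to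 T^2\times T^2$ corresponding to $S_k$ under $\operatorname{End}H_{\tau,k}\simeq H_{\tau,k}\otimes\overline{H_{\tau,k}}$ (given by the scalar product). Let $\Phi:T^2\to T^2$ be lifted by an automorphism $\Phi_L$ of the prequantum bundle $L$. The sequence $(S_k)_{k\ge1}$ is a *Fourier integral operator associated to $\Phi_L$ with symbol the function $f$* if $$S_k(x,y)=\Bigl(\frac k{2\pi}\Bigr)^nF^k(x,y)\,g(x,y,k)+O(k^{-\infty})\quad\text{uniformly on }T^2\times T^2,$$ where, for the complex structure $(j_\tau,-j_\tau)$ and with $\Gamma=\{(\Phi(x),x)\}$: * $F$ is a smooth section of $L\boxtimes\overline L$ with $\|F(x,y)\|<1$ if $x\ne\Phi(y)$, $F(\Phi(x),x)=\Phi_L(u)\otimes\bar u$ for every $u\in L_x$ with $\|u\|=1$, and $\bar\partial F$ vanishes to any order along $\Gamma$; * $g(\cdot,k)$ is a sequence of smooth sections of $\delta_\tau\boxtimes\overline\delta_\tau$ with an asymptotic expansion $g_0+k^{-1}g_1+k^{-2}g_2+\cdots$ in the $C^\infty$ topology, whose coefficients $g_i$ are smooth with $\bar\partial g_i$ vanishing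 to any order along $\Gamma$; * at $(\Phi(x),x)$, $g_0$ is equal to the map $\delta_{\tau,x}\to\delta_{\tau,\Phi(x)}$, $\Omega^{1/2}\mapsto f(x)\Omega^{1/2}$, where $\delta_\tau\otimes\overline\delta_\tau$ is identified with $\operatorname{Hom}(\delta_\tau,\delta_\tau)$ by the metric of $\delta_\tau$. **Theorem.** For every $\tau\in\mathbb H$ and $(A,e)\in\mathrm{Mo}_2$, the operators $R_2(A,e):H_{\tau,k}\to H_{\tau,k}$ are well defined for all $k\ge1$, and the sequence $(R_2(A,e))_{k=1,2,\dots}$ is a Fourier integral operator associated to the prequantum lift of $A$ to $L$. Its symbol is the constant function equal to $$\sigma(A,e)=e(\tau)\Bigl(\frac{A\tau-\overline{A\tau}}{\tau-\overline{A\tau}}\Bigr)^{n/2},$$ where the quotient has positive real part and the power is the principal one (equal to $1$ when $A\tau=\tau$). -/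

import Mathlib

open scoped ContDiff InnerProductSpace ComplexConjugate MatrixGroups

namespace TorusQuantization

noncomputable section

/-! ### The Lie-theoretic data

`t` is the Lie algebra of the maximal torus, normed by the basic inner product `B = ⟪·,·⟫`, and `P`
is its root system: roots in the dual of `t`, coroots in `t`. -/

/-- The inner product of `t` is the basic one: it is invariant under the Weyl group, and every
coroot of a long root has square length `2`. Lengths of roots are the dual lengths. -/
structure IsBasicInnerProduct {ι M t : Type*} [AddCommGroup M] [Module ℝ M]
    [NormedAddCommGroup t] [InnerProductSpace ℝ t] [FiniteDimensional ℝ t]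
    (P : RootPairing ι ℝ M t) : Prop where
  invariant : ∀ (i : ι) (x y : t), ⟪P.coreflection i x, P.coreflection i y⟫_ℝ = ⟪x, y⟫_ℝ
  long_coroot : ∀ i : ι,
    (∀ j : ι, ‖(P.root' j).toContinuousLinearMap‖ ≤ ‖(P.root' i).toContinuousLinearMap‖) →
      ⟪P.coroot i, P.coroot i⟫_ℝ = 2

section Bundles

variable {t : Type*} [NormedAddCommGroup t] [InnerProductSpace ℝ t]

/-- A finitely generated subgroup of a real vector space is free. -/
instance instFreeLattice (Λ : Submodule ℤ t) [Module.Finite ℤ Λ] : Module.Free ℤ Λ := by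
  have : Module.IsTorsionFree ℤ t := Module.IsTorsionFree.trans_faithfulSMul ℤ ℝ t
  infer_instance

/-! ### The prequantum bundle `L` over the torus `t² / Λ²`

Points of `t²` are pairs `(p, q)`. Sections over the torus of the bundles below are functions on `t²`
with the appropriate equivariance under `Λ²`. -/

/-- The symplectic form `ω = 2π B(dp, dq)`. -/
def omega (x y : t × t) : ℝ := 2 * Real.pi * (⟪x.1, y.2⟫_ℝ - ⟪x.2, y.1⟫_ℝ)

/-- The lattice vector `γ = (p, q)` is embedded in the Heisenberg group as `(γ, exp(iπ B(p, q)))`,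
and acts on the trivial line bundle by
`γ · (x, u) = (x + γ, exp(iπ B(p, q)) exp((i/2) ω(γ, x)) u)`. -/
def latticeFactor (γ x : t × t) : ℂ :=
  Complex.exp (Complex.I * Real.pi * (⟪γ.1, γ.2⟫_ℝ : ℝ)) *
    Complex.exp (Complex.I / 2 * (omega γ x : ℝ))

/-- `σ` is a section of `L^k` over the torus. -/
def IsSection (Λ : Submodule ℤ t) (k : ℕ) (σ : t × t → ℂ) : Prop :=
  ∀ γ : t × t, γ.1 ∈ Λ → γ.2 ∈ Λ → ∀ x, σ (x + γ) = latticeFactor γ x ^ k * σ x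

/-- The primitive `B(p, dq) - B(q, dp)` at `x`, evaluated on `w`. -/
def primitive (x w : t × t) : ℝ := ⟪x.1, w.2⟫_ℝ - ⟪x.2, w.1⟫_ℝ

/-- The covariant derivative of `L^k`: `d + k (π / i) (B(p, dq) - B(q, dp))`. -/
def covDeriv (k : ℕ) (σ : t × t → ℂ) (x w : t × t) : ℂ :=
  fderiv ℝ σ x w + k * (Real.pi / Complex.I) * (primitive x w : ℝ) * σ x

/-! ### Complex structures and half-forms

For `τ` in the upper half-plane the complex coordinate is `ζ = p + τ q`. The vectors of type
`(0,1)`, those killed by `dζ`, are spanned over `ℂ` by the `(τ v, -v)` with `v` in `t`; the vectors of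
type `(1,0)`, those killed by `dζ̄`, by the `(τ̄ v, -v)`.

The half-form line `δ` is trivialized by `Ω^{1/2}`: sections of `L^k ⊗ δ` are written
`σ ⊗ Ω^{1/2}`, and identified with `σ`. Since `Ω^{1/2}` is holomorphic and of constant norm, it is
parallel. -/

/-- The covariant Cauchy-Riemann equations for sections of `L^k ⊗ δ_τ`. -/
def IsHolomorphic (τ : UpperHalfPlane) (k : ℕ) (σ : t × t → ℂ) : Prop :=
  ∀ (x : t × t) (v : t), (τ : ℂ) * covDeriv k σ x (v, 0) - covDeriv k σ x (0, v) = 0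

/-- Scalars `a` such that the complexified vector `(a.1 v, a.2 v)` is the type `(1,0)` vector with
`dζ = v`. -/
def tangentCoeff (τ : UpperHalfPlane) : ℂ × ℂ :=
  (-(conj (τ : ℂ)) / ((τ : ℂ) - conj (τ : ℂ)), 1 / ((τ : ℂ) - conj (τ : ℂ)))

/-- The `ℂ`-bilinear extension of `ω`, on the complexified vectors `(a.1 v, a.2 v)` and
`(b.1 w, b.2 w)`. -/
def omegaC (a : ℂ × ℂ) (v : t) (b : ℂ × ℂ) (w : t) : ℂ :=
  2 * Real.pi * (a.1 * b.2 - a.2 * b.1) * (⟪v, w⟫_ℝ : ℝ)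

/-- The Hermitian product `(1/i) ω(X, Ȳ)` of the type `(1,0)` vectors `X`, `Y` with `dζ(X) = v` and
`dζ(Y) = w`. -/
def tangentHermitian (τ : UpperHalfPlane) (v w : t) : ℂ :=
  1 / Complex.I *
    omegaC (tangentCoeff τ) v (conj (tangentCoeff τ).1, conj (tangentCoeff τ).2) w

open Classical in
/-- The square norm of the section `Ω_τ` of the canonical bundle such that
`Ω_τ(γ₁, …, γₙ) = 1` for a basis `(γᵢ)` of the lattice: the inverse of the Gram determinant. -/
def canonicalNormSq (Λ : Submodule ℤ t) [Module.Finite ℤ Λ] (τ : UpperHalfPlane) : ℝ :=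
  (Matrix.det (Matrix.of fun i j : Module.Free.ChooseBasisIndex ℤ Λ =>
    tangentHermitian τ (Module.Free.chooseBasis ℤ Λ i : t)
      (Module.Free.chooseBasis ℤ Λ j : t))).re⁻¹

/-- The square norm of `Ω^{1/2}` in `δ_τ`, where `Ω^{1/2} ⊗ Ω^{1/2}` is sent to `Ω_τ`. -/
def halfFormNormSq (Λ : Submodule ℤ t) [Module.Finite ℤ Λ] (τ : UpperHalfPlane) : ℝ :=
  Real.sqrt (canonicalNormSq Λ τ)

/-! ### The quantum spaces -/

/-- The space `H⁰_τ(t²/Λ², L^k ⊗ δ_τ)` of holomorphic sections. -/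
def QuantumSpace (Λ : Submodule ℤ t) (τ : UpperHalfPlane) (k : ℕ) :
    Submodule ℂ (t × t → ℂ) where
  carrier := {σ | ContDiff ℝ ∞ σ ∧ IsSection Λ k σ ∧ IsHolomorphic τ k σ}
  add_mem' := by
    rintro a b ⟨ha, ha', ha''⟩ ⟨hb, hb', hb''⟩
    refine ⟨ha.add hb, fun γ h1 h2 x => ?_, fun x v => ?_⟩
    · simp only [Pi.add_apply, ha' γ h1 h2 x, hb' γ h1 h2 x]
      ring
    · have h1 := ha'' x v
      have h2 := hb'' x v
      have hda : DifferentiableAt ℝ a x := (ha.differentiable (by simp)) x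
      have hdb : DifferentiableAt ℝ b x := (hb.differentiable (by simp)) x
      simp only [covDeriv, fderiv_add hda hdb, Pi.add_apply,
        _root_.add_apply] at h1 h2 ⊢
      linear_combination h1 + h2
  zero_mem' := by
    refine ⟨contDiff_const, fun γ _ _ x => by simp, fun x v => ?_⟩
    have h0 : fderiv ℝ (0 : t × t → ℂ) x = 0 := by simp
    simp [covDeriv, h0]
  smul_mem' := by
    rintro c a ⟨ha, ha', ha''⟩
    refine ⟨ha.const_smul c, fun γ h1 h2 x => ?_, fun x v => ?_⟩
    · simp only [Pi.smul_apply, ha' γ h1 h2 x, smul_eq_mul]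
      ring
    · have h1 := ha'' x v
      have hda : DifferentiableAt ℝ a x := (ha.differentiable (by simp)) x
      simp only [covDeriv, fderiv_const_smul hda, Pi.smul_apply, smul_eq_mul,
        _root_.smul_apply] at h1 ⊢
      linear_combination c * h1

/-- The fundamental domain `{∑ xᵢ γᵢ : xᵢ ∈ [0,1)}` of the lattice. -/
def fundamentalDomain (Λ : Submodule ℤ t) [Module.Finite ℤ Λ] : Set t :=
  {v | ∃ x : Module.Free.ChooseBasisIndex ℤ Λ → ℝ, (∀ i, x i ∈ Set.Ico (0 : ℝ) 1) ∧
    v = ∑ i, x i • (Module.Free.chooseBasis ℤ Λ i : t)}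

/-- The scalar product of sections of `L^k ⊗ δ_τ` over the torus: the integral of the pointwise
product against the Liouville measure `|ωⁿ| / n!`, which is `(2π)ⁿ` times the product of the Riemannian
volumes. It is linear in the first argument. -/
def scalarProduct [MeasurableSpace t] [BorelSpace t] [FiniteDimensional ℝ t]
    (Λ : Submodule ℤ t) [Module.Finite ℤ Λ] (τ : UpperHalfPlane) (σ σ' : t × t → ℂ) : ℂ :=
  (2 * Real.pi : ℂ) ^ Module.finrank ℝ t *
    ∫ x in fundamentalDomain Λ ×ˢ fundamentalDomain Λ,
      σ x * conj (σ' x) * (halfFormNormSq Λ τ : ℂ)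

/-! ### The modular group -/

/-- For `A` with coefficients `a, b, c, d`, the matrix with coefficients `a, -b, -c, d`. -/
def twist (A : SL(2, ℤ)) : SL(2, ℤ) :=
  ⟨!![A 0 0, -(A 0 1); -(A 1 0), A 1 1], by
    have h := A.det_coe
    rw [Matrix.det_fin_two] at h
    rw [Matrix.det_fin_two_of]
    linarith⟩

/-- The action `A τ = (a τ - b) / (-c τ + d)` on the upper half-plane. -/
def mobius (A : SL(2, ℤ)) (τ : UpperHalfPlane) : UpperHalfPlane := twist A • τ

theorem coe_mobius (A : SL(2, ℤ)) (τ : UpperHalfPlane) :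
    (mobius A τ : ℂ) =
      ((A 0 0 : ℤ) * (τ : ℂ) - (A 0 1 : ℤ)) / (-((A 1 0 : ℤ) : ℂ) * (τ : ℂ) + (A 1 1 : ℤ)) := by
  rw [mobius, UpperHalfPlane.coe_specialLinearGroup_apply]
  simp [twist, sub_eq_add_neg]

/-- The action `A (p, q) = (a p + b q, c p + d q)`. -/
def modularAction (A : SL(2, ℤ)) (x : t × t) : t × t :=
  (A 0 0 • x.1 + A 0 1 • x.2, A 1 0 • x.1 + A 1 1 • x.2)

/-- The elements `(A, e)` of the extension `Mo₂`: the function `e` is continuous on the upper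
half-plane and `e(τ)² = (-c τ + d)ⁿ`. -/
structure Mo₂ (n : ℕ) where
  A : SL(2, ℤ)
  e : UpperHalfPlane → ℂ
  continuous_e : Continuous e
  e_sq : ∀ τ : UpperHalfPlane, e τ ^ 2 = (-((A 1 0 : ℤ) : ℂ) * (τ : ℂ) + (A 1 1 : ℤ)) ^ n

/-- `σ(A, e) = e(τ) ((Aτ - \bar{Aτ}) / (τ - \bar{Aτ}))^{n/2}`. The quotient has positive real part, and
the power is the principal one, continuous and equal to `1` where `Aτ = τ`. -/
def modularSymbol {n : ℕ} (g : Mo₂ n) (τ : UpperHalfPlane) : ℂ :=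
  g.e τ * (((mobius g.A τ : ℂ) - conj (mobius g.A τ : ℂ)) /
    ((τ : ℂ) - conj (mobius g.A τ : ℂ))) ^ ((n : ℂ) / 2)

/-! ### Theta functions and the operators `R₂(A, e)` -/

/-- The holomorphic section `s_τ = exp(iπ B(ζ, q))`. -/
def baseSection (τ : UpperHalfPlane) (x : t × t) : ℂ :=
  Complex.exp (Complex.I * Real.pi * ((⟪x.1, x.2⟫_ℝ : ℝ) + τ * (⟪x.2, x.2⟫_ℝ : ℝ)))

/-- The theta function
`∑_{γ ∈ μ + Λ} exp(2iπk ((τ/2) B(γ, γ) - B(ζ, γ)))`. -/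
def theta (Λ : Submodule ℤ t) (τ : UpperHalfPlane) (k : ℕ) (μ : t) (x : t × t) : ℂ :=
  ∑' l : Λ, Complex.exp (2 * Complex.I * Real.pi * k *
    ((τ : ℂ) / 2 * (⟪μ + l, μ + l⟫_ℝ : ℝ) -
      ((⟪x.1, μ + l⟫_ℝ : ℝ) + τ * (⟪x.2, μ + l⟫_ℝ : ℝ))))

/-- `μ` belongs to `k⁻¹ Λ*`, the dual lattice being embedded in `t` by `B`. -/
def MemScaledDual (Λ : Submodule ℤ t) (k : ℕ) (μ : t) : Prop :=
  ∀ l ∈ Λ, ∃ m : ℤ, (k : ℝ) * ⟪μ, l⟫_ℝ = m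

/-- `Ψ` is the map `Ψ_{τ₁,τ₂,k}`: it sends `Θ^{τ₁}_{μ,k} s^k_{τ₁} ⊗ Ω^{1/2}` to
`Θ^{τ₂}_{μ,k} s^k_{τ₂} ⊗ Ω^{1/2}`, for all `μ` in `k⁻¹ Λ*`. -/
def IsPsi (Λ : Submodule ℤ t) (τ₁ τ₂ : UpperHalfPlane) (k : ℕ)
    (Ψ : QuantumSpace Λ τ₁ k →ₗ[ℂ] QuantumSpace Λ τ₂ k) : Prop :=
  ∀ μ : t, MemScaledDual Λ k μ → ∃ σ : QuantumSpace Λ τ₁ k,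
    (∀ x, (σ : t × t → ℂ) x = theta Λ τ₁ k μ x * baseSection τ₁ x ^ k) ∧
    ∀ x, (Ψ σ : t × t → ℂ) x = theta Λ τ₂ k μ x * baseSection τ₂ x ^ k

/-- `R` is the operator `R₂(A, e) = φ*_{(A,e)⁻¹} ∘ Ψ_{τ, A⁻¹τ}`. Here `(A, e)` acts trivially on `L` and
sends `z Ω^{1/2}` to `z e(τ') Ω^{1/2}` from `δ_{τ'}` to `δ_{Aτ'}`, with `τ' = A⁻¹τ`. -/
def IsR₂ {n : ℕ} (Λ : Submodule ℤ t) (τ : UpperHalfPlane) (g : Mo₂ n) (k : ℕ)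
    (R : QuantumSpace Λ τ k →ₗ[ℂ] QuantumSpace Λ τ k) : Prop :=
  ∃ Ψ : QuantumSpace Λ τ k →ₗ[ℂ] QuantumSpace Λ (mobius g.A⁻¹ τ) k,
    IsPsi Λ τ (mobius g.A⁻¹ τ) k Ψ ∧
    ∀ (σ : QuantumSpace Λ τ k) (x : t × t), (R σ : t × t → ℂ) x =
      g.e (mobius g.A⁻¹ τ) * (Ψ σ : t × t → ℂ) (modularAction g.A⁻¹ x)

/-! ### Fourier integral operators

Sections of `L^k ⊠ L̄^k` over the square of the torus are functions of `(x, y)`. -/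

/-- `F` is a section of `L^k ⊠ L̄^k`. For `k = 0`, it is a function on the square of the torus, or a
section of `δ ⊠ δ̄` trivialized by `Ω^{1/2} ⊠ Ω̄^{1/2}`. -/
def IsSection₂ (Λ : Submodule ℤ t) (k : ℕ) (F : (t × t) × (t × t) → ℂ) : Prop :=
  ∀ γ γ' : t × t, γ.1 ∈ Λ → γ.2 ∈ Λ → γ'.1 ∈ Λ → γ'.2 ∈ Λ → ∀ x y,
    F (x + γ, y + γ') = latticeFactor γ x ^ k * conj (latticeFactor γ' y) ^ k * F (x, y)

/-- The covariant derivative of `L^k ⊠ L̄^k` in the direction `w` of the first factor. -/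
def covDerivLeft (k : ℕ) (F : (t × t) × (t × t) → ℂ) (z : (t × t) × (t × t)) (w : t × t) : ℂ :=
  fderiv ℝ F z (w, 0) + k * (Real.pi / Complex.I) * (primitive z.1 w : ℝ) * F z

/-- The covariant derivative of `L^k ⊠ L̄^k` in the direction `w` of the second factor. -/
def covDerivRight (k : ℕ) (F : (t × t) × (t × t) → ℂ) (z : (t × t) × (t × t)) (w : t × t) : ℂ :=
  fderiv ℝ F z (0, w) + k * conj (Real.pi / Complex.I) * (primitive z.2 w : ℝ) * F z

/-- For the complex structure `(j_τ, -j_τ)` on the square of the torus, `∂̄F` vanishes to any order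
along the graph `{(Φ x, x)}`. The vectors of type `(0,1)` are spanned by the `((τ v, -v), 0)` and the
`(0, (τ̄ v, -v))`. -/
def DbarVanishesOnGraph (τ : UpperHalfPlane) (Φ : t × t → t × t) (k : ℕ)
    (F : (t × t) × (t × t) → ℂ) : Prop :=
  ∀ (v : t) (m : ℕ) (x : t × t),
    iteratedFDeriv ℝ m (fun z => (τ : ℂ) * covDerivLeft k F z (v, 0) - covDerivLeft k F z (0, v))
      (Φ x, x) = 0 ∧
    iteratedFDeriv ℝ m (fun z => conj (τ : ℂ) * covDerivRight k F z (v, 0) -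
      covDerivRight k F z (0, v)) (Φ x, x) = 0

/-- The sequence `g(·, k)`, `k ≥ 1`, has the asymptotic expansion `∑ k^{-l} g_l` in the `C^∞` topology:
all the derivatives of the remainders are uniformly bounded by the first omitted power. -/
def HasSmoothExpansion {E : Type*} [NormedAddCommGroup E] [NormedSpace ℝ E]
    (g : ℕ → E → ℂ) (a : ℕ → E → ℂ) : Prop :=
  ∀ N m : ℕ, ∃ C : ℝ, ∀ k : ℕ, 1 ≤ k → ∀ z : E,
    ‖iteratedFDeriv ℝ m (fun z => g k z - ∑ l ∈ Finset.range N, ((k : ℂ) ^ l)⁻¹ * a l z) z‖ ≤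
      C / (k : ℝ) ^ N

section Operators

variable [MeasurableSpace t] [BorelSpace t] [FiniteDimensional ℝ t]

/-- `K` is the Schwartz kernel of the operator `S`, the section of
`(L^k ⊗ δ) ⊠ (L̄^k ⊗ δ̄)` which corresponds to `S` under the isomorphism of `End H` with `H ⊗ H̄` given by
the scalar product: `(Sσ)(x) = ⟨σ, \bar{K(x, ·)}⟩`, where `\bar{K(x, ·)}` belongs to `H`. -/
def IsSchwartzKernel (Λ : Submodule ℤ t) [Module.Finite ℤ Λ] (τ : UpperHalfPlane) (k : ℕ)
    (S : QuantumSpace Λ τ k →ₗ[ℂ] QuantumSpace Λ τ k) (K : (t × t) × (t × t) → ℂ) : Prop :=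
  (∀ x, (fun y => conj (K (x, y))) ∈ QuantumSpace Λ τ k) ∧
  ∀ (σ : QuantumSpace Λ τ k) (x : t × t),
    (S σ : t × t → ℂ) x = scalarProduct Λ τ σ (fun y => conj (K (x, y)))

/-- `(S_k)`, `k ≥ 1`, is a Fourier integral operator associated to the prequantum bundle automorphism
`Φ_L : (x, u) ↦ (Φ x, ℓ(x) u)`, with symbol the bundle map `Ω^{1/2} ↦ f(x) Ω^{1/2}` from `δ_x` to
`δ_{Φ x}`.

The element `c Ω^{1/2} ⊗ Ω̄^{1/2}` of `δ ⊗ δ̄` is identified with the map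
`Ω^{1/2} ↦ c |Ω^{1/2}|² Ω^{1/2}`. -/
def IsFourierIntegralOperator (Λ : Submodule ℤ t) [Module.Finite ℤ Λ] (τ : UpperHalfPlane)
    (Φ : t × t → t × t) (ℓ : t × t → ℂ) (f : t × t → ℂ)
    (S : ∀ k : ℕ, QuantumSpace Λ τ k →ₗ[ℂ] QuantumSpace Λ τ k) : Prop :=
  ∃ (K : ℕ → (t × t) × (t × t) → ℂ) (F : (t × t) × (t × t) → ℂ)
    (g : ℕ → (t × t) × (t × t) → ℂ) (a : ℕ → (t × t) × (t × t) → ℂ),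
    (∀ k, 1 ≤ k → IsSchwartzKernel Λ τ k (S k) (K k)) ∧
    -- the section `F` of `L ⊠ L̄`
    (ContDiff ℝ ∞ F ∧ IsSection₂ Λ 1 F ∧
      (∀ x y : t × t, ¬ ((x - Φ y).1 ∈ Λ ∧ (x - Φ y).2 ∈ Λ) → ‖F (x, y)‖ < 1) ∧
      (∀ x, F (Φ x, x) = ℓ x) ∧
      DbarVanishesOnGraph τ Φ 1 F) ∧
    -- the sequence `g(·, k)` of sections of `δ ⊠ δ̄` and its coefficients
    (∀ k, 1 ≤ k → ContDiff ℝ ∞ (g k) ∧ IsSection₂ Λ 0 (g k)) ∧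
    (∀ l, ContDiff ℝ ∞ (a l) ∧ IsSection₂ Λ 0 (a l) ∧ DbarVanishesOnGraph τ Φ 0 (a l)) ∧
    HasSmoothExpansion g a ∧
    -- the symbol
    (∀ x, a 0 (Φ x, x) * (halfFormNormSq Λ τ : ℂ) = f x) ∧
    -- the Schwartz kernel is `(k / 2π)ⁿ F^k g(·, k) + O(k^{-∞})`, uniformly
    ∀ N : ℕ, ∃ C : ℝ, ∀ k : ℕ, 1 ≤ k → ∀ z,
      ‖K k z - ((k : ℂ) / (2 * Real.pi)) ^ Module.finrank ℝ t * F z ^ k * g k z‖ ≤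
        C / (k : ℝ) ^ N

end Operators

end Bundles

end

end TorusQuantization

/-!
The basic inner product gives the coroots the square lengths `2`, `4` or `6`, so that the coroot
lattice `Λ` is an even integral lattice (`IsBasicInnerProduct.isEvenLattice`). Evenness makes the
multiplier of the action of `Λ²` on `L` a cocycle invariant under `SL(2, ℤ)`, which therefore acts
on the quantum spaces. A holomorphic section is determined by its Fourier coefficients along
`q = 0`, and these identify it with a combination of theta functions
(`span_thetaSection_eq_top`); so the maps `Ψ`, and with them the operators `R₂(A, e)`, exist and
are unique (`existsUnique_isR₂`).

The Schwartz kernel of `R₂(A, e)` is explicit. With `τ' = A⁻¹τ`, let `E(x, y)` be the Gaussian which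
is holomorphic in `x` for `τ'`, antiholomorphic in `y` for `τ`, and equal to `1` on the diagonal;
its modulus is less than `1` elsewhere. Integration against `E^k` over `t²` sends each term of a theta
series for `τ` to a multiple of the same term for `τ'`
(`integral_gaussKernel_pow_mul_thetaTerm`), and unfolding the integral over the torus shows that the
sum of the translates of `E^k` under `Λ²` represents a multiple of `Ψ`. The inverse of the multiple
is `((τ - τ̄) / (τ' - τ̄))^{n/2} kⁿ` (`symbol_mul_gaussian_constant`), up to the factors which
normalize the scalar product, and its product with `e(τ')` is `kⁿ` times the symbol computed at `τ'`
instead of `τ`. But the symbol does not depend on the point of the orbit at which it is computed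
(`modularSymbol_mobius`): a computation shows this for its square, and a bound on arguments excludes
a change of sign.

Finally the sum of the translates of `E^k` is, up to an exponentially small error, the `k`-th power
of a section `F`: the sum of the translates of `E` multiplied by a cutoff function supported near
the diagonal. The supports of the translates of the cutoff are disjoint, so the power of the sum is
the sum of the powers, and what is cut off has modulus at most `exp(-εk)`
(`exists_norm_latticeKernel_sub_le`). Near the graph of `A` the section `F` is a single Gaussian,
which is holomorphic for `(j_τ, -j_τ)`. The amplitude `g` is constant, and its expansion reduces to
the first term.
-/

namespace TorusQuantization

noncomputable section

/-! ### The coroot lattice -/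

/-- An even integral lattice: inner products are integers and square lengths are even. -/
structure IsEvenLattice {t : Type*} [NormedAddCommGroup t] [InnerProductSpace ℝ t]
    (Λ : Submodule ℤ t) : Prop where
  inner_int : ∀ x ∈ Λ, ∀ y ∈ Λ, ∃ m : ℤ, ⟪x, y⟫_ℝ = m
  even : ∀ x ∈ Λ, ∃ m : ℤ, ⟪x, x⟫_ℝ = 2 * m

section RootSystem

variable {ι M t : Type*} [AddCommGroup M] [Module ℝ M]
    [NormedAddCommGroup t] [InnerProductSpace ℝ t] [FiniteDimensional ℝ t]
    {P : RootPairing ι ℝ M t}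

/-- The basic inner product, as an invariant form of the dual root system. -/
def IsBasicInnerProduct.invariantForm (hB : IsBasicInnerProduct P) [P.IsRootSystem] :
    P.flip.InvariantForm where
  form := innerₗ t
  symm := ⟨fun x y => real_inner_comm y x⟩
  ne_zero i := by
    have : P.coroot i ≠ 0 := P.flip.ne_zero i
    simpa using this
  isOrthogonal_reflection i := fun x y => hB.invariant i x y

theorem IsBasicInnerProduct.two_mul_inner (hB : IsBasicInnerProduct P) [P.IsRootSystem]
    (i j : ι) : 2 * ⟪P.coroot i, P.coroot j⟫_ℝ = P.pairing j i * ⟪P.coroot j, P.coroot j⟫_ℝ := by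
  exact hB.invariantForm.two_mul_apply_root_root i j

theorem IsBasicInnerProduct.root'_apply (hB : IsBasicInnerProduct P) [P.IsRootSystem]
    (i : ι) (x : t) : P.root' i x * ⟪P.coroot i, P.coroot i⟫_ℝ = 2 * ⟪x, P.coroot i⟫_ℝ := by
  have h := hB.invariant i x (P.coroot i)
  have h1 : P.coreflection i (P.coroot i) = - P.coroot i := by simp
  rw [h1, P.coreflection_apply, inner_sub_left, inner_neg_right, inner_neg_right,
    real_inner_smul_left] at h
  linarith

/-- A root and its coroot have inverse lengths, up to the factor `2`. -/
theorem IsBasicInnerProduct.norm_root_mul_norm_coroot (hB : IsBasicInnerProduct P)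
    [P.IsRootSystem] (i : ι) :
    ‖(P.root' i).toContinuousLinearMap‖ * ‖P.coroot i‖ = 2 := by
  have h0 : P.coroot i ≠ 0 := P.flip.ne_zero i
  have hpos : 0 < ‖P.coroot i‖ := norm_pos_iff.mpr h0
  apply le_antisymm
  · rw [← le_div_iff₀ hpos]
    refine ContinuousLinearMap.opNorm_le_bound _ (by positivity) fun x => ?_
    have h := hB.root'_apply i x
    have h2 := abs_real_inner_le_norm x (P.coroot i)
    rw [real_inner_self_eq_norm_sq] at h
    have h3 : |P.root' i x| * ‖P.coroot i‖ ^ 2 = 2 * |⟪x, P.coroot i⟫_ℝ| := by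
      rw [← abs_of_pos (show 0 < ‖P.coroot i‖ ^ 2 by positivity), ← abs_mul, h, abs_mul]
      simp
    rw [LinearMap.coe_toContinuousLinearMap', Real.norm_eq_abs, div_mul_eq_mul_div,
      le_div_iff₀ hpos]
    have h4 : (|P.root' i x| * ‖P.coroot i‖) * ‖P.coroot i‖ ≤ (2 * ‖x‖) * ‖P.coroot i‖ := by
      nlinarith
    exact le_of_mul_le_mul_right h4 hpos
  · have := (P.root' i).toContinuousLinearMap.le_opNorm (P.coroot i)
    simpa using this

/-- In an irreducible reduced system, the square lengths of the coroots are `2`, `4` or `6`: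
the coroots of the long roots are the shortest ones, and the ratios of square lengths are quotients
of Cartan integers. -/
theorem IsBasicInnerProduct.exists_inner_coroot_self [Finite ι] [P.IsRootSystem]
    [P.IsCrystallographic] [P.IsReduced] [P.IsIrreducible] (hB : IsBasicInnerProduct P) (j : ι) :
    ∃ m : ℤ, ⟪P.coroot j, P.coroot j⟫_ℝ = 2 * m := by
  have : Nonempty ι := ⟨j⟩
  obtain ⟨i, hi⟩ := Finite.exists_max fun i => ‖(P.root' i).toContinuousLinearMap‖
  have h2 := hB.long_coroot i hi
  obtain ⟨k, hk, hne⟩ := P.flip.exists_form_eq_form_and_form_ne_zero hB.invariantForm i j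
  change ⟪P.coroot k, P.coroot k⟫_ℝ = ⟪P.coroot j, P.coroot j⟫_ℝ at hk
  change ⟪P.coroot i, P.coroot k⟫_ℝ ≠ 0 at hne
  rw [← hk]
  have e1 := hB.two_mul_inner i k
  have e2 := hB.two_mul_inner k i
  rw [real_inner_comm, h2] at e2
  have hge : 2 ≤ ⟪P.coroot k, P.coroot k⟫_ℝ := by
    have hi2 := hB.norm_root_mul_norm_coroot i
    have hk2 := hB.norm_root_mul_norm_coroot k
    have h0 : P.coroot k ≠ 0 := P.flip.ne_zero k
    have hpos : 0 < ‖P.coroot k‖ := norm_pos_iff.mpr h0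
    have hle := hi k
    have hrpos : 0 < ‖(P.root' i).toContinuousLinearMap‖ := by
      by_contra hneg
      have : ‖(P.root' i).toContinuousLinearMap‖ = 0 :=
        le_antisymm (not_lt.mp hneg) (norm_nonneg _)
      rw [this] at hi2
      norm_num at hi2
    have hc : ‖P.coroot i‖ ≤ ‖P.coroot k‖ := by
      refine le_of_mul_le_mul_left ?_ hrpos
      rw [hi2, ← hk2]
      gcongr
    rw [real_inner_self_eq_norm_sq] at h2 ⊢
    rw [← h2]
    gcongr
  rw [← P.algebraMap_pairingIn ℤ] at e1 e2
  have hmem := P.pairingIn_pairingIn_mem_set_of_isCrystal_of_isRed k i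
  generalize ⟪P.coroot k, P.coroot k⟫_ℝ = N at *
  generalize ⟪P.coroot i, P.coroot k⟫_ℝ = c at *
  simp only [Set.mem_insert_iff, Set.mem_singleton_iff, Prod.mk.injEq] at hmem
  rcases hmem with h | h | h | h | h | h | h | h | h | h | h | h | h <;>
    obtain ⟨ha, hb⟩ := h <;> rw [ha] at e1 <;> rw [hb] at e2 <;> norm_num at e1 e2
  · exact absurd e1 hne
  all_goals first
    | exact ⟨1, by push_cast; linarith⟩
    | exact ⟨2, by push_cast; linarith⟩
    | exact ⟨3, by push_cast; linarith⟩

/-- The coroots have square lengths `2`, `4` or `6`, so that `B` takes integral values on coroots,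
and even ones on the diagonal. -/
theorem IsBasicInnerProduct.isEvenLattice [Finite ι] [P.IsRootSystem]
    [P.IsCrystallographic] [P.IsReduced] [P.IsIrreducible] (hB : IsBasicInnerProduct P) :
    IsEvenLattice (P.corootSpan ℤ) := by
  have hint : ∀ i j, ∃ m : ℤ, ⟪P.coroot i, P.coroot j⟫_ℝ = m := by
    intro i j
    obtain ⟨m, hm⟩ := hB.exists_inner_coroot_self j
    refine ⟨P.pairingIn ℤ j i * m, ?_⟩
    have h := hB.two_mul_inner i j
    rw [hm, ← P.algebraMap_pairingIn ℤ] at h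
    simp only [algebraMap_int_eq, eq_intCast] at h
    push_cast
    linarith
  have hint' : ∀ x ∈ P.corootSpan ℤ, ∀ y ∈ P.corootSpan ℤ, ∃ m : ℤ, ⟪x, y⟫_ℝ = m := by
    intro x hx y hy
    induction hx, hy using Submodule.span_induction₂ with
    | mem_mem x y hx hy =>
      obtain ⟨i, rfl⟩ := hx
      obtain ⟨j, rfl⟩ := hy
      exact hint i j
    | zero_left y hy => exact ⟨0, by simp⟩
    | zero_right x hx => exact ⟨0, by simp⟩
    | add_left x y z hx hy hz h1 h2 =>
      obtain ⟨a, ha⟩ := h1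
      obtain ⟨b, hb⟩ := h2
      exact ⟨a + b, by rw [inner_add_left, ha, hb]; push_cast; ring⟩
    | add_right x y z hx hy hz h1 h2 =>
      obtain ⟨a, ha⟩ := h1
      obtain ⟨b, hb⟩ := h2
      exact ⟨a + b, by rw [inner_add_right, ha, hb]; push_cast; ring⟩
    | smul_left r x y hx hy h =>
      obtain ⟨a, ha⟩ := h
      exact ⟨r * a, by rw [← Int.cast_smul_eq_zsmul ℝ, real_inner_smul_left, ha]; push_cast; ring⟩
    | smul_right r x y hx hy h =>
      obtain ⟨a, ha⟩ := h
      exact ⟨r * a, by rw [← Int.cast_smul_eq_zsmul ℝ, real_inner_smul_right, ha]; push_cast; ring⟩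
  refine ⟨hint', fun x hx => ?_⟩
  induction hx using Submodule.span_induction with
  | mem x hx =>
    obtain ⟨i, rfl⟩ := hx
    exact hB.exists_inner_coroot_self i
  | zero => exact ⟨0, by simp⟩
  | add x y hx hy h1 h2 =>
    obtain ⟨a, ha⟩ := h1
    obtain ⟨b, hb⟩ := h2
    obtain ⟨c, hc⟩ := hint' x hx y hy
    refine ⟨a + b + c, ?_⟩
    rw [real_inner_add_add_self, ha, hb, hc]
    push_cast
    ring
  | smul r x hx h =>
    obtain ⟨a, ha⟩ := h
    refine ⟨r ^ 2 * a, ?_⟩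
    rw [← Int.cast_smul_eq_zsmul ℝ, real_inner_smul_left, real_inner_smul_right, ha]
    push_cast
    ring

end RootSystem

section Lattice

variable {t : Type*} [NormedAddCommGroup t] [InnerProductSpace ℝ t] {Λ : Submodule ℤ t}

theorem IsEvenLattice.one_le_norm (hΛ : IsEvenLattice Λ) {x : t} (hx : x ∈ Λ) (h0 : x ≠ 0) :
    1 ≤ ‖x‖ := by
  obtain ⟨m, hm⟩ := hΛ.even x hx
  have hpos : 0 < ‖x‖ := norm_pos_iff.mpr h0
  rw [real_inner_self_eq_norm_sq] at hm
  have hm0 : (0 : ℝ) < m := by nlinarith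
  have hm1 : (1 : ℤ) ≤ m := by exact_mod_cast hm0
  have hm1' : (1 : ℝ) ≤ m := by exact_mod_cast hm1
  nlinarith

theorem IsEvenLattice.discreteTopology (hΛ : IsEvenLattice Λ) : DiscreteTopology Λ := by
  refine discreteTopology_iff_isOpen_singleton_zero.mpr ?_
  have : ({0} : Set Λ) = Metric.ball 0 1 := by
    refine Set.ext fun x => ?_
    rw [Set.mem_singleton_iff, Metric.mem_ball, dist_zero_right]
    refine ⟨fun hx => by simp [hx], fun hx => ?_⟩
    by_contra hne
    have := hΛ.one_le_norm x.2 (by simpa using hne)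
    rw [Submodule.coe_norm] at hx
    linarith
  rw [this]
  exact Metric.isOpen_ball

end Lattice

/-! ### Invariance of the symbol -/

theorem mobius_denom_ne_zero (A : SL(2, ℤ)) (τ : UpperHalfPlane) :
    -((A 1 0 : ℤ) : ℂ) * (τ : ℂ) + (A 1 1 : ℤ) ≠ 0 := by
  have h := UpperHalfPlane.denom_ne_zero (twist A : SL(2, ℤ)) τ
  have h2 : UpperHalfPlane.denom (twist A : SL(2, ℤ)) τ =
      -((A 1 0 : ℤ) : ℂ) * (τ : ℂ) + (A 1 1 : ℤ) := by
    rw [ModularGroup.denom_apply]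
    simp [twist]
  rwa [h2] at h

/-- The imaginary part of the automorphy factor `-cτ + d` keeps a constant sign, so that the
principal logarithm is continuous along it. -/
theorem continuous_log_denom (A : SL(2, ℤ)) :
    Continuous fun τ : UpperHalfPlane =>
      Complex.log (-((A 1 0 : ℤ) : ℂ) * (τ : ℂ) + (A 1 1 : ℤ)) := by
  by_cases hc : A 1 0 = 0
  · simp only [hc]
    simpa using continuous_const
  · refine Continuous.clog (by fun_prop) fun τ => Or.inr ?_
    have : (τ : ℂ).im ≠ 0 := τ.im_pos.ne'
    simpa using ⟨hc, this⟩

/-- `e` is, up to sign, the principal power `(-cτ + d)^{n/2}`. -/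
theorem Mo₂.exists_e_eq {n : ℕ} (g : Mo₂ n) : ∃ ε : ℂ, ∀ τ : UpperHalfPlane,
    g.e τ = ε * Complex.exp ((n : ℂ) / 2 *
      Complex.log (-((g.A 1 0 : ℤ) : ℂ) * (τ : ℂ) + (g.A 1 1 : ℤ))) := by
  set P : UpperHalfPlane → ℂ := fun τ => Complex.exp ((n : ℂ) / 2 *
      Complex.log (-((g.A 1 0 : ℤ) : ℂ) * (τ : ℂ) + (g.A 1 1 : ℤ))) with hP
  have hPc : Continuous P :=
    Complex.continuous_exp.comp (continuous_const.mul (continuous_log_denom g.A))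
  have hsq : ∀ τ, P τ ^ 2 = g.e τ ^ 2 := by
    intro τ
    rw [g.e_sq, hP]
    simp only
    rw [← Complex.exp_nat_mul]
    conv_rhs => rw [← Complex.exp_log (mobius_denom_ne_zero g.A τ), ← Complex.exp_nat_mul]
    congr 1
    push_cast
    ring
  have hP0 : ∀ τ, P τ ≠ 0 := fun τ => Complex.exp_ne_zero _
  have := (isPreconnected_univ (α := UpperHalfPlane)).eq_or_eq_neg_of_sq_eq
    g.continuous_e.continuousOn hPc.continuousOn (fun τ _ => (hsq τ).symm) (fun {τ} _ => hP0 τ)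
  rcases this with h | h
  · exact ⟨1, fun τ => by rw [one_mul]; exact h (Set.mem_univ τ)⟩
  · exact ⟨-1, fun τ => by rw [neg_one_mul]; exact h (Set.mem_univ τ)⟩

theorem sub_conj_ne_zero (τ τ' : UpperHalfPlane) : (τ : ℂ) - conj (τ' : ℂ) ≠ 0 := by
  intro h
  have h1 := congrArg Complex.im h
  have := τ.im_pos
  have := τ'.im_pos
  simp at h1
  linarith

/-- The quotient `(τ' - τ̄') / (τ - τ̄')` has positive real part. -/
theorem re_quotient_pos (τ τ' : UpperHalfPlane) :
    0 < (((τ' : ℂ) - conj (τ' : ℂ)) / ((τ : ℂ) - conj (τ' : ℂ))).re := by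
  have h := sub_conj_ne_zero τ τ'
  have h1 := τ.im_pos
  have h2 := τ'.im_pos
  rw [Complex.div_re, ← add_div]
  apply div_pos _ (Complex.normSq_pos.mpr h)
  simp only [Complex.sub_re, Complex.conj_re, sub_self, zero_mul, Complex.sub_im, Complex.conj_im,
    zero_add]
  have h1' : 0 < (τ : ℂ).im := h1
  have h2' : 0 < (τ' : ℂ).im := h2
  nlinarith

/-- Two complex numbers with the same exponential, whose imaginary parts differ by less than `2π`,
are equal. -/
theorem eq_of_exp_eq_of_abs_im_sub_lt {z w : ℂ} (h : Complex.exp z = Complex.exp w)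
    (hlt : |z.im - w.im| < 2 * Real.pi) : z = w := by
  obtain ⟨m, hm⟩ := Complex.exp_eq_exp_iff_exists_int.mp h
  have him : z.im - w.im = m * (2 * Real.pi) := by
    rw [hm]
    simp
  have hm0 : m = 0 := by
    rw [him, abs_mul, abs_of_pos Real.two_pi_pos] at hlt
    have h1 : |(m : ℝ)| < 1 := by
      by_contra hh
      nlinarith [Real.two_pi_pos]
    have h2 : |m| < 1 := by exact_mod_cast h1
    exact Int.abs_lt_one_iff.mp h2
  rw [hm, hm0]
  simp

theorem coe_det_eq_one (A : SL(2, ℤ)) :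
    ((A 0 0 : ℤ) : ℂ) * (A 1 1 : ℤ) - ((A 0 1 : ℤ) : ℂ) * (A 1 0 : ℤ) = 1 := by
  have h := A.det_coe
  rw [Matrix.det_fin_two] at h
  exact_mod_cast h

/-- The product of the automorphy factor with the quotient in the symbol is invariant: it is
`(τ - τ̄) / D(τ)`, where `D` is the sesquilinear form attached to the matrix, an invariant of the
action. -/
theorem denom_mul_quotient_mobius (A : SL(2, ℤ)) (τ : UpperHalfPlane) :
    (-((A 1 0 : ℤ) : ℂ) * (mobius A τ : ℂ) + (A 1 1 : ℤ)) *
      (((mobius A (mobius A τ) : ℂ) - conj (mobius A (mobius A τ) : ℂ)) /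
        ((mobius A τ : ℂ) - conj (mobius A (mobius A τ) : ℂ))) =
    (-((A 1 0 : ℤ) : ℂ) * (τ : ℂ) + (A 1 1 : ℤ)) *
      (((mobius A τ : ℂ) - conj (mobius A τ : ℂ)) / ((τ : ℂ) - conj (mobius A τ : ℂ))) := by
  have hdet := coe_det_eq_one A
  have hm : ∀ τ : UpperHalfPlane, (mobius A τ : ℂ) * (-((A 1 0 : ℤ) : ℂ) * (τ : ℂ) + (A 1 1 : ℤ)) =
      (A 0 0 : ℤ) * (τ : ℂ) - (A 0 1 : ℤ) := fun τ => by
    rw [coe_mobius, div_mul_cancel₀ _ (mobius_denom_ne_zero A τ)]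
  have hm' : ∀ τ : UpperHalfPlane,
      conj (mobius A τ : ℂ) * (-((A 1 0 : ℤ) : ℂ) * conj (τ : ℂ) + (A 1 1 : ℤ)) =
      (A 0 0 : ℤ) * conj (τ : ℂ) - (A 0 1 : ℤ) := fun τ => by
    have := congrArg conj (hm τ)
    simpa using this
  have hJ' : ∀ τ : UpperHalfPlane, -((A 1 0 : ℤ) : ℂ) * conj (τ : ℂ) + (A 1 1 : ℤ) ≠ 0 := by
    intro τ h
    apply mobius_denom_ne_zero A τ
    have := congrArg conj h
    simpa using this
  have key : ∀ τ : UpperHalfPlane, (-((A 1 0 : ℤ) : ℂ) * (τ : ℂ) + (A 1 1 : ℤ)) *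
      (((mobius A τ : ℂ) - conj (mobius A τ : ℂ)) / ((τ : ℂ) - conj (mobius A τ : ℂ))) *
      (-((A 1 0 : ℤ) : ℂ) * (τ : ℂ) * conj (τ : ℂ) + (A 1 1 : ℤ) * τ - (A 0 0 : ℤ) * conj (τ : ℂ)
        + (A 0 1 : ℤ)) = (τ : ℂ) - conj (τ : ℂ) := by
    intro τ
    have h0 := sub_conj_ne_zero τ (mobius A τ)
    have h1 := hm τ
    have h2 := hm' τ
    rw [mul_div_assoc', div_mul_eq_mul_div, div_eq_iff h0]
    apply mul_right_cancel₀ (hJ' τ)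
    generalize ((A 0 0 : ℤ) : ℂ) = a at *
    generalize ((A 0 1 : ℤ) : ℂ) = b at *
    generalize ((A 1 0 : ℤ) : ℂ) = c at *
    generalize ((A 1 1 : ℤ) : ℂ) = d at *
    generalize conj (mobius A τ : ℂ) = m' at *
    generalize (mobius A τ : ℂ) = m at *
    generalize conj (τ : ℂ) = σ at *
    generalize (τ : ℂ) = ρ at *
    linear_combination (-c * ρ * σ + d * ρ - a * σ + b) * ((-c * σ + d) * h1 - (-c * ρ + d) * h2)
      + (ρ - σ) * h2 + (-c * ρ * σ + d * ρ - a * σ + b) * (ρ - σ) * hdet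
  have hD : ∀ τ : UpperHalfPlane,
      (-((A 1 0 : ℤ) : ℂ) * (τ : ℂ) * conj (τ : ℂ) + (A 1 1 : ℤ) * τ - (A 0 0 : ℤ) * conj (τ : ℂ)
        + (A 0 1 : ℤ)) ≠ 0 := by
    intro τ h
    have := key τ
    rw [h, mul_zero] at this
    exact sub_conj_ne_zero τ τ this.symm
  have k1 := key τ
  have k2 := key (mobius A τ)
  rw [← eq_div_iff (hD _)] at k1 k2
  rw [k1, k2, div_eq_div_iff (hD _) (hD _)]
  apply mul_right_cancel₀ (mul_ne_zero (mobius_denom_ne_zero A τ) (hJ' τ))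
  have h1 := hm τ
  have h2 := hm' τ
  clear key hm hm' hJ' hD k1 k2
  generalize ((A 0 0 : ℤ) : ℂ) = a at *
  generalize ((A 0 1 : ℤ) : ℂ) = b at *
  generalize ((A 1 0 : ℤ) : ℂ) = c at *
  generalize ((A 1 1 : ℤ) : ℂ) = d at *
  generalize conj (mobius A τ : ℂ) = m' at *
  generalize (mobius A τ : ℂ) = m at *
  generalize conj (τ : ℂ) = σ at *
  generalize (τ : ℂ) = ρ at *
  have e1 : (m - m') * ((-c * ρ + d) * (-c * σ + d)) = ρ - σ := by
    linear_combination (-c * σ + d) * h1 - (-c * ρ + d) * h2 + (ρ - σ) * hdet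
  have e2 : (-c * m * m' + d * m - a * m' + b) * ((-c * ρ + d) * (-c * σ + d)) =
      -c * ρ * σ + d * ρ - a * σ + b := by
    linear_combination (-c * m' * (-c * σ + d) + d * (-c * σ + d)) * h1 +
      (-c * (a * ρ - b) - a * (-c * ρ + d)) * h2 + (-c * ρ * σ + d * ρ - a * σ + b) * hdet
  linear_combination (-c * ρ * σ + d * ρ - a * σ + b) * e1 - (ρ - σ) * e2

/-- The arguments of the automorphy factor at two points differ by at most `π`, the factor being
constant or staying in a fixed open half-plane, and those of `z₁` and `z₂` differ by less than
`π`. -/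
theorem arg_add_arg_sub_lt (A : SL(2, ℤ)) (τ₁ τ₂ : UpperHalfPlane) {z₁ z₂ : ℂ} (h₁ : 0 < z₁.re)
    (h₂ : 0 < z₂.re) :
    |(Complex.log (-((A 1 0 : ℤ) : ℂ) * (τ₁ : ℂ) + (A 1 1 : ℤ)) + Complex.log z₁).im -
      (Complex.log (-((A 1 0 : ℤ) : ℂ) * (τ₂ : ℂ) + (A 1 1 : ℤ)) + Complex.log z₂).im| <
      2 * Real.pi := by
  have a1 := abs_lt.mp (Complex.abs_arg_lt_pi_div_two_iff.mpr (Or.inl h₁))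
  have a2 := abs_lt.mp (Complex.abs_arg_lt_pi_div_two_iff.mpr (Or.inl h₂))
  have p := Real.pi_pos
  have him : ∀ τ : UpperHalfPlane, (-((A 1 0 : ℤ) : ℂ) * (τ : ℂ) + (A 1 1 : ℤ)).im =
      -(A 1 0 : ℤ) * τ.im := fun τ => by simp
  simp only [Complex.add_im, Complex.log_im]
  rcases lt_trichotomy (A 1 0) 0 with hc | hc | hc
  · have hc' : ((A 1 0 : ℤ) : ℝ) < 0 := by exact_mod_cast hc
    have key : ∀ τ : UpperHalfPlane, 0 ≤ (-((A 1 0 : ℤ) : ℂ) * (τ : ℂ) + (A 1 1 : ℤ)).arg ∧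
        (-((A 1 0 : ℤ) : ℂ) * (τ : ℂ) + (A 1 1 : ℤ)).arg ≤ Real.pi := fun τ =>
      ⟨Complex.arg_nonneg_iff.mpr (by rw [him]; nlinarith [τ.im_pos]), Complex.arg_le_pi _⟩
    have k1 := key τ₁
    have k2 := key τ₂
    rw [abs_lt]
    constructor <;> linarith
  · simp only [hc, Int.cast_zero, neg_zero, zero_mul, zero_add]
    rw [abs_lt]
    constructor <;> linarith
  · have hc' : 0 < ((A 1 0 : ℤ) : ℝ) := by exact_mod_cast hc
    have key : ∀ τ : UpperHalfPlane, (-((A 1 0 : ℤ) : ℂ) * (τ : ℂ) + (A 1 1 : ℤ)).arg < 0 ∧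
        -Real.pi < (-((A 1 0 : ℤ) : ℂ) * (τ : ℂ) + (A 1 1 : ℤ)).arg := fun τ =>
      ⟨Complex.arg_neg_iff.mpr (by rw [him]; nlinarith [τ.im_pos]), Complex.neg_pi_lt_arg _⟩
    have k1 := key τ₁
    have k2 := key τ₂
    rw [abs_lt]
    constructor <;> linarith

/-- The symbol is invariant under the action on the upper half-plane. The square of the symbol is
plainly invariant; the sign is settled by the sum of the arguments of the two factors, which
varies in an interval of length less than `2π`. -/
theorem modularSymbol_mobius {n : ℕ} (g : Mo₂ n) (τ : UpperHalfPlane) :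
    modularSymbol g (mobius g.A τ) = modularSymbol g τ := by
  obtain ⟨ε, hε⟩ := g.exists_e_eq
  have hQ : ∀ τ : UpperHalfPlane,
      ((mobius g.A τ : ℂ) - conj (mobius g.A τ : ℂ)) / ((τ : ℂ) - conj (mobius g.A τ : ℂ)) ≠ 0 :=
    fun τ => div_ne_zero (sub_conj_ne_zero _ _) (sub_conj_ne_zero _ _)
  have key : ∀ τ, modularSymbol g τ = ε * Complex.exp ((n : ℂ) / 2 *
      (Complex.log (-((g.A 1 0 : ℤ) : ℂ) * (τ : ℂ) + (g.A 1 1 : ℤ)) +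
        Complex.log (((mobius g.A τ : ℂ) - conj (mobius g.A τ : ℂ)) /
          ((τ : ℂ) - conj (mobius g.A τ : ℂ))))) := by
    intro τ
    rw [modularSymbol, hε, Complex.cpow_def_of_ne_zero (hQ τ), mul_add, Complex.exp_add]
    ring_nf
  rw [key, key]
  congr 3
  apply eq_of_exp_eq_of_abs_im_sub_lt
  · rw [Complex.exp_add, Complex.exp_add, Complex.exp_log (mobius_denom_ne_zero _ _),
      Complex.exp_log (mobius_denom_ne_zero _ _), Complex.exp_log (hQ _), Complex.exp_log (hQ _)]
    exact denom_mul_quotient_mobius g.A τ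
  · exact arg_add_arg_sub_lt g.A _ _ (re_quotient_pos _ _) (re_quotient_pos _ _)

/-! ### Gaussian sums over lattices -/

section LatticeSums

theorem pow_mul_exp_neg_le (n : ℕ) {c : ℝ} (hc : 0 < c) (R : ℝ) {r : ℝ} (hr : 0 ≤ r) :
    r ^ n * Real.exp (-c * r ^ 2 + R * r) ≤ n.factorial * Real.exp ((R + 1) ^ 2 / (4 * c)) := by
  have h1 : r ^ n ≤ n.factorial * Real.exp r := by
    have := Real.pow_div_factorial_le_exp r hr n
    rwa [div_le_iff₀ (by positivity), mul_comm] at this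
  calc r ^ n * Real.exp (-c * r ^ 2 + R * r)
      ≤ n.factorial * Real.exp r * Real.exp (-c * r ^ 2 + R * r) := by gcongr
    _ = n.factorial * Real.exp (r + (-c * r ^ 2 + R * r)) := by rw [mul_assoc, ← Real.exp_add]
    _ ≤ _ := by
      gcongr
      rw [le_div_iff₀ (by positivity)]
      nlinarith [sq_nonneg (2 * c * r - (R + 1))]

theorem exp_neg_sq_norm_add_le {E : Type*} [NormedAddCommGroup E] {c : ℝ} (hc : 0 < c)
    {R : ℝ} (hR : 0 ≤ R) (l x : E) :
    Real.exp (-c * ‖x + l‖ ^ 2 + R * ‖x + l‖) ≤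
      Real.exp (c * ‖x‖ ^ 2 + R * ‖x‖) * Real.exp (-(c / 2) * ‖l‖ ^ 2 + R * ‖l‖) := by
  rw [← Real.exp_add, Real.exp_le_exp]
  have h1 : ‖x + l‖ ≤ ‖x‖ + ‖l‖ := norm_add_le _ _
  have h2 : ‖l‖ ≤ ‖x + l‖ + ‖x‖ := by
    calc ‖l‖ = ‖(x + l) - x‖ := by congr 1; abel
      _ ≤ _ := norm_sub_le _ _
  have h3 : ‖l‖ ^ 2 ≤ 2 * ‖x + l‖ ^ 2 + 2 * ‖x‖ ^ 2 := by
    nlinarith [norm_nonneg l, norm_nonneg x, norm_nonneg (x + l), sq_nonneg (‖x + l‖ - ‖x‖)]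
  nlinarith

variable {E : Type*} [NormedAddCommGroup E] [NormedSpace ℝ E] [FiniteDimensional ℝ E]
  (L : Submodule ℤ E) [DiscreteTopology L]

theorem summable_exp_neg_sq_norm {c : ℝ} (hc : 0 < c) (R : ℝ) :
    Summable fun l : L => Real.exp (-c * ‖l‖ ^ 2 + R * ‖l‖) := by
  set n := Module.finrank ℤ L + 1
  have hg := (ZLattice.summable_norm_pow_inv L n (Nat.lt_succ_self _)).mul_left
    (n.factorial * Real.exp ((R + 1) ^ 2 / (4 * c)))
  refine Summable.of_norm_bounded_eventually hg ?_
  filter_upwards [(Set.finite_singleton (0 : L)).compl_mem_cofinite] with l hl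
  have hl0 : 0 < ‖l‖ := norm_pos_iff.mpr (by simpa using hl)
  rw [Real.norm_eq_abs, abs_of_pos (Real.exp_pos _), inv_pow, ← div_eq_mul_inv,
    le_div_iff₀ (by positivity), mul_comm]
  exact pow_mul_exp_neg_le n hc R hl0.le

theorem summable_exp_neg_sq_norm_add {c : ℝ} (hc : 0 < c) (R : ℝ) (x : E) :
    Summable fun l : L => Real.exp (-c * ‖x + l‖ ^ 2 + R * ‖x + l‖) := by
  refine Summable.of_nonneg_of_le (fun _ => (Real.exp_pos _).le) (fun l => ?_)
    ((summable_exp_neg_sq_norm L (half_pos hc) |R|).mul_left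
      (Real.exp (c * ‖x‖ ^ 2 + |R| * ‖x‖)))
  refine le_trans ?_ (exp_neg_sq_norm_add_le hc (abs_nonneg R) (l : E) x)
  gcongr
  exact le_abs_self R

/-- Sums of a Gaussian over the translates of a lattice are uniformly bounded. -/
theorem exists_tsum_exp_neg_sq_norm_add_le [IsZLattice ℝ L] {c : ℝ} (hc : 0 < c) :
    ∃ C : ℝ, ∀ x : E, ∑' l : L, Real.exp (-c * ‖x + l‖ ^ 2) ≤ C := by
  set b := (Module.Free.chooseBasis ℤ L).ofZLatticeBasis ℝ L
  have hb : Submodule.span ℤ (Set.range b) = L :=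
    (Module.Free.chooseBasis ℤ L).ofZLatticeBasis_span ℝ
  set r := ∑ i, ‖b i‖
  refine ⟨∑' l : L, Real.exp (c * r ^ 2) * Real.exp (-(c / 2) * ‖l‖ ^ 2), fun x => ?_⟩
  have hmem : ((ZSpan.floor b x : _) : E) ∈ L := hb.le (ZSpan.floor b x).2
  have hsum : ∀ y : E, Summable fun l : L => Real.exp (-c * ‖y + l‖ ^ 2) := fun y => by
    simpa using summable_exp_neg_sq_norm_add L hc 0 y
  have hshift : ∑' l : L, Real.exp (-c * ‖x + l‖ ^ 2) =
      ∑' l : L, Real.exp (-c * ‖ZSpan.fract b x + l‖ ^ 2) := by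
    rw [← (Equiv.addLeft (⟨_, hmem⟩ : L)).tsum_eq
      (fun l : L => Real.exp (-c * ‖ZSpan.fract b x + l‖ ^ 2))]
    congr 1
    ext l
    simp only [Equiv.coe_addLeft, Submodule.coe_add, ZSpan.fract_apply]
    congr 4
    abel
  rw [hshift]
  refine (hsum _).tsum_le_tsum (fun l => ?_)
    ((by simpa using summable_exp_neg_sq_norm L (half_pos hc) 0 :
      Summable fun l : L => Real.exp (-(c / 2) * ‖l‖ ^ 2)).mul_left _)
  have h := exp_neg_sq_norm_add_le hc le_rfl (l : E) (ZSpan.fract b x)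
  simp only [zero_mul, add_zero] at h
  refine h.trans ?_
  have := ZSpan.norm_fract_le b x
  refine mul_le_mul_of_nonneg_right ?_ (Real.exp_pos _).le
  gcongr

end LatticeSums

/-! ### Sums of exponentials of linear forms -/

section ExpSums

variable {I V : Type*} [NormedAddCommGroup V] [NormedSpace ℝ V]

/-- The summability under which `∑ aᵢ exp(λᵢ(z))` is an entire function of `z`. -/
def ExpSummable (a : I → ℂ) (lam : I → V →L[ℝ] ℂ) : Prop :=
  ∀ R : ℝ, Summable fun i => ‖a i‖ * Real.exp (R * ‖lam i‖)

theorem norm_mul_cexp_le (a : ℂ) (lam : V →L[ℝ] ℂ) {z : V} {r : ℝ} (hz : ‖z‖ ≤ r) :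
    ‖a * Complex.exp (lam z)‖ ≤ ‖a‖ * Real.exp (r * ‖lam‖) := by
  rw [norm_mul, Complex.norm_exp]
  gcongr
  calc (lam z).re ≤ ‖lam z‖ := Complex.re_le_norm _
    _ ≤ ‖lam‖ * ‖z‖ := lam.le_opNorm z
    _ ≤ r * ‖lam‖ := by rw [mul_comm]; gcongr

theorem norm_mul_cexp_smul_le (a : ℂ) (lam : V →L[ℝ] ℂ) {z : V} {r : ℝ} (hz : ‖z‖ ≤ r) :
    ‖(a * Complex.exp (lam z)) • lam‖ ≤ ‖a‖ * Real.exp ((r + 1) * ‖lam‖) := by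
  rw [norm_smul]
  have h1 : ‖lam‖ ≤ Real.exp ‖lam‖ := by linarith [Real.add_one_le_exp ‖lam‖]
  calc ‖a * Complex.exp (lam z)‖ * ‖lam‖
      ≤ (‖a‖ * Real.exp (r * ‖lam‖)) * Real.exp ‖lam‖ := by
        gcongr
        exact norm_mul_cexp_le a lam hz
    _ = _ := by rw [mul_assoc, ← Real.exp_add]; ring_nf

theorem ExpSummable.summable {a : I → ℂ} {lam : I → V →L[ℝ] ℂ} (h : ExpSummable a lam) (z : V) :
    Summable fun i => a i * Complex.exp (lam i z) :=
  Summable.of_norm_bounded (h ‖z‖) fun _ => norm_mul_cexp_le _ _ le_rfl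

theorem ExpSummable.hasFDerivAt {a : I → ℂ} {lam : I → V →L[ℝ] ℂ} (h : ExpSummable a lam)
    (z : V) : HasFDerivAt (fun z => ∑' i, a i * Complex.exp (lam i z))
      (∑' i, (a i * Complex.exp (lam i z)) • lam i) z := by
  have hz : z ∈ Metric.ball (0 : V) (‖z‖ + 1) := by simp
  have hd : ∀ (i : I) (y : V), y ∈ Metric.ball (0 : V) (‖z‖ + 1) →
      HasFDerivAt (fun y => a i * Complex.exp (lam i y)) ((a i * Complex.exp (lam i y)) • lam i)
        y := fun i y _ => by
    have h1 : HasFDerivAt (fun y => Complex.exp (lam i y)) (Complex.exp (lam i y) • lam i) y :=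
      (lam i).hasFDerivAt.cexp
    have h2 := h1.const_mul (a i)
    rwa [smul_smul] at h2
  have hb : ∀ (i : I) (y : V), y ∈ Metric.ball (0 : V) (‖z‖ + 1) →
      ‖(a i * Complex.exp (lam i y)) • lam i‖ ≤ ‖a i‖ * Real.exp ((‖z‖ + 1 + 1) * ‖lam i‖) :=
    fun i y hy => norm_mul_cexp_smul_le _ _ (mem_ball_zero_iff.mp hy).le
  exact hasFDerivAt_tsum_of_isPreconnected (h (‖z‖ + 1 + 1)) Metric.isOpen_ball
    (convex_ball _ _).isPreconnected hd hb hz (h.summable z) hz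

theorem ExpSummable.fderiv_apply {a : I → ℂ} {lam : I → V →L[ℝ] ℂ} (h : ExpSummable a lam)
    (z w : V) : fderiv ℝ (fun z => ∑' i, a i * Complex.exp (lam i z)) z w =
      ∑' i, (a i * lam i w) * Complex.exp (lam i z) := by
  rw [(h.hasFDerivAt z).fderiv]
  have hs : Summable fun i => (a i * Complex.exp (lam i z)) • lam i :=
    Summable.of_norm_bounded (h (‖z‖ + 1)) fun i => norm_mul_cexp_smul_le _ _ le_rfl
  have := (ContinuousLinearMap.apply ℝ ℂ w).map_tsum hs
  simp only [ContinuousLinearMap.apply_apply] at this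
  rw [this]
  congr 1
  ext i
  simp
  ring

theorem ExpSummable.mul_apply {a : I → ℂ} {lam : I → V →L[ℝ] ℂ} (h : ExpSummable a lam) (w : V) :
    ExpSummable (fun i => a i * lam i w) lam := by
  intro R
  refine Summable.of_nonneg_of_le (fun i => by positivity) (fun i => ?_)
    ((h (R + 1)).mul_left ‖w‖)
  have h1 : ‖lam i‖ ≤ Real.exp ‖lam i‖ := by linarith [Real.add_one_le_exp ‖lam i‖]
  calc ‖a i * lam i w‖ * Real.exp (R * ‖lam i‖)
      ≤ (‖a i‖ * (Real.exp ‖lam i‖ * ‖w‖)) * Real.exp (R * ‖lam i‖) := by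
        rw [norm_mul]
        gcongr
        exact ((lam i).le_opNorm w).trans (by gcongr)
    _ = ‖w‖ * (‖a i‖ * (Real.exp (R * ‖lam i‖) * Real.exp ‖lam i‖)) := by ring
    _ = _ := by rw [← Real.exp_add]; ring_nf

theorem ExpSummable.contDiff [FiniteDimensional ℝ V] {a : I → ℂ} {lam : I → V →L[ℝ] ℂ}
    (h : ExpSummable a lam) : ContDiff ℝ ∞ fun z => ∑' i, a i * Complex.exp (lam i z) := by
  rw [contDiff_infty]
  intro n
  induction n generalizing a with
  | zero =>
    exact contDiff_zero.mpr
      (continuous_iff_continuousAt.mpr fun z => (h.hasFDerivAt z).continuousAt)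
  | succ n ih =>
    push_cast
    rw [contDiff_succ_iff_fderiv_apply]
    refine ⟨fun z => (h.hasFDerivAt z).differentiableAt, by simp, fun w => ?_⟩
    simp only [h.fderiv_apply]
    exact ih (h.mul_apply w)

end ExpSums

/-! ### Holomorphic sections built from a frame -/

section Frames

variable {t : Type*} [NormedAddCommGroup t] [InnerProductSpace ℝ t]

/-- The product of a holomorphic section with a holomorphic function is holomorphic. -/
theorem IsHolomorphic.mul {τ : UpperHalfPlane} {k : ℕ} {s f : t × t → ℂ}
    (hs : IsHolomorphic τ k s) (hsd : Differentiable ℝ s) (hfd : Differentiable ℝ f)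
    (hf : ∀ (x : t × t) (v : t), (τ : ℂ) * fderiv ℝ f x (v, 0) - fderiv ℝ f x (0, v) = 0) :
    IsHolomorphic τ k (fun x => s x * f x) := by
  intro x v
  have h1 := hs x v
  have h2 := hf x v
  simp only [covDeriv, fderiv_fun_mul (hsd x) (hfd x), _root_.add_apply,
    _root_.smul_apply, smul_eq_mul] at h1 ⊢
  linear_combination f x * h1 + s x * h2

theorem ExpSummable.fderiv_holomorphic {I : Type*} {a : I → ℂ} {lam : I → (t × t) →L[ℝ] ℂ}
    (h : ExpSummable a lam) {τ : UpperHalfPlane}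
    (hl : ∀ i v, lam i (0, v) = (τ : ℂ) * lam i (v, 0)) (x : t × t) (v : t) :
    (τ : ℂ) * fderiv ℝ (fun z => ∑' i, a i * Complex.exp (lam i z)) x (v, 0) -
      fderiv ℝ (fun z => ∑' i, a i * Complex.exp (lam i z)) x (0, v) = 0 := by
  rw [h.fderiv_apply, h.fderiv_apply, ← tsum_mul_left, sub_eq_zero]
  congr 1
  ext i
  rw [hl]
  ring

end Frames

/-! ### Gaussian sections and the coordinate `ζ` -/

section Quadratic

variable {t : Type*} [NormedAddCommGroup t] [InnerProductSpace ℝ t]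

/-- The quadratic form `a B(p, p) + b B(p, q) + c B(q, q)` with complex coefficients. -/
def quadForm (a b c : ℂ) (x : t × t) : ℂ :=
  a * (⟪x.1, x.1⟫_ℝ : ℝ) + b * (⟪x.1, x.2⟫_ℝ : ℝ) + c * (⟪x.2, x.2⟫_ℝ : ℝ)

theorem contDiff_quadForm (a b c : ℂ) : ContDiff ℝ ∞ (quadForm a b c : t × t → ℂ) := by
  have h : ∀ f g : t × t → t, ContDiff ℝ ∞ f → ContDiff ℝ ∞ g →
      ContDiff ℝ ∞ fun x => ((⟪f x, g x⟫_ℝ : ℝ) : ℂ) := fun f g hf hg =>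
    Complex.ofRealCLM.contDiff.comp (hf.inner ℝ hg)
  exact ((contDiff_const.mul (h _ _ contDiff_fst contDiff_fst)).add
    (contDiff_const.mul (h _ _ contDiff_fst contDiff_snd))).add
    (contDiff_const.mul (h _ _ contDiff_snd contDiff_snd))

theorem fderiv_quadForm (a b c : ℂ) (x w : t × t) :
    fderiv ℝ (quadForm a b c) x w = 2 * a * (⟪x.1, w.1⟫_ℝ : ℝ) +
      b * ((⟪x.1, w.2⟫_ℝ : ℝ) + (⟪x.2, w.1⟫_ℝ : ℝ)) + 2 * c * (⟪x.2, w.2⟫_ℝ : ℝ) := by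
  have h1 : HasFDerivAt (fun x : t × t => x.1) (ContinuousLinearMap.fst ℝ t t) x := hasFDerivAt_fst
  have h2 : HasFDerivAt (fun x : t × t => x.2) (ContinuousLinearMap.snd ℝ t t) x := hasFDerivAt_snd
  have key : ∀ {f g : t × t → t} {f' g' : t × t →L[ℝ] t}, HasFDerivAt f f' x →
      HasFDerivAt g g' x → HasFDerivAt (fun x => ((⟪f x, g x⟫_ℝ : ℝ) : ℂ))
        (Complex.ofRealCLM.comp ((fderivInnerCLM ℝ (f x, g x)).comp (f'.prod g'))) x :=
    fun hf hg => Complex.ofRealCLM.hasFDerivAt.comp x (hf.inner ℝ hg)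
  have := (((key h1 h1).const_mul a).add ((key h1 h2).const_mul b)).add ((key h2 h2).const_mul c)
  have h3 : fderiv ℝ (quadForm a b c) x = _ := this.fderiv
  rw [h3]
  simp only [_root_.add_apply, _root_.smul_apply, ContinuousLinearMap.comp_apply,
    ContinuousLinearMap.prod_apply, ContinuousLinearMap.coe_fst', ContinuousLinearMap.coe_snd',
    fderivInnerCLM_apply, Complex.ofRealCLM_apply, smul_eq_mul]
  rw [real_inner_comm x.1 w.1, real_inner_comm x.2 w.1, real_inner_comm x.2 w.2]
  push_cast
  ring

theorem contDiff_exp_quadForm (a b c : ℂ) :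
    ContDiff ℝ ∞ fun x : t × t => Complex.exp (quadForm a b c x) :=
  (contDiff_quadForm a b c).cexp

/-- The Gaussian sections which are holomorphic. -/
theorem isHolomorphic_exp_quadForm {τ : UpperHalfPlane} {k : ℕ} {a b c : ℂ}
    (hb : b = 2 * τ * a + k * Real.pi * Complex.I)
    (hc : 2 * c = τ * (b + k * Real.pi * Complex.I)) :
    IsHolomorphic τ k fun x : t × t => Complex.exp (quadForm a b c x) := by
  intro x v
  have hd : ∀ w, fderiv ℝ (fun x : t × t => Complex.exp (quadForm a b c x)) x w =
      Complex.exp (quadForm a b c x) * fderiv ℝ (quadForm a b c) x w := fun w => by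
    have := ((contDiff_quadForm (t := t) a b c).differentiable (by simp) x).hasFDerivAt.cexp
    rw [this.fderiv]
    simp
  simp only [covDeriv, hd, fderiv_quadForm, primitive, inner_zero_right, Complex.div_I]
  push_cast
  linear_combination Complex.exp (quadForm a b c x) * (-(⟪x.1, v⟫_ℝ : ℝ) * hb -
    (⟪x.2, v⟫_ℝ : ℝ) * hc)

theorem baseSection_pow (τ : UpperHalfPlane) (k : ℕ) (x : t × t) :
    baseSection τ x ^ k = Complex.exp (quadForm 0 (k * Real.pi * Complex.I)
      (k * Real.pi * Complex.I * τ) x) := by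
  rw [baseSection, ← Complex.exp_nat_mul, quadForm]
  congr 1
  ring

/-- The linear form `x ↦ B(u, p) + τ B(u, q)`, that is `B(u, ζ)`. -/
def zetaForm (τ : UpperHalfPlane) (u : t) : (t × t) →L[ℝ] ℂ :=
  Complex.ofRealCLM.comp ((innerSL ℝ u).comp (ContinuousLinearMap.fst ℝ t t)) +
    (τ : ℂ) • Complex.ofRealCLM.comp ((innerSL ℝ u).comp (ContinuousLinearMap.snd ℝ t t))

theorem zetaForm_apply (τ : UpperHalfPlane) (u : t) (x : t × t) :
    zetaForm τ u x = (⟪u, x.1⟫_ℝ : ℝ) + τ * (⟪u, x.2⟫_ℝ : ℝ) := by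
  simp [zetaForm]

theorem norm_zetaForm_le (τ : UpperHalfPlane) (u : t) :
    ‖zetaForm τ u‖ ≤ (1 + ‖(τ : ℂ)‖) * ‖u‖ := by
  refine ContinuousLinearMap.opNorm_le_bound _ (by positivity) fun x => ?_
  rw [zetaForm_apply]
  have h1 : ‖((⟪u, x.1⟫_ℝ : ℝ) : ℂ)‖ ≤ ‖u‖ * ‖x‖ := by
    rw [Complex.norm_real]
    exact (norm_inner_le_norm u x.1).trans (by gcongr; exact norm_fst_le x)
  have h2 : ‖((⟪u, x.2⟫_ℝ : ℝ) : ℂ)‖ ≤ ‖u‖ * ‖x‖ := by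
    rw [Complex.norm_real]
    exact (norm_inner_le_norm u x.2).trans (by gcongr; exact norm_snd_le x)
  calc _ ≤ ‖u‖ * ‖x‖ + ‖(τ : ℂ)‖ * (‖u‖ * ‖x‖) := by
        refine (norm_add_le _ _).trans ?_
        rw [norm_mul]
        gcongr
    _ = _ := by ring

end Quadratic

/-! ### Absolute convergence under a Gaussian bound -/

section GaussianExpSum

/-- `norm_smul` for functionals with values in `ℂ`, stated separately because the instance search
for the general lemma is expensive when `V` is a product. -/
theorem norm_smul_clm {V : Type*} [NormedAddCommGroup V] [NormedSpace ℝ V] (c : ℂ)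
    (f : V →L[ℝ] ℂ) : ‖c • f‖ = ‖c‖ * ‖f‖ := norm_smul c f

variable {E V : Type*} [NormedAddCommGroup E] [NormedSpace ℝ E] [FiniteDimensional ℝ E]
  [NormedAddCommGroup V] [NormedSpace ℝ V]

theorem expSummable_of_gaussian (L : Submodule ℤ E) [DiscreteTopology L] {a : L → ℂ}
    {lam : L → V →L[ℝ] ℂ} {c C M : ℝ} (hc : 0 < c) (x : E)
    (ha : ∀ l, ‖a l‖ ≤ M * Real.exp (-c * ‖x + l‖ ^ 2)) (hl : ∀ l, ‖lam l‖ ≤ C * ‖x + l‖) :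
    ExpSummable a lam := by
  intro R
  refine Summable.of_nonneg_of_le (fun i => by positivity) (fun l => ?_)
    ((summable_exp_neg_sq_norm_add L hc (|R| * C) x).mul_left M)
  rw [Real.exp_add, ← mul_assoc]
  have h1 : R * ‖lam l‖ ≤ |R| * C * ‖x + l‖ := by
    calc R * ‖lam l‖ ≤ |R| * ‖lam l‖ := by gcongr; exact le_abs_self R
      _ ≤ |R| * (C * ‖x + l‖) := by gcongr; exact hl l
      _ = _ := by ring
  have := ha l
  gcongr
  exact (norm_nonneg _).trans this

end GaussianExpSum

/-! ### Theta functions -/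

section Theta

variable {t : Type*} [NormedAddCommGroup t] [InnerProductSpace ℝ t]

/-- The terms of the series of `Θ_{μ,k} s^k`:
`exp(iπk (τ |q - γ|² + B(p, q - 2γ)))`. -/
def thetaTerm (τ : UpperHalfPlane) (k : ℕ) (γ : t) (x : t × t) : ℂ :=
  Complex.exp (k * Real.pi * Complex.I *
    (τ * (⟪x.2 - γ, x.2 - γ⟫_ℝ : ℝ) + (⟪x.1, x.2 - (2 : ℝ) • γ⟫_ℝ : ℝ)))

theorem theta_mul_baseSection (Λ : Submodule ℤ t) (τ : UpperHalfPlane) (k : ℕ) (μ : t)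
    (x : t × t) :
    theta Λ τ k μ x * baseSection τ x ^ k = ∑' l : Λ, thetaTerm τ k (μ + l) x := by
  rw [theta, ← tsum_mul_right]
  congr 1
  ext l
  rw [baseSection, thetaTerm, ← Complex.exp_nat_mul, ← Complex.exp_add]
  congr 1
  generalize (μ + l : t) = γ
  simp only [inner_sub_left, inner_sub_right, real_inner_smul_right]
  rw [real_inner_comm x.2 γ]
  push_cast
  ring

theorem norm_thetaTerm (τ : UpperHalfPlane) (k : ℕ) (γ : t) (x : t × t) :
    ‖thetaTerm τ k γ x‖ = Real.exp (-(k * Real.pi * τ.im) * ‖x.2 - γ‖ ^ 2) := by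
  rw [thetaTerm, Complex.norm_exp, ← real_inner_self_eq_norm_sq]
  generalize ⟪x.2 - γ, x.2 - γ⟫_ℝ = N
  congr 1
  simp
  ring

theorem continuous_thetaTerm (τ : UpperHalfPlane) (k : ℕ) (γ : t) :
    Continuous (thetaTerm τ k γ) := by
  unfold thetaTerm
  fun_prop

/-- The terms of the theta series are exchanged by the action of the lattice. -/
theorem thetaTerm_add (Λ : Submodule ℤ t) (τ : UpperHalfPlane) {k : ℕ} {μ : t}
    (hμ : MemScaledDual Λ k μ) {γ : t × t} (h1 : γ.1 ∈ Λ) (x : t × t) :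
    thetaTerm τ k μ (x + γ) = latticeFactor γ x ^ k * thetaTerm τ k (μ - γ.2) x := by
  obtain ⟨m, hm⟩ := hμ _ h1
  rw [latticeFactor, ← Complex.exp_add, thetaTerm, thetaTerm, ← Complex.exp_nat_mul,
    ← Complex.exp_add, Complex.exp_eq_exp_iff_exists_int]
  refine ⟨-m, ?_⟩
  have hm' : (k : ℂ) * (⟪μ, γ.1⟫_ℝ : ℝ) = m := by exact_mod_cast hm
  have e1 : (x + γ).2 - μ = x.2 - (μ - γ.2) := by rw [Prod.snd_add]; abel
  rw [e1]
  simp only [omega, Prod.fst_add, Prod.snd_add, inner_add_left, inner_add_right, inner_sub_right,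
    real_inner_smul_right, smul_sub]
  rw [real_inner_comm γ.2 x.1, real_inner_comm μ γ.1] at *
  push_cast
  linear_combination (-2 * Real.pi * Complex.I) * hm'

theorem MemScaledDual.add {Λ : Submodule ℤ t} (hΛ : IsEvenLattice Λ) {k : ℕ} {μ l : t}
    (hμ : MemScaledDual Λ k μ) (hl : l ∈ Λ) : MemScaledDual Λ k (μ + l) := by
  intro x hx
  obtain ⟨m, hm⟩ := hμ x hx
  obtain ⟨m', hm'⟩ := hΛ.inner_int l hl x hx
  exact ⟨m + k * m', by rw [inner_add_left, mul_add, hm, hm']; push_cast; ring⟩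

theorem theta_add {Λ : Submodule ℤ t} (τ : UpperHalfPlane) (k : ℕ) (μ : t) {l : t} (hl : l ∈ Λ)
    (x : t × t) : theta Λ τ k (μ + l) x = theta Λ τ k μ x := by
  rw [theta, theta, ← (Equiv.addLeft (⟨l, hl⟩ : Λ)).tsum_eq (fun l' : Λ => Complex.exp
    (2 * Complex.I * Real.pi * k * ((τ : ℂ) / 2 * (⟪μ + l', μ + l'⟫_ℝ : ℝ) -
      ((⟪x.1, μ + l'⟫_ℝ : ℝ) + τ * (⟪x.2, μ + l'⟫_ℝ : ℝ)))))]
  simp only [Equiv.coe_addLeft, Submodule.coe_add, add_assoc]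

variable [FiniteDimensional ℝ t]

/-- The sections `Θ_{μ,k} s^k` are holomorphic sections of `L^k`. -/
theorem theta_mem {Λ : Submodule ℤ t} [DiscreteTopology Λ] (hΛ : IsEvenLattice Λ)
    (τ : UpperHalfPlane) {k : ℕ} (hk : 1 ≤ k) {μ : t} (hμ : MemScaledDual Λ k μ) :
    (fun x => theta Λ τ k μ x * baseSection τ x ^ k) ∈ QuantumSpace Λ τ k := by
  have hkpos : (0 : ℝ) < k := by exact_mod_cast hk
  set a : Λ → ℂ := fun l =>
    Complex.exp (2 * Complex.I * Real.pi * k * ((τ : ℂ) / 2 * (⟪μ + l, μ + l⟫_ℝ : ℝ))) with ha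
  set lam : Λ → (t × t) →L[ℝ] ℂ := fun l =>
    (-(2 * Complex.I * Real.pi * k)) • zetaForm τ (μ + l) with hlam
  have hES : ExpSummable a lam := by
    refine expSummable_of_gaussian Λ (c := k * Real.pi * τ.im) (M := 1)
      (C := ‖-(2 * Complex.I * Real.pi * k)‖ * (1 + ‖(τ : ℂ)‖))
      (by have := τ.im_pos; have := Real.pi_pos; positivity) μ (fun l => ?_) fun l => ?_
    · rw [one_mul, ha, Complex.norm_exp, ← real_inner_self_eq_norm_sq]
      apply le_of_eq
      generalize ⟪μ + (l : t), μ + (l : t)⟫_ℝ = N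
      congr 1
      simp
      ring
    · calc ‖lam l‖ = ‖-(2 * Complex.I * Real.pi * k)‖ * ‖zetaForm τ (μ + l)‖ :=
          norm_smul_clm _ _
        _ ≤ ‖-(2 * Complex.I * Real.pi * k)‖ * ((1 + ‖(τ : ℂ)‖) * ‖μ + (l : t)‖) := by
          gcongr
          exact norm_zetaForm_le _ _
        _ = _ := by ring
  have hth : ∀ x, theta Λ τ k μ x = ∑' l, a l * Complex.exp (lam l x) := by
    intro x
    rw [theta]
    congr 1
    ext l
    rw [ha, hlam, ← Complex.exp_add]
    congr 1
    simp only [_root_.smul_apply, zetaForm_apply, smul_eq_mul]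
    rw [real_inner_comm x.1, real_inner_comm x.2]
    ring
  have hfun : (fun x => theta Λ τ k μ x * baseSection τ x ^ k) = fun x =>
      Complex.exp (quadForm 0 (k * Real.pi * Complex.I) (k * Real.pi * Complex.I * τ) x) *
        ∑' l, a l * Complex.exp (lam l x) := by
    ext x
    rw [hth, baseSection_pow, mul_comm]
  refine ⟨?_, ?_, ?_⟩
  · rw [hfun]
    exact (contDiff_exp_quadForm _ _ _).mul hES.contDiff
  · intro γ h1 h2 x
    simp only [theta_mul_baseSection]
    rw [← (Equiv.addRight (⟨γ.2, h2⟩ : Λ)).tsum_eq, ← tsum_mul_left]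
    congr 1
    ext l
    rw [thetaTerm_add Λ τ (hμ.add hΛ (SetLike.coe_mem _)) h1]
    congr 2
    simp only [Equiv.coe_addRight, Submodule.coe_add]
    abel
  · rw [hfun]
    refine IsHolomorphic.mul (isHolomorphic_exp_quadForm (by ring) (by ring))
      ((contDiff_exp_quadForm _ _ _).differentiable (by simp))
      (hES.contDiff.differentiable (by simp)) (hES.fderiv_holomorphic fun l v => ?_)
    simp only [hlam, _root_.smul_apply, zetaForm_apply, smul_eq_mul, inner_zero_right]
    push_cast
    ring

end Theta

/-! ### Fourier coefficients of periodic functions -/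

section Fourier

open MeasureTheory

/-- The unit cube, over which Fourier coefficients are computed. -/
def unitCube (J : Type*) : Set (J → ℝ) := {x | ∀ i, x i ∈ Set.Ioc (0 : ℝ) 1}

theorem unitCube_subset {J : Type*} : unitCube J ⊆ Set.Icc 0 1 := fun _ hx =>
  ⟨fun i => (hx i).1.le, fun i => (hx i).2⟩

/-- Periodicity under the standard lattice. -/
def IsPeriodic {J : Type*} (f : (J → ℝ) → ℂ) : Prop :=
  ∀ (m : J → ℤ) (x : J → ℝ), f (x + fun i => (m i : ℝ)) = f x

/-- A continuous periodic function descends to the torus. -/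
theorem IsPeriodic.exists_lift {J : Type*} {f : (J → ℝ) → ℂ} (hp : IsPeriodic f)
    (hf : Continuous f) :
    ∃ F : C(UnitAddTorus J, ℂ), ∀ x : J → ℝ, F (fun i => (x i : UnitAddCircle)) = f x := by
  have hq : IsOpenQuotientMap (fun (x : J → ℝ) (i : J) => (x i : UnitAddCircle)) :=
    IsOpenQuotientMap.piMap (f := fun _ (y : ℝ) => (y : UnitAddCircle)) fun _ =>
      QuotientAddGroup.isOpenQuotientMap_mk
  have hfac : Function.FactorsThrough f (fun (x : J → ℝ) (i : J) => (x i : UnitAddCircle)) := by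
    intro x y hxy
    have : ∀ i, ∃ m : ℤ, y i = x i + m := by
      intro i
      have h1 := congrFun hxy i
      simp only at h1
      rw [← sub_eq_zero, ← AddCircle.coe_sub, AddCircle.coe_eq_zero_iff] at h1
      obtain ⟨m, hm⟩ := h1
      refine ⟨-m, ?_⟩
      rw [zsmul_one] at hm
      push_cast
      linarith
    choose m hm using this
    rw [← hp m x]
    congr 1
    ext i
    exact (hm i).symm
  let q : C(J → ℝ, UnitAddTorus J) := ⟨_, hq.continuous⟩
  have hq' : Topology.IsQuotientMap q := hq.isQuotientMap
  refine ⟨hq'.lift ⟨f, hf⟩ hfac, fun x => ?_⟩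
  exact congrFun (congrArg DFunLike.coe (hq'.lift_comp ⟨f, hf⟩ hfac)) x

variable {J : Type*} [Fintype J]

theorem measurableSet_unitCube : MeasurableSet (unitCube J) :=
  MeasurableSet.univ_pi' (fun _ => measurableSet_Ioc)

theorem volume_unitCube : volume (unitCube J) = 1 := by
  have : unitCube J = Set.pi Set.univ fun _ => Set.Ioc (0 : ℝ) 1 := by
    ext x
    simp [unitCube]
  rw [this, Real.volume_pi_Ioc]
  simp

theorem integrableOn_unitCube {f : (J → ℝ) → ℂ} (hf : Continuous f) :
    IntegrableOn f (unitCube J) :=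
  (hf.continuousOn.integrableOn_compact isCompact_Icc).mono_set unitCube_subset

/-- The Haar probability measure of the torus. -/
def torusMeasure (J : Type*) [Fintype J] : Measure (UnitAddTorus J) :=
  Measure.pi fun _ => AddCircle.haarAddCircle

theorem setIntegral_unitCube_eq (F : UnitAddTorus J → ℂ) :
    ∫ x in unitCube J, F (fun i => (x i : UnitAddCircle)) = ∫ θ, F θ ∂(torusMeasure J) := by
  refine Eq.trans ?_ (UnitAddTorus.integral_preimage F 0).symm
  simp [unitCube]

theorem IsPeriodic.setIntegral_add {f : (J → ℝ) → ℂ} (hp : IsPeriodic f) (hf : Continuous f)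
    (a : J → ℝ) : ∫ x in unitCube J, f (x + a) = ∫ x in unitCube J, f x := by
  obtain ⟨F, hF⟩ := hp.exists_lift hf
  have h1 : ∫ x in unitCube J, f x = ∫ θ, F θ ∂(torusMeasure J) := by
    rw [← setIntegral_unitCube_eq]
    simp only [hF]
  have h2 : ∫ x in unitCube J, f (x + a) =
      ∫ θ, F (θ + fun i => (a i : UnitAddCircle)) ∂(torusMeasure J) := by
    rw [← setIntegral_unitCube_eq]
    congr 1
    ext x
    rw [← hF]
    rfl
  rw [h1, h2]
  have : (torusMeasure J).IsAddRightInvariant := by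
    unfold torusMeasure
    infer_instance
  exact integral_add_right_eq_self (μ := torusMeasure J) F _

/-- The standard characters. -/
def cubeChar (n : J → ℤ) (x : J → ℝ) : ℂ :=
  Complex.exp (2 * Real.pi * Complex.I * ((∑ i, (n i : ℝ) * x i : ℝ) : ℂ))

theorem continuous_cubeChar (n : J → ℤ) : Continuous (cubeChar n) := by
  unfold cubeChar
  fun_prop

theorem cubeChar_add (n : J → ℤ) (x y : J → ℝ) :
    cubeChar n (x + y) = cubeChar n x * cubeChar n y := by
  rw [cubeChar, cubeChar, cubeChar, ← Complex.exp_add]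
  congr 1
  simp only [Pi.add_apply, mul_add, Finset.sum_add_distrib]
  push_cast
  ring

theorem isPeriodic_cubeChar (n : J → ℤ) : IsPeriodic (cubeChar n) := by
  intro m x
  rw [cubeChar_add]
  suffices cubeChar n (fun i => (m i : ℝ)) = 1 by rw [this, mul_one]
  rw [cubeChar, Complex.exp_eq_one_iff]
  exact ⟨∑ i, n i * m i, by push_cast; ring⟩

theorem setIntegral_cubeChar (n : J → ℤ) :
    ∫ x in unitCube J, cubeChar n x = if n = 0 then 1 else 0 := by
  classical
  split_ifs with h
  · simp [h, cubeChar, Measure.real, volume_unitCube]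
  · obtain ⟨j, hj⟩ := Function.ne_iff.mp h
    have hj' : (n j : ℝ) ≠ 0 := by exact_mod_cast hj
    -- translating by a half-period changes the sign of the character
    have h1 := (isPeriodic_cubeChar n).setIntegral_add (continuous_cubeChar n)
      (Pi.single j (1 / (2 * (n j : ℝ))))
    have h2 : cubeChar n (Pi.single j (1 / (2 * (n j : ℝ)))) = -1 := by
      rw [cubeChar, ← Complex.exp_pi_mul_I]
      congr 1
      have : (∑ i, (n i : ℝ) * (Pi.single j (1 / (2 * (n j : ℝ))) : J → ℝ) i) = 1 / 2 := by
        rw [Finset.sum_eq_single j]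
        · simp only [Pi.single_eq_same]
          field_simp
        · intro i _ hi
          simp [Pi.single_eq_of_ne hi]
        · simp
      rw [this]
      push_cast
      ring
    simp only [cubeChar_add, h2, mul_neg, mul_one, integral_neg] at h1
    linear_combination (-1 / 2 : ℂ) * h1

theorem mFourier_coe (n : J → ℤ) (x : J → ℝ) :
    UnitAddTorus.mFourier n (fun i => (x i : UnitAddCircle)) = cubeChar n x := by
  simp only [UnitAddTorus.mFourier, ContinuousMap.coe_mk, fourier_coe_apply, cubeChar]
  rw [← Complex.exp_sum]
  congr 1
  push_cast
  rw [Finset.mul_sum]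
  refine Finset.sum_congr rfl fun i _ => ?_
  ring

/-- A continuous periodic function with vanishing Fourier coefficients vanishes. -/
theorem IsPeriodic.eq_zero {f : (J → ℝ) → ℂ} (hp : IsPeriodic f) (hf : Continuous f)
    (h : ∀ n : J → ℤ, ∫ x in unitCube J, cubeChar n x * f x = 0) : f = 0 := by
  obtain ⟨F, hF⟩ := hp.exists_lift hf
  have h0 : UnitAddTorus.mFourierCoeff F = 0 := by
    ext n
    refine (setIntegral_unitCube_eq fun θ => UnitAddTorus.mFourier (-n) θ • F θ).symm.trans ?_
    simp only [hF, mFourier_coe, smul_eq_mul]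
    exact h (-n)
  have hs : Summable (UnitAddTorus.mFourierCoeff F) := by
    rw [h0]
    exact summable_zero
  ext x
  have := UnitAddTorus.hasSum_mFourier_series_apply_of_summable hs (fun i => (x i : UnitAddCircle))
  rw [h0, hF] at this
  simp only [Pi.zero_apply, zero_smul] at this
  exact this.unique hasSum_zero

theorem hasDerivAt_setIntegral_unitCube {F F' : ℝ → (J → ℝ) → ℂ}
    (hF : Continuous (Function.uncurry F)) (hF' : Continuous (Function.uncurry F'))
    (hd : ∀ s x, HasDerivAt (fun s => F s x) (F' s x) s) (s : ℝ) :
    HasDerivAt (fun s => ∫ x in unitCube J, F s x) (∫ x in unitCube J, F' s x) s := by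
  obtain ⟨C, hC⟩ := ((isCompact_Icc (a := s - 1) (b := s + 1)).prod
    (isCompact_Icc (a := (0 : J → ℝ)) (b := 1))).exists_bound_of_continuousOn hF'.continuousOn
  have hc : ∀ r, Continuous (F r) := fun r => hF.comp (Continuous.prodMk_right r)
  have hc' : ∀ r, Continuous (F' r) := fun r => hF'.comp (Continuous.prodMk_right r)
  refine (hasDerivAt_integral_of_dominated_loc_of_deriv_le (bound := fun _ => C)
    (Icc_mem_nhds (by linarith : s - 1 < s) (by linarith : s < s + 1))
    (Filter.Eventually.of_forall fun r => (hc r).aestronglyMeasurable)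
    (integrableOn_unitCube (hc s)) (hc' s).aestronglyMeasurable ?_ ?_ ?_).2
  · filter_upwards [ae_restrict_mem measurableSet_unitCube] with x hx r hr
    exact hC (r, x) ⟨hr, unitCube_subset hx⟩
  · exact integrableOn_const (by simp [volume_unitCube])
  · exact Filter.Eventually.of_forall fun x r _ => hd r x

end Fourier

/-! ### Expansion of holomorphic sections in theta functions -/

section Coefficients

open MeasureTheory

theorem MemScaledDual.exp_eq_one {t : Type*} [NormedAddCommGroup t]
    [InnerProductSpace ℝ t] {Λ : Submodule ℤ t} {k : ℕ} {μ l : t}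
    (hμ : MemScaledDual Λ k μ) (hl : l ∈ Λ) :
    Complex.exp (2 * Real.pi * Complex.I * (k * ⟪μ, l⟫_ℝ : ℝ)) = 1 := by
  obtain ⟨m, hm⟩ := hμ l hl
  rw [hm, Complex.exp_eq_one_iff]
  exact ⟨m, by push_cast; ring⟩

theorem MemScaledDual.sub {t : Type*} [NormedAddCommGroup t]
    [InnerProductSpace ℝ t] {Λ : Submodule ℤ t} {k : ℕ} {μ ν : t}
    (hμ : MemScaledDual Λ k μ) (hν : MemScaledDual Λ k ν) :
    MemScaledDual Λ k (μ - ν) := by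
  intro l hl
  obtain ⟨m, hm⟩ := hμ l hl
  obtain ⟨m', hm'⟩ := hν l hl
  exact ⟨m - m', by rw [inner_sub_left, mul_sub, hm, hm']; push_cast; ring⟩

variable {t J : Type*} [NormedAddCommGroup t] [InnerProductSpace ℝ t] [FiniteDimensional ℝ t]
  [Fintype J] (b : Module.Basis J ℝ t)

theorem equivFunL_symm_intCast_mem (m : J → ℤ) :
    b.equivFunL.symm (fun j => (m j : ℝ)) ∈ Submodule.span ℤ (Set.range b) := by
  have : b.equivFunL.symm (fun j => (m j : ℝ)) = ∑ j, m j • b j := by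
    change b.equivFun.symm _ = _
    simp [Module.Basis.equivFun_symm_apply, Int.cast_smul_eq_zsmul]
  rw [this]
  exact Submodule.sum_mem _ fun j _ => Submodule.smul_mem _ _ (Submodule.subset_span ⟨j, rfl⟩)

theorem isPeriodic_of_lattice {f : t → ℂ}
    (hf : ∀ a ∈ Submodule.span ℤ (Set.range b), ∀ p, f (p + a) = f p) :
    IsPeriodic fun x => f (b.equivFunL.symm x) := fun m x => by
  simp only [map_add]
  exact hf _ (equivFunL_symm_intCast_mem b m) _

/-- The mean over `p` of a holomorphic function of `p + τ q`, periodic in `p`, does not depend on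
`q`: its derivative in `q` is `τ` times the mean of a derivative in `p`. -/
theorem setIntegral_eq_of_holomorphic {u : t × t → ℂ} (hu : ContDiff ℝ ∞ u) {τ : ℂ}
    (hp : ∀ a ∈ Submodule.span ℤ (Set.range b), ∀ p q, u (p + a, q) = u (p, q))
    (hol : ∀ (x : t × t) (v : t), τ * fderiv ℝ u x (v, 0) - fderiv ℝ u x (0, v) = 0) (q : t) :
    ∫ x in unitCube J, u (b.equivFunL.symm x, q) =
      ∫ x in unitCube J, u (b.equivFunL.symm x, 0) := by
  have hdu : ∀ x, HasFDerivAt u (fderiv ℝ u x) x := fun x =>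
    (hu.differentiable (by simp) x).hasFDerivAt
  have hcu : Continuous u := hu.continuous
  have hcd : ∀ w, Continuous fun x => fderiv ℝ u x w := fun w =>
    (hu.continuous_fderiv (by simp)).clm_apply continuous_const
  have hP : Continuous b.equivFunL.symm := b.equivFunL.symm.continuous
  -- the derivative along the second factor
  have h1 : ∀ s : ℝ, HasDerivAt (fun s : ℝ => ∫ x in unitCube J, u (b.equivFunL.symm x, s • q))
      (∫ x in unitCube J, fderiv ℝ u (b.equivFunL.symm x, s • q) (0, q)) s := by
    refine hasDerivAt_setIntegral_unitCube ?_ ?_ fun s x => ?_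
    · exact hcu.comp (by fun_prop)
    · exact (hcd (0, q)).comp (by fun_prop)
    · have hline : HasDerivAt (fun s : ℝ => ((b.equivFunL.symm x, s • q) : t × t)) (0, q) s := by
        refine (hasDerivAt_const _ _).prodMk ?_
        simpa using (hasDerivAt_id s).smul_const q
      exact (hdu _).comp_hasDerivAt s hline
  -- the derivative along the first factor
  have h2 : ∀ s : ℝ, HasDerivAt
      (fun r : ℝ => ∫ x in unitCube J, u (b.equivFunL.symm x + r • q, s • q))
      (∫ x in unitCube J, fderiv ℝ u (b.equivFunL.symm x + (0 : ℝ) • q, s • q) (q, 0)) 0 := by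
    intro s
    refine hasDerivAt_setIntegral_unitCube
      (F := fun r x => u (b.equivFunL.symm x + r • q, s • q))
      (F' := fun r x => fderiv ℝ u (b.equivFunL.symm x + r • q, s • q) (q, 0)) ?_ ?_
      (fun r x => ?_) 0
    · exact hcu.comp (by fun_prop)
    · exact (hcd (q, 0)).comp (by fun_prop)
    · have hline : HasDerivAt (fun r : ℝ => ((b.equivFunL.symm x + r • q, s • q) : t × t))
          (q, 0) r := by
        refine HasDerivAt.prodMk ?_ (hasDerivAt_const _ _)
        simpa using ((hasDerivAt_id r).smul_const q).const_add (b.equivFunL.symm x)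
      exact (hdu _).comp_hasDerivAt r hline
  have h3 : ∀ s : ℝ, ∫ x in unitCube J, fderiv ℝ u (b.equivFunL.symm x, s • q) (q, 0) = 0 := by
    intro s
    have hconst : (fun r : ℝ => ∫ x in unitCube J, u (b.equivFunL.symm x + r • q, s • q)) =
        fun _ => ∫ x in unitCube J, u (b.equivFunL.symm x, s • q) := by
      ext r
      have := (isPeriodic_of_lattice b (f := fun p => u (p, s • q))
        fun a ha p => hp a ha p (s • q)).setIntegral_add (hcu.comp (by fun_prop))
        (b.equivFunL (r • q))
      simpa using this
    have := h2 s
    rw [hconst] at this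
    simpa using this.unique (hasDerivAt_const _ _)
  have h4 : ∀ s : ℝ, HasDerivAt
      (fun s : ℝ => ∫ x in unitCube J, u (b.equivFunL.symm x, s • q)) 0 s := by
    intro s
    have := h1 s
    have e : ∀ x : J → ℝ, fderiv ℝ u (b.equivFunL.symm x, s • q) (0, q) =
        τ * fderiv ℝ u (b.equivFunL.symm x, s • q) (q, 0) := fun x =>
      (sub_eq_zero.mp (hol _ _)).symm
    simp only [e] at this
    rw [integral_const_mul, h3, mul_zero] at this
    exact this
  have := is_const_of_deriv_eq_zero (fun s => (h4 s).differentiableAt) (fun s => (h4 s).deriv) 1 0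
  simpa using this

variable {Λ : Submodule ℤ t}

/-- The coefficient of a holomorphic section on the theta function `Θ_{μ,k} s^k`, computed as a
Fourier coefficient along `q = 0`. -/
def thetaCoeff (τ : UpperHalfPlane) (k : ℕ) (μ : t) (σ : t × t → ℂ) : ℂ :=
  Complex.exp (-(Complex.I * Real.pi * k * τ * (⟪μ, μ⟫_ℝ : ℝ))) *
    ∫ x in unitCube J, σ (b.equivFunL.symm x, 0) *
      Complex.exp (2 * Real.pi * Complex.I * (k * ⟪μ, b.equivFunL.symm x⟫_ℝ : ℝ))

/-- The Fourier coefficients of a holomorphic section along any `q` are determined by those along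
`q = 0`. -/
theorem setIntegral_section_eq (hb : Submodule.span ℤ (Set.range b) = Λ) {τ : UpperHalfPlane}
    {k : ℕ} {σ : t × t → ℂ} (hσ : σ ∈ QuantumSpace Λ τ k) {μ : t} (hμ : MemScaledDual Λ k μ)
    (q : t) :
    ∫ x in unitCube J, σ (b.equivFunL.symm x, q) *
      Complex.exp (quadForm 0 (-(Complex.I * Real.pi * k)) (-(Complex.I * Real.pi * k * τ))
        (b.equivFunL.symm x, q) +
        2 * Real.pi * Complex.I * k * zetaForm τ μ (b.equivFunL.symm x, q)) =
    ∫ x in unitCube J, σ (b.equivFunL.symm x, 0) *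
      Complex.exp (2 * Real.pi * Complex.I * (k * ⟪μ, b.equivFunL.symm x⟫_ℝ : ℝ)) := by
  obtain ⟨hs, hsec, hhol⟩ := hσ
  set Q : t × t → ℂ := quadForm 0 (-(Complex.I * Real.pi * k)) (-(Complex.I * Real.pi * k * τ))
    with hQ
  have hQs : ContDiff ℝ ∞ Q := contDiff_quadForm _ _ _
  set φ : t × t → ℂ := fun x => Q x + 2 * Real.pi * Complex.I * k * zetaForm τ μ x with hφ
  have hφs : ContDiff ℝ ∞ φ := hQs.add (contDiff_const.mul (zetaForm τ μ).contDiff)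
  have hdφ : ∀ x w, fderiv ℝ φ x w = fderiv ℝ Q x w +
      2 * Real.pi * Complex.I * k * zetaForm τ μ w := by
    intro x w
    have h1 : HasFDerivAt φ _ x := ((hQs.differentiable (by simp) x).hasFDerivAt).add
      (((zetaForm τ μ).hasFDerivAt (x := x)).const_mul (2 * Real.pi * Complex.I * k))
    rw [h1.fderiv]
    simp
  have hdu : ∀ x w, fderiv ℝ (fun x => σ x * Complex.exp (φ x)) x w =
      Complex.exp (φ x) * (fderiv ℝ σ x w + σ x * fderiv ℝ φ x w) := by
    intro x w
    have h1 := ((hs.differentiable (by simp) x).hasFDerivAt).mul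
      ((hφs.differentiable (by simp) x).hasFDerivAt.cexp)
    have h2 : fderiv ℝ (fun x => σ x * Complex.exp (φ x)) x = _ := h1.fderiv
    rw [h2]
    simp only [_root_.add_apply, _root_.smul_apply, smul_eq_mul]
    ring
  have key := setIntegral_eq_of_holomorphic b (u := fun x => σ x * Complex.exp (φ x))
    (hs.mul hφs.cexp) (τ := τ) (fun a ha p q => ?_) (fun x v => ?_) q
  · refine Eq.trans key (congrArg _ (funext fun x => ?_))
    simp only [hφ, hQ, quadForm, zetaForm_apply, inner_zero_right]
    congr 2
    push_cast
    ring
  · rw [hb] at ha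
    have h1 := hsec (a, 0) ha Λ.zero_mem (p, q)
    have h2 : ((p, q) : t × t) + (a, 0) = (p + a, q) := by simp
    rw [h2] at h1
    simp only [h1]
    have h3 := hμ.exp_eq_one ha
    rw [latticeFactor, ← Complex.exp_add, ← Complex.exp_nat_mul]
    have h4 : φ (p + a, q) = φ (p, q) - Complex.I * Real.pi * k * (⟪a, q⟫_ℝ : ℝ) +
        2 * Real.pi * Complex.I * (k * ⟪μ, a⟫_ℝ : ℝ) := by
      simp only [hφ, hQ, quadForm, zetaForm_apply, inner_add_left, inner_add_right]
      push_cast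
      ring
    rw [h4, Complex.exp_add, h3, mul_one, mul_comm (Complex.exp _) (σ _), mul_assoc,
      ← Complex.exp_add]
    congr 2
    simp only [omega, inner_zero_right, inner_zero_left]
    push_cast
    ring
  · have h1 := hhol x v
    simp only [covDeriv, primitive, inner_zero_right, Complex.div_I] at h1
    simp only [hdu, hdφ, hQ, fderiv_quadForm, zetaForm_apply, inner_zero_right]
    push_cast at h1 ⊢
    linear_combination Complex.exp (φ x) * h1

/-- The coefficients only depend on the class of `μ` modulo the lattice. -/
theorem thetaCoeff_add (hΛ : IsEvenLattice Λ) (hb : Submodule.span ℤ (Set.range b) = Λ)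
    {τ : UpperHalfPlane} {k : ℕ} {σ : t × t → ℂ} (hσ : σ ∈ QuantumSpace Λ τ k) {μ : t}
    (hμ : MemScaledDual Λ k μ) {l : t} (hl : l ∈ Λ) :
    thetaCoeff b τ k (μ + l) σ = thetaCoeff b τ k μ σ := by
  have h := setIntegral_section_eq b hb hσ (hμ.add hΛ hl) l
  rw [thetaCoeff, ← h, thetaCoeff, ← integral_const_mul, ← integral_const_mul]
  refine congrArg _ (funext fun x => ?_)
  have h1 := hσ.2.1 (0, l) Λ.zero_mem hl (b.equivFunL.symm x, 0)
  have h2 : ((b.equivFunL.symm x, 0) : t × t) + (0, l) = (b.equivFunL.symm x, l) := by simp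
  rw [h2] at h1
  rw [h1, latticeFactor, ← Complex.exp_add, ← Complex.exp_nat_mul,
    mul_comm (Complex.exp _) (σ _), mul_assoc (σ _), ← Complex.exp_add, mul_left_comm,
    ← Complex.exp_add, mul_left_comm, ← Complex.exp_add]
  congr 2
  simp only [quadForm, zetaForm_apply, omega, inner_zero_left, inner_add_left, inner_add_right]
  rw [real_inner_comm l μ, real_inner_comm l (b.equivFunL.symm x)]
  push_cast
  ring

/-- The integer coordinates of an element of the scaled dual lattice. -/
theorem MemScaledDual.exists_cubeChar (hb : Submodule.span ℤ (Set.range b) = Λ) {k : ℕ}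
    (hk : 1 ≤ k) {ν : t} (hν : MemScaledDual Λ k ν) :
    ∃ n : J → ℤ, (n = 0 ↔ ν = 0) ∧ ∀ x,
      Complex.exp (2 * Real.pi * Complex.I * (k * ⟪ν, b.equivFunL.symm x⟫_ℝ : ℝ)) =
        cubeChar n x := by
  have hbΛ : ∀ j, b j ∈ Λ := fun j => hb ▸ Submodule.subset_span ⟨j, rfl⟩
  choose n hn using fun j => hν (b j) (hbΛ j)
  have hk0 : (k : ℝ) ≠ 0 := by positivity
  refine ⟨n, ⟨fun h => ?_, fun h => ?_⟩, fun x => ?_⟩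
  · refine InnerProductSpace.ext_inner_right_basis b fun j => ?_
    have := hn j
    simpa [h, hk0] using this
  · ext j
    have := hn j
    rw [h, inner_zero_left, mul_zero] at this
    exact_mod_cast this.symm
  · rw [cubeChar]
    congr 3
    change k * ⟪ν, b.equivFun.symm x⟫_ℝ = _
    rw [Module.Basis.equivFun_symm_apply, inner_sum, Finset.mul_sum]
    refine Finset.sum_congr rfl fun j _ => ?_
    rw [real_inner_smul_right, ← hn]
    ring

theorem exists_memScaledDual_cubeChar (hb : Submodule.span ℤ (Set.range b) = Λ) {k : ℕ}
    (hk : 1 ≤ k) (n : J → ℤ) : ∃ μ, MemScaledDual Λ k μ ∧ ∀ x,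
      Complex.exp (2 * Real.pi * Complex.I * (k * ⟪μ, b.equivFunL.symm x⟫_ℝ : ℝ)) =
        cubeChar n x := by
  have hk0 : (k : ℝ) ≠ 0 := by positivity
  obtain ⟨μ, hμ⟩ : ∃ μ : t, ∀ v, (k : ℝ) * ⟪μ, v⟫_ℝ = ∑ j, (n j : ℝ) * b.equivFunL v j := by
    let f : t →ₗ[ℝ] ℝ := ∑ j, (n j : ℝ) • (LinearMap.proj j ∘ₗ b.equivFun.toLinearMap)
    refine ⟨(k : ℝ)⁻¹ • (InnerProductSpace.toDual ℝ t).symm f.toContinuousLinearMap, fun v => ?_⟩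
    rw [real_inner_smul_left, mul_inv_cancel_left₀ hk0, InnerProductSpace.toDual_symm_apply]
    simp [f]
  refine ⟨μ, fun l hl => ?_, fun x => ?_⟩
  · rw [hμ]
    rw [← hb] at hl
    have : ∀ j, ∃ m : ℤ, b.repr l j = m := fun j => by
      obtain ⟨m, hm⟩ := (b.mem_span_iff_repr_mem ℤ l).mp hl j
      exact ⟨m, by simpa using hm.symm⟩
    choose m hm using this
    refine ⟨∑ j, n j * m j, ?_⟩
    push_cast
    refine Finset.sum_congr rfl fun j _ => ?_
    rw [← hm]
    simp
  · rw [hμ, cubeChar, ContinuousLinearEquiv.apply_symm_apply]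

/-- Holomorphic sections with vanishing coefficients vanish. -/
theorem eq_zero_of_thetaCoeff_eq_zero (hb : Submodule.span ℤ (Set.range b) = Λ)
    {τ : UpperHalfPlane} {k : ℕ} (hk : 1 ≤ k) {σ : t × t → ℂ} (hσ : σ ∈ QuantumSpace Λ τ k)
    (h : ∀ μ, MemScaledDual Λ k μ → thetaCoeff b τ k μ σ = 0) : σ = 0 := by
  have hcσ : Continuous σ := hσ.1.continuous
  suffices H : ∀ q, (fun x => σ (b.equivFunL.symm x, q) * Complex.exp (-(Complex.I * Real.pi * k *
      (⟪b.equivFunL.symm x, q⟫_ℝ : ℝ)))) = 0 by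
    ext ⟨p, q⟩
    have := congrFun (H q) (b.equivFunL p)
    simpa using this
  intro q
  refine IsPeriodic.eq_zero ?_ ?_ fun n => ?_
  · refine isPeriodic_of_lattice b (f := fun p => σ (p, q) * Complex.exp (-(Complex.I * Real.pi *
      k * (⟪p, q⟫_ℝ : ℝ)))) fun a ha p => ?_
    rw [hb] at ha
    have h1 := hσ.2.1 (a, 0) ha Λ.zero_mem (p, q)
    have h2 : ((p, q) : t × t) + (a, 0) = (p + a, q) := by simp
    rw [h2] at h1
    rw [h1, latticeFactor, ← Complex.exp_add, ← Complex.exp_nat_mul,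
      mul_comm (Complex.exp _) (σ _), mul_assoc, ← Complex.exp_add]
    congr 2
    simp only [omega, inner_zero_right, inner_zero_left, inner_add_left]
    push_cast
    ring
  · refine (hcσ.comp (by fun_prop)).mul (Complex.continuous_exp.comp ?_)
    fun_prop
  · obtain ⟨μ, hμ, hn⟩ := exists_memScaledDual_cubeChar b hb hk n
    have h1 := h μ hμ
    rw [thetaCoeff, mul_eq_zero, or_iff_right (Complex.exp_ne_zero _),
      ← setIntegral_section_eq b hb hσ hμ q] at h1
    -- the factor depending on `q` only
    have h2 : ∀ x : J → ℝ, cubeChar n x * (σ (b.equivFunL.symm x, q) * Complex.exp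
        (-(Complex.I * Real.pi * k * (⟪b.equivFunL.symm x, q⟫_ℝ : ℝ)))) =
        Complex.exp (Complex.I * Real.pi * k * τ * (⟪q, q⟫_ℝ - 2 * ⟪μ, q⟫_ℝ : ℝ)) *
        (σ (b.equivFunL.symm x, q) *
      Complex.exp (quadForm 0 (-(Complex.I * Real.pi * k)) (-(Complex.I * Real.pi * k * τ))
        (b.equivFunL.symm x, q) +
        2 * Real.pi * Complex.I * k * zetaForm τ μ (b.equivFunL.symm x, q))) := by
      intro x
      rw [← hn, mul_left_comm, ← Complex.exp_add, mul_left_comm, ← Complex.exp_add]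
      congr 2
      simp only [quadForm, zetaForm_apply]
      push_cast
      ring
    simp only [h2]
    rw [integral_const_mul, h1, mul_zero]

open Classical in
/-- The coefficients of the theta functions themselves. -/
theorem thetaCoeff_theta [DiscreteTopology Λ] [IsZLattice ℝ Λ] (hΛ : IsEvenLattice Λ)
    (hb : Submodule.span ℤ (Set.range b) = Λ) (τ : UpperHalfPlane) {k : ℕ} (hk : 1 ≤ k) {μ ν : t}
    (hμ : MemScaledDual Λ k μ) (hν : MemScaledDual Λ k ν) :
    thetaCoeff b τ k ν (fun x => theta Λ τ k μ x * baseSection τ x ^ k) =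
      if ν - μ ∈ Λ then 1 else 0 := by
  have hkpos : (0 : ℝ) < k := by exact_mod_cast hk
  have hτ := τ.im_pos
  set A : Λ → ℂ := fun l =>
    Complex.exp (Complex.I * Real.pi * k * τ * (⟪μ + l, μ + l⟫_ℝ : ℝ)) with hA
  set F : Λ → (J → ℝ) → ℂ := fun l x => A l *
    Complex.exp (2 * Real.pi * Complex.I * (k * ⟪ν - (μ + l), b.equivFunL.symm x⟫_ℝ : ℝ)) with hF
  have hnormA : ∀ l, ‖A l‖ = Real.exp (-(k * Real.pi * τ.im) * ‖μ + l‖ ^ 2) := by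
    intro l
    rw [hA, Complex.norm_exp, ← real_inner_self_eq_norm_sq]
    generalize ⟪μ + (l : t), μ + (l : t)⟫_ℝ = N
    have e : Complex.I * Real.pi * k * τ * (N : ℂ) =
        ((k * Real.pi * N : ℝ) : ℂ) * (Complex.I * τ) := by
      push_cast
      ring
    rw [e, Complex.re_ofReal_mul]
    congr 1
    simp
    ring
  have hnorm : ∀ l x, ‖F l x‖ = ‖A l‖ := by
    intro l x
    have : 2 * Real.pi * Complex.I * ((k * ⟪ν - (μ + l), b.equivFunL.symm x⟫_ℝ : ℝ) : ℂ) =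
      ((2 * Real.pi * (k * ⟪ν - (μ + l), b.equivFunL.symm x⟫_ℝ) : ℝ) : ℂ) * Complex.I := by
      push_cast
      ring
    rw [hF, norm_mul, this, Complex.norm_exp_ofReal_mul_I, mul_one]
  have hval : ∀ l, ∫ x in unitCube J, F l x = if ν - (μ + l) = 0 then A l else 0 := by
    intro l
    obtain ⟨n, hn, hc⟩ := (hν.sub (hμ.add hΛ l.2)).exists_cubeChar b hb hk
    simp only [hF, hc]
    rw [integral_const_mul, setIntegral_cubeChar]
    simp [hn]
  have hsum : HasSum (fun l => ∫ x in unitCube J, F l x) (∫ x in unitCube J, ∑' l, F l x) := by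
    refine hasSum_integral_of_summable_integral_norm (fun l => ?_) ?_
    · exact integrableOn_unitCube (by simp only [hF]; fun_prop)
    · have hv : volume.real (unitCube J) = 1 := by simp [Measure.real, volume_unitCube]
      simp only [hnorm, integral_const, measureReal_restrict_apply_univ, hv, one_smul, hnormA]
      simpa using summable_exp_neg_sq_norm_add Λ
        (c := k * Real.pi * τ.im) (by have := Real.pi_pos; positivity) 0 μ
  have hint : ∀ x : J → ℝ, theta Λ τ k μ (b.equivFunL.symm x, 0) *
      baseSection τ (b.equivFunL.symm x, 0) ^ k *
      Complex.exp (2 * Real.pi * Complex.I * (k * ⟪ν, b.equivFunL.symm x⟫_ℝ : ℝ)) =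
      ∑' l, F l x := by
    intro x
    rw [theta_mul_baseSection, ← tsum_mul_right]
    refine tsum_congr fun l => ?_
    simp only [hF, hA, thetaTerm]
    rw [← Complex.exp_add, ← Complex.exp_add]
    congr 1
    simp only [zero_sub, inner_neg_left, inner_neg_right, real_inner_smul_right, inner_sub_left]
    rw [real_inner_comm (μ + (l : t)) (b.equivFunL.symm x)]
    push_cast
    ring
  rw [thetaCoeff]
  simp only [hint]
  rw [← hsum.tsum_eq]
  simp only [hval]
  split_ifs with h
  · rw [tsum_eq_single ⟨ν - μ, h⟩]
    · have e : μ + (ν - μ) = ν := by abel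
      simp only [hA, e, sub_self, if_true]
      rw [← Complex.exp_add, Complex.exp_eq_one_iff]
      exact ⟨0, by push_cast; ring⟩
    · intro l hl
      rw [if_neg]
      intro h0
      apply hl
      ext
      rw [← sub_eq_zero, ← neg_eq_zero, ← h0]
      simp only
      abel
  · have : ∀ l : Λ, ν - (μ + l) ≠ 0 := by
      intro l h0
      apply h
      have : ν - μ = l := by
        rw [← sub_eq_zero, ← h0]
        abel
      rw [this]
      exact l.2
    simp [this]

/-- The coefficient on `Θ_{μ,k} s^k`, as a linear form on the quantum space. -/
def thetaCoeffLinear (Λ : Submodule ℤ t) (τ : UpperHalfPlane) (k : ℕ) (μ : t) :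
    QuantumSpace Λ τ k →ₗ[ℂ] ℂ where
  toFun σ := thetaCoeff b τ k μ σ
  map_add' σ σ' := by
    have hc : ∀ σ : QuantumSpace Λ τ k, IntegrableOn (fun x : J → ℝ =>
        (σ : t × t → ℂ) (b.equivFunL.symm x, 0) *
          Complex.exp (2 * Real.pi * Complex.I * (k * ⟪μ, b.equivFunL.symm x⟫_ℝ : ℝ)))
        (unitCube J) := fun σ =>
      integrableOn_unitCube ((σ.2.1.continuous.comp (by fun_prop)).mul (by fun_prop))
    simp only [thetaCoeff, Submodule.coe_add, Pi.add_apply, add_mul]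
    rw [integral_add (hc σ) (hc σ'), mul_add]
  map_smul' c σ := by
    simp only [thetaCoeff, Submodule.coe_smul, Pi.smul_apply, smul_eq_mul, mul_assoc,
      RingHom.id_apply]
    rw [integral_const_mul, mul_left_comm]

/-- Representatives of `k⁻¹ Λ* / Λ`. -/
theorem exists_finset_representatives (hb : Submodule.span ℤ (Set.range b) = Λ)
    (hΛ : IsEvenLattice Λ) {k : ℕ} (hk : 1 ≤ k) :
    ∃ R : Finset t, (∀ r ∈ R, MemScaledDual Λ k r) ∧
      (∀ r ∈ R, ∀ r' ∈ R, r - r' ∈ Λ → r = r') ∧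
      ∀ μ, MemScaledDual Λ k μ → ∃ r ∈ R, μ - r ∈ Λ := by
  classical
  have hk0 : (k : ℝ) ≠ 0 := by positivity
  have hbΛ : ∀ j, b j ∈ Λ := fun j => hb ▸ Submodule.subset_span ⟨j, rfl⟩
  have hfin : {μ | μ ∈ ZSpan.fundamentalDomain b ∧ MemScaledDual Λ k μ}.Finite := by
    refine Set.Finite.of_injOn (f := fun μ (j : J) => ⌊(k : ℝ) * ⟪μ, b j⟫_ℝ⌋)
      (t := Set.Icc (fun j => ⌊-((k : ℝ) * ((∑ i, ‖b i‖) * ‖b j‖))⌋)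
        (fun j => ⌊(k : ℝ) * ((∑ i, ‖b i‖) * ‖b j‖)⌋)) ?_ ?_ (Set.finite_Icc _ _)
    · rintro μ ⟨hμ, -⟩
      have h1 : ‖μ‖ ≤ ∑ i, ‖b i‖ := by
        have := ZSpan.norm_fract_le b μ
        rwa [ZSpan.fract_eq_self.mpr hμ] at this
      have h2 : ∀ j, |(k : ℝ) * ⟪μ, b j⟫_ℝ| ≤ (k : ℝ) * ((∑ i, ‖b i‖) * ‖b j‖) := fun j => by
        rw [abs_mul, Nat.abs_cast]
        gcongr
        exact (abs_real_inner_le_norm _ _).trans (by gcongr)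
      exact ⟨fun j => Int.floor_mono (abs_le.mp (h2 j)).1,
        fun j => Int.floor_mono (abs_le.mp (h2 j)).2⟩
    · rintro μ ⟨-, hμ⟩ ν ⟨-, hν⟩ h
      refine InnerProductSpace.ext_inner_right_basis b fun j => ?_
      have h1 := congrFun h j
      obtain ⟨m, hm⟩ := hμ _ (hbΛ j)
      obtain ⟨m', hm'⟩ := hν _ (hbΛ j)
      simp only [hm, hm', Int.floor_intCast] at h1
      rw [h1, ← hm'] at hm
      exact mul_left_cancel₀ hk0 hm
  refine ⟨hfin.toFinset, fun r hr => (hfin.mem_toFinset.mp hr).2, fun r hr r' hr' h => ?_,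
    fun μ hμ => ?_⟩
  · have h1 := ZSpan.fract_eq_self.mpr (hfin.mem_toFinset.mp hr).1
    have h2 := ZSpan.fract_eq_self.mpr (hfin.mem_toFinset.mp hr').1
    rw [← h1, ← h2, ZSpan.fract_eq_fract, hb]
    have : -r + r' = -(r - r') := by abel
    rw [this]
    exact Λ.neg_mem h
  · have hmem : ((ZSpan.floor b μ : _) : t) ∈ Λ := hb.le (ZSpan.floor b μ).2
    refine ⟨ZSpan.fract b μ, hfin.mem_toFinset.mpr ⟨ZSpan.fract_mem_fundamentalDomain b μ, ?_⟩, ?_⟩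
    · rw [ZSpan.fract_apply, sub_eq_add_neg]
      exact hμ.add hΛ (Λ.neg_mem hmem)
    · rw [ZSpan.fract_apply, sub_sub_cancel]
      exact hmem

end Coefficients

/-! ### The basis of theta functions and the maps `Ψ` -/

section Psi

variable {t : Type*} [NormedAddCommGroup t] [InnerProductSpace ℝ t] [FiniteDimensional ℝ t]
  {Λ : Submodule ℤ t} [DiscreteTopology Λ]

/-- The holomorphic section `Θ_{μ,k} s^k`. -/
def thetaSection (hΛ : IsEvenLattice Λ) (τ : UpperHalfPlane) {k : ℕ} (hk : 1 ≤ k) {μ : t}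
    (hμ : MemScaledDual Λ k μ) : QuantumSpace Λ τ k :=
  ⟨_, theta_mem hΛ τ hk hμ⟩

variable [IsZLattice ℝ Λ]

/-- The theta functions span the quantum space: the coefficients of the difference of a section with
its expansion all vanish. -/
theorem span_thetaSection_eq_top (hΛ : IsEvenLattice Λ) (τ : UpperHalfPlane) {k : ℕ}
    (hk : 1 ≤ k) : Submodule.span ℂ {σ : QuantumSpace Λ τ k |
      ∃ (μ : t) (hμ : MemScaledDual Λ k μ), σ = thetaSection hΛ τ hk hμ} = ⊤ := by
  classical
  set b := (Module.Free.chooseBasis ℤ Λ).ofZLatticeBasis ℝ Λ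
  have hb : Submodule.span ℤ (Set.range b) = Λ :=
    (Module.Free.chooseBasis ℤ Λ).ofZLatticeBasis_span ℝ
  obtain ⟨R, hR, hinj, hsurj⟩ := exists_finset_representatives b hb hΛ hk
  rw [eq_top_iff]
  intro σ _
  set f : t → QuantumSpace Λ τ k := fun r =>
    if hr : MemScaledDual Λ k r then thetaSection hΛ τ hk hr else 0 with hf
  have key : σ = ∑ r ∈ R, thetaCoeffLinear b Λ τ k r σ • f r := by
    rw [← sub_eq_zero]
    set ρ := σ - ∑ r ∈ R, thetaCoeffLinear b Λ τ k r σ • f r with hρ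
    have hz : ∀ r ∈ R, thetaCoeffLinear b Λ τ k r ρ = 0 := by
      intro r hr
      rw [hρ, map_sub, map_sum, Finset.sum_eq_single r]
      · have : thetaCoeffLinear b Λ τ k r (f r) = 1 := by
          simp only [hf, dif_pos (hR r hr)]
          exact (thetaCoeff_theta b hΛ hb τ hk (hR r hr) (hR r hr)).trans (by simp)
        rw [map_smul, this, smul_eq_mul, mul_one, sub_self]
      · intro r' hr' hne
        have : thetaCoeffLinear b Λ τ k r (f r') = 0 := by
          simp only [hf, dif_pos (hR r' hr')]
          refine (thetaCoeff_theta b hΛ hb τ hk (hR r' hr') (hR r hr)).trans (if_neg fun h => ?_)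
          exact hne (hinj r hr r' hr' h).symm
        rw [map_smul, this, smul_zero]
      · exact fun h => absurd hr h
    apply Subtype.ext
    refine eq_zero_of_thetaCoeff_eq_zero b hb hk ρ.2 fun μ hμ => ?_
    obtain ⟨r, hr, hμr⟩ := hsurj μ hμ
    have := thetaCoeff_add b hΛ hb ρ.2 (hR r hr) hμr
    rw [add_sub_cancel] at this
    rw [this]
    exact hz r hr
  rw [key]
  refine Submodule.sum_mem _ fun r hr => Submodule.smul_mem _ _ (Submodule.subset_span ?_)
  exact ⟨r, hR r hr, by simp only [hf, dif_pos (hR r hr)]⟩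

/-- The theta functions being, up to repetition, a basis of the quantum space, the map `Ψ` exists.
-/
theorem exists_isPsi (hΛ : IsEvenLattice Λ) (τ₁ τ₂ : UpperHalfPlane) {k : ℕ} (hk : 1 ≤ k) :
    ∃ Ψ, IsPsi Λ τ₁ τ₂ k Ψ := by
  classical
  set b := (Module.Free.chooseBasis ℤ Λ).ofZLatticeBasis ℝ Λ
  have hb : Submodule.span ℤ (Set.range b) = Λ :=
    (Module.Free.chooseBasis ℤ Λ).ofZLatticeBasis_span ℝ
  obtain ⟨R, hR, hinj, hsurj⟩ := exists_finset_representatives b hb hΛ hk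
  set f : t → QuantumSpace Λ τ₂ k := fun r =>
    if hr : MemScaledDual Λ k r then thetaSection hΛ τ₂ hk hr else 0 with hf
  refine ⟨∑ r ∈ R, (thetaCoeffLinear b Λ τ₁ k r).smulRight (f r), fun μ hμ =>
    ⟨thetaSection hΛ τ₁ hk hμ, fun x => rfl, fun x => ?_⟩⟩
  obtain ⟨r, hr, hμr⟩ := hsurj μ hμ
  have hc : ∀ r' ∈ R, thetaCoeffLinear b Λ τ₁ k r' (thetaSection hΛ τ₁ hk hμ) =
      if r' - μ ∈ Λ then 1 else 0 := fun r' hr' =>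
    thetaCoeff_theta b hΛ hb τ₁ hk hμ (hR r' hr')
  have hsum : (∑ r ∈ R, (thetaCoeffLinear b Λ τ₁ k r).smulRight (f r))
      (thetaSection hΛ τ₁ hk hμ) = f r := by
    rw [LinearMap.sum_apply, Finset.sum_eq_single r]
    · have h : r - μ ∈ Λ := by
        rw [← neg_sub]
        exact Λ.neg_mem hμr
      rw [LinearMap.smulRight_apply, hc r hr, if_pos h, one_smul]
    · intro r' hr' hne
      rw [LinearMap.smulRight_apply, hc r' hr', if_neg, zero_smul]
      intro h
      apply hne
      refine hinj r' hr' r hr ?_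
      have := Λ.add_mem h hμr
      rwa [sub_add_sub_cancel] at this
    · exact fun h => absurd hr h
  rw [hsum]
  simp only [hf, dif_pos (hR r hr)]
  have := theta_add τ₂ k r hμr x
  rw [add_sub_cancel] at this
  rw [this]
  rfl

/-- Linear maps on the quantum space are determined by their values on theta functions. -/
theorem linearMap_ext_theta (hΛ : IsEvenLattice Λ) {τ : UpperHalfPlane} {k : ℕ} (hk : 1 ≤ k)
    {W : Type*} [AddCommGroup W] [Module ℂ W] {S S' : QuantumSpace Λ τ k →ₗ[ℂ] W}
    (h : ∀ (μ : t) (hμ : MemScaledDual Λ k μ),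
      S (thetaSection hΛ τ hk hμ) = S' (thetaSection hΛ τ hk hμ)) : S = S' := by
  refine LinearMap.ext_on (span_thetaSection_eq_top hΛ τ hk) ?_
  rintro _ ⟨μ, hμ, rfl⟩
  exact h μ hμ

theorem IsPsi.apply_thetaSection (hΛ : IsEvenLattice Λ) {τ₁ τ₂ : UpperHalfPlane} {k : ℕ}
    (hk : 1 ≤ k) {Ψ : QuantumSpace Λ τ₁ k →ₗ[ℂ] QuantumSpace Λ τ₂ k} (h : IsPsi Λ τ₁ τ₂ k Ψ)
    {μ : t} (hμ : MemScaledDual Λ k μ) :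
    Ψ (thetaSection hΛ τ₁ hk hμ) = thetaSection hΛ τ₂ hk hμ := by
  obtain ⟨σ, h1, h2⟩ := h μ hμ
  have : σ = thetaSection hΛ τ₁ hk hμ := Subtype.ext (funext h1)
  rw [← this]
  exact Subtype.ext (funext h2)

theorem IsPsi.unique (hΛ : IsEvenLattice Λ) {τ₁ τ₂ : UpperHalfPlane} {k : ℕ}
    (hk : 1 ≤ k) {Ψ Ψ' : QuantumSpace Λ τ₁ k →ₗ[ℂ] QuantumSpace Λ τ₂ k}
    (h : IsPsi Λ τ₁ τ₂ k Ψ) (h' : IsPsi Λ τ₁ τ₂ k Ψ') : Ψ = Ψ' :=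
  linearMap_ext_theta hΛ hk fun μ hμ => by
    rw [h.apply_thetaSection hΛ hk hμ, h'.apply_thetaSection hΛ hk hμ]

end Psi

/-! ### The action of the modular group -/

section Modular

theorem inv_coeffs (A : SL(2, ℤ)) :
    A⁻¹ 0 0 = A 1 1 ∧ A⁻¹ 0 1 = -A 0 1 ∧ A⁻¹ 1 0 = -A 1 0 ∧ A⁻¹ 1 1 = A 0 0 := by
  rw [Matrix.SpecialLinearGroup.SL2_inv_expl]
  simp

theorem twist_mul_twist_inv (A : SL(2, ℤ)) : twist A * twist A⁻¹ = 1 := by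
  obtain ⟨h1, h2, h3, h4⟩ := inv_coeffs A
  have hdet := A.det_coe
  rw [Matrix.det_fin_two] at hdet
  ext i j
  rw [Matrix.SpecialLinearGroup.coe_mul, Matrix.mul_apply, Fin.sum_univ_two]
  fin_cases i <;> fin_cases j <;> simp [twist, h1, h2, h3, h4] <;> linarith

theorem mobius_mobius_inv (A : SL(2, ℤ)) (τ : UpperHalfPlane) : mobius A (mobius A⁻¹ τ) = τ := by
  rw [mobius, mobius, ← mul_smul, twist_mul_twist_inv, one_smul]

variable {t : Type*} [NormedAddCommGroup t] [InnerProductSpace ℝ t]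

/-- The action of a matrix on `t²`, as a continuous linear map. -/
def modularCLM (A : SL(2, ℤ)) : (t × t) →L[ℝ] (t × t) :=
  (((A 0 0 : ℤ) : ℝ) • ContinuousLinearMap.fst ℝ t t +
    ((A 0 1 : ℤ) : ℝ) • ContinuousLinearMap.snd ℝ t t).prod
  (((A 1 0 : ℤ) : ℝ) • ContinuousLinearMap.fst ℝ t t +
    ((A 1 1 : ℤ) : ℝ) • ContinuousLinearMap.snd ℝ t t)

theorem modularCLM_apply (A : SL(2, ℤ)) (x : t × t) : modularCLM A x = modularAction A x := by
  simp [modularCLM, modularAction, Int.cast_smul_eq_zsmul]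

theorem modularAction_eq (A : SL(2, ℤ)) (x : t × t) : modularAction A x =
    (((A 0 0 : ℤ) : ℝ) • x.1 + ((A 0 1 : ℤ) : ℝ) • x.2,
      ((A 1 0 : ℤ) : ℝ) • x.1 + ((A 1 1 : ℤ) : ℝ) • x.2) := by
  simp [modularAction, Int.cast_smul_eq_zsmul]

theorem contDiff_modularAction (A : SL(2, ℤ)) :
    ContDiff ℝ ∞ (modularAction A : t × t → t × t) := by
  have : (modularAction A : t × t → t × t) = modularCLM A := funext fun x =>
    (modularCLM_apply A x).symm
  rw [this]
  exact (modularCLM A : (t × t) →L[ℝ] (t × t)).contDiff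

theorem modularAction_add (A : SL(2, ℤ)) (x y : t × t) :
    modularAction A (x + y) = modularAction A x + modularAction A y := by
  simp [← modularCLM_apply]

theorem modularAction_sub (A : SL(2, ℤ)) (x y : t × t) :
    modularAction A (x - y) = modularAction A x - modularAction A y := by
  simp [← modularCLM_apply]

theorem modularAction_inv_modularAction (A : SL(2, ℤ)) (x : t × t) :
    modularAction A⁻¹ (modularAction A x) = x := by
  obtain ⟨h1, h2, h3, h4⟩ := inv_coeffs A
  have hdet := A.det_coe
  rw [Matrix.det_fin_two] at hdet
  ext1
  · simp only [modularAction, h1, h2, smul_add, smul_smul]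
    rw [add_add_add_comm, ← add_smul, ← add_smul]
    have e1 : A 1 1 * A 0 0 + -A 0 1 * A 1 0 = 1 := by linarith
    have e2 : A 1 1 * A 0 1 + -A 0 1 * A 1 1 = 0 := by ring
    rw [e1, e2, one_smul, zero_smul, add_zero]
  · simp only [modularAction, h3, h4, smul_add, smul_smul]
    rw [add_add_add_comm, ← add_smul, ← add_smul]
    have e1 : -A 1 0 * A 0 0 + A 0 0 * A 1 0 = 0 := by ring
    have e2 : -A 1 0 * A 0 1 + A 0 0 * A 1 1 = 1 := by linarith
    rw [e1, e2, one_smul, zero_smul, zero_add]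

theorem modularAction_modularAction_inv (A : SL(2, ℤ)) (x : t × t) :
    modularAction A (modularAction A⁻¹ x) = x := by
  have := modularAction_inv_modularAction A⁻¹ x
  rwa [inv_inv] at this

theorem modularAction_mem {Λ : Submodule ℤ t} (A : SL(2, ℤ)) {γ : t × t} (h1 : γ.1 ∈ Λ)
    (h2 : γ.2 ∈ Λ) : (modularAction A γ).1 ∈ Λ ∧ (modularAction A γ).2 ∈ Λ :=
  ⟨Λ.add_mem (Λ.smul_mem _ h1) (Λ.smul_mem _ h2), Λ.add_mem (Λ.smul_mem _ h1) (Λ.smul_mem _ h2)⟩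

theorem coe_det_eq_one_real (A : SL(2, ℤ)) :
    ((A 0 0 : ℤ) : ℝ) * (A 1 1 : ℤ) - ((A 0 1 : ℤ) : ℝ) * (A 1 0 : ℤ) = 1 := by
  have h := A.det_coe
  rw [Matrix.det_fin_two] at h
  exact_mod_cast h

theorem primitive_modularAction (A : SL(2, ℤ)) (x w : t × t) :
    primitive (modularAction A x) (modularAction A w) = primitive x w := by
  have hdet := coe_det_eq_one_real A
  simp only [primitive, modularAction_eq, inner_add_left, inner_add_right, real_inner_smul_left,
    real_inner_smul_right]
  linear_combination (⟪x.1, w.2⟫_ℝ - ⟪x.2, w.1⟫_ℝ) * hdet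

theorem omega_modularAction (A : SL(2, ℤ)) (x y : t × t) :
    omega (modularAction A x) (modularAction A y) = omega x y := by
  have := primitive_modularAction A x y
  simp only [primitive] at this
  rw [omega, omega, this]

/-- The lattice action on the prequantum bundle is invariant under the modular group, because the
lattice is even. -/
theorem latticeFactor_modularAction {Λ : Submodule ℤ t} (hΛ : IsEvenLattice Λ) (A : SL(2, ℤ))
    {γ : t × t} (h1 : γ.1 ∈ Λ) (h2 : γ.2 ∈ Λ) (x : t × t) :
    latticeFactor (modularAction A γ) (modularAction A x) = latticeFactor γ x := by
  rw [latticeFactor, latticeFactor, omega_modularAction]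
  congr 1
  obtain ⟨m1, hm1⟩ := hΛ.even _ h1
  obtain ⟨m2, hm2⟩ := hΛ.even _ h2
  obtain ⟨m, hm⟩ := hΛ.inner_int _ h1 _ h2
  have hdet : ((A 0 0 : ℤ) : ℝ) * (A 1 1 : ℤ) - ((A 0 1 : ℤ) : ℝ) * (A 1 0 : ℤ) = 1 :=
    coe_det_eq_one_real A
  have e : ⟪(modularAction A γ).1, (modularAction A γ).2⟫_ℝ = ⟪γ.1, γ.2⟫_ℝ +
      2 * ((A 0 0 * A 1 0 * m1 + A 0 1 * A 1 1 * m2 + A 0 1 * A 1 0 * m : ℤ) : ℝ) := by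
    simp only [modularAction_eq, inner_add_left, inner_add_right, real_inner_smul_left,
      real_inner_smul_right]
    rw [real_inner_comm γ.1 γ.2, hm1, hm2, hm]
    push_cast
    linear_combination (m : ℝ) * hdet
  rw [e, Complex.exp_eq_exp_iff_exists_int]
  exact ⟨A 0 0 * A 1 0 * m1 + A 0 1 * A 1 1 * m2 + A 0 1 * A 1 0 * m, by push_cast; ring⟩

theorem covDeriv_comp_modularAction (A : SL(2, ℤ)) {k : ℕ} {σ : t × t → ℂ}
    (hσ : Differentiable ℝ σ) (x w : t × t) :
    covDeriv k (fun x => σ (modularAction A x)) x w =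
      covDeriv k σ (modularAction A x) (modularAction A w) := by
  have h : HasFDerivAt (fun x => σ (modularAction A x))
      ((fderiv ℝ σ (modularAction A x)).comp (modularCLM A)) x := by
    have h1 : HasFDerivAt (fun x : t × t => modularAction A x) (modularCLM A) x := by
      simp only [← modularCLM_apply]
      exact (modularCLM A : (t × t) →L[ℝ] (t × t)).hasFDerivAt
    exact (hσ _).hasFDerivAt.comp x h1
  rw [covDeriv, covDeriv, h.fderiv, primitive_modularAction, ContinuousLinearMap.comp_apply,
    modularCLM_apply]

theorem covDeriv_eq (k : ℕ) (σ : t × t → ℂ) (x : t × t) (r s : ℝ) (v : t) :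
    covDeriv k σ x (r • v, s • v) = r * covDeriv k σ x (v, 0) + s * covDeriv k σ x (0, v) := by
  have h : ((r • v, s • v) : t × t) = r • (v, 0) + s • (0, v) := by simp
  simp only [covDeriv, primitive, inner_zero_right, real_inner_smul_right]
  rw [h, map_add, map_smul, map_smul, Complex.real_smul, Complex.real_smul]
  push_cast
  ring

/-- Composition with the action of `A` exchanges the complex structures `Aτ` and `τ`. -/
theorem IsHolomorphic.comp_modularAction (A : SL(2, ℤ)) {τ : UpperHalfPlane} {k : ℕ}
    {σ : t × t → ℂ} (hhol : IsHolomorphic (mobius A τ) k σ) (hd : Differentiable ℝ σ) :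
    IsHolomorphic τ k fun x => σ (modularAction A x) := by
  intro x v
  have h := hhol (modularAction A x) v
  have e1 := covDeriv_eq k σ (modularAction A x) (A 0 0 : ℤ) (A 1 0 : ℤ) v
  have e2 := covDeriv_eq k σ (modularAction A x) (A 0 1 : ℤ) (A 1 1 : ℤ) v
  rw [covDeriv_comp_modularAction A hd, covDeriv_comp_modularAction A hd]
  simp only [modularAction_eq, smul_zero, add_zero, zero_add] at e1 e2 h ⊢
  rw [e1, e2]
  have hJ := mobius_denom_ne_zero A τ
  have hm : (mobius A τ : ℂ) * (-((A 1 0 : ℤ) : ℂ) * (τ : ℂ) + (A 1 1 : ℤ)) =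
      (A 0 0 : ℤ) * (τ : ℂ) - (A 0 1 : ℤ) := by
    rw [coe_mobius, div_mul_cancel₀ _ hJ]
  push_cast
  set X := covDeriv k σ _ (v, 0)
  set Y := covDeriv k σ _ (0, v)
  linear_combination (-((A 1 0 : ℤ) : ℂ) * (τ : ℂ) + (A 1 1 : ℤ)) * h - X * hm

theorem comp_modularAction_mem {Λ : Submodule ℤ t} (hΛ : IsEvenLattice Λ) (A : SL(2, ℤ))
    {τ : UpperHalfPlane} {k : ℕ} {σ : t × t → ℂ} (hσ : σ ∈ QuantumSpace Λ (mobius A τ) k) :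
    (fun x => σ (modularAction A x)) ∈ QuantumSpace Λ τ k := by
  obtain ⟨hs, hsec, hhol⟩ := hσ
  refine ⟨hs.comp (contDiff_modularAction A), fun γ h1 h2 x => ?_,
    hhol.comp_modularAction A (hs.differentiable (by simp))⟩
  have h := modularAction_mem A h1 h2
  simp only [modularAction_add, hsec _ h.1 h.2, latticeFactor_modularAction hΛ A h1 h2]

/-- Composition with the action of `A⁻¹`, as a linear map between quantum spaces. -/
def pullback {Λ : Submodule ℤ t} (hΛ : IsEvenLattice Λ) (A : SL(2, ℤ)) (τ : UpperHalfPlane)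
    (k : ℕ) : QuantumSpace Λ (mobius A τ) k →ₗ[ℂ] QuantumSpace Λ τ k where
  toFun σ := ⟨_, comp_modularAction_mem hΛ A σ.2⟩
  map_add' _ _ := rfl
  map_smul' _ _ := rfl

variable [FiniteDimensional ℝ t] {Λ : Submodule ℤ t} [DiscreteTopology Λ] [IsZLattice ℝ Λ]

/-- `Ψ` exists and is unique, and `R₂(A, e)` is its composition with the pullback by `A⁻¹` and the
multiplication by `e(A⁻¹τ)`. -/
theorem existsUnique_isR₂ (hΛ : IsEvenLattice Λ) (τ : UpperHalfPlane) {n : ℕ} (g : Mo₂ n)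
    {k : ℕ} (hk : 1 ≤ k) : ∃! R, IsR₂ Λ τ g k R := by
  obtain ⟨Ψ, hΨ⟩ := exists_isPsi hΛ τ (mobius g.A⁻¹ τ) hk
  refine ⟨g.e (mobius g.A⁻¹ τ) • (pullback hΛ g.A⁻¹ τ k ∘ₗ Ψ), ⟨Ψ, hΨ, fun σ x => rfl⟩, ?_⟩
  rintro R ⟨Ψ', hΨ', hR⟩
  refine LinearMap.ext fun σ => Subtype.ext (funext fun x => ?_)
  rw [hR, hΨ'.unique hΛ hk hΨ]
  rfl

theorem IsR₂.apply_thetaSection (hΛ : IsEvenLattice Λ) {τ : UpperHalfPlane} {n : ℕ} {g : Mo₂ n}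
    {k : ℕ} (hk : 1 ≤ k) {R : QuantumSpace Λ τ k →ₗ[ℂ] QuantumSpace Λ τ k}
    (hR : IsR₂ Λ τ g k R) {μ : t} (hμ : MemScaledDual Λ k μ) (x : t × t) :
    (R (thetaSection hΛ τ hk hμ) : t × t → ℂ) x = g.e (mobius g.A⁻¹ τ) *
      (thetaSection hΛ (mobius g.A⁻¹ τ) hk hμ : t × t → ℂ) (modularAction g.A⁻¹ x) := by
  obtain ⟨Ψ, hΨ, h⟩ := hR
  rw [h, hΨ.apply_thetaSection hΛ hk hμ]

end Modular

/-! ### Gaussian integrals -/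

section GaussianIntegrals

open MeasureTheory

variable {V : Type*} [NormedAddCommGroup V] [InnerProductSpace ℝ V] [FiniteDimensional ℝ V]
  [MeasurableSpace V] [BorelSpace V]

/-- The Gaussian integral with a linear term `B(ξ, v)`, where `ξ = c₁ w₁ + c₂ w₂` is a vector of the
complexification. -/
theorem integral_cexp_neg_mul_sq_norm_add_add {b : ℂ} (hb : 0 < b.re) (c₁ c₂ : ℂ) (w₁ w₂ : V) :
    ∫ v : V, Complex.exp (-b * (⟪v, v⟫_ℝ : ℝ) + (c₁ * (⟪w₁, v⟫_ℝ : ℝ) + c₂ * (⟪w₂, v⟫_ℝ : ℝ))) =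
      (Real.pi / b) ^ (Module.finrank ℝ V / 2 : ℂ) * Complex.exp ((c₁ ^ 2 * (⟪w₁, w₁⟫_ℝ : ℝ) +
        2 * c₁ * c₂ * (⟪w₁, w₂⟫_ℝ : ℝ) + c₂ ^ 2 * (⟪w₂, w₂⟫_ℝ : ℝ)) / (4 * b)) := by
  set e := (stdOrthonormalBasis ℝ V).repr.symm
  have hin : ∀ w w' : V, ⟪w, w'⟫_ℝ = ∑ i, e.symm w i * e.symm w' i := fun w w' => by
    rw [← e.symm.inner_map_map w w', PiLp.inner_apply]
    simp [mul_comm]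
  rw [← e.measurePreserving.integral_comp e.toHomeomorph.measurableEmbedding,
    ← (PiLp.volume_preserving_toLp _).integral_comp
      (MeasurableEquiv.toLp 2 _).measurableEmbedding]
  have h := GaussianFourier.integral_cexp_neg_mul_sum_add hb
    (fun i => c₁ * (e.symm w₁ i : ℝ) + c₂ * (e.symm w₂ i : ℝ))
  rw [Fintype.card_fin] at h
  refine Eq.trans (congrArg _ (funext fun v => ?_)) (h.trans ?_)
  · have hv : ∀ i, e.symm (e (WithLp.toLp 2 v)) i = v i := fun i => by
      rw [LinearIsometryEquiv.symm_apply_apply]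
    have hin' : ∀ w, ⟪w, e (WithLp.toLp 2 v)⟫_ℝ = ∑ i, e.symm w i * v i := fun w => by
      rw [hin]
      simp only [hv]
    have hvv : ⟪e (WithLp.toLp 2 v), e (WithLp.toLp 2 v)⟫_ℝ = ∑ i, v i ^ 2 := by
      rw [hin']
      simp only [hv, sq]
    change Complex.exp (-b * ((⟪e (WithLp.toLp 2 v), e (WithLp.toLp 2 v)⟫_ℝ : ℝ) : ℂ) +
      (c₁ * ((⟪w₁, e (WithLp.toLp 2 v)⟫_ℝ : ℝ) : ℂ) +
        c₂ * ((⟪w₂, e (WithLp.toLp 2 v)⟫_ℝ : ℝ) : ℂ))) = _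
    rw [hvv, hin', hin']
    congr 1
    push_cast
    simp only [Finset.mul_sum, ← Finset.sum_add_distrib]
    refine Finset.sum_congr rfl fun i _ => ?_
    ring
  · rw [hin, hin, hin]
    congr 3
    push_cast
    simp only [Finset.mul_sum, ← Finset.sum_add_distrib]
    refine Finset.sum_congr rfl fun i _ => ?_
    ring

theorem integrable_exp_neg_mul_sq_norm_prod {c : ℝ} (hc : 0 < c) :
    Integrable fun z : V × V => Real.exp (-c * ‖z‖ ^ 2) := by
  have h1 : Integrable fun v : V => Real.exp (-(c / 2) * ‖v‖ ^ 2) := by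
    have h := (GaussianFourier.integrable_cexp_neg_mul_sq_norm_add (V := V) (b := ((c / 2 : ℝ) : ℂ))
      (by rw [Complex.ofReal_re]; positivity) 0 0).norm
    refine h.congr (Filter.Eventually.of_forall fun v => ?_)
    simp only [zero_mul, add_zero, Complex.norm_exp]
    congr 1
    rw [← Complex.ofReal_neg, ← Complex.ofReal_pow, ← Complex.ofReal_mul, Complex.ofReal_re]
  refine (h1.mul_prod h1).mono' (by fun_prop) (Filter.Eventually.of_forall fun z => ?_)
  rw [Real.norm_of_nonneg (Real.exp_pos _).le, ← Real.exp_add, Real.exp_le_exp]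
  have h2 := norm_fst_le z
  have h3 := norm_snd_le z
  have h4 : ‖z.1‖ ^ 2 ≤ ‖z‖ ^ 2 := by gcongr
  have h5 : ‖z.2‖ ^ 2 ≤ ‖z‖ ^ 2 := by gcongr
  nlinarith

end GaussianIntegrals

/-! ### The Gaussian kernel -/

section GaussianKernel

variable {t : Type*} [NormedAddCommGroup t] [InnerProductSpace ℝ t]

/-- The quadratic form `-(iπ / (τ' - τ̄)) B(p + τ' q, p + τ̄ q)`. -/
def gaussForm (τ τ' : UpperHalfPlane) : t × t → ℂ :=
  quadForm (-(Real.pi * Complex.I) / ((τ' : ℂ) - conj (τ : ℂ)))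
    (-(Real.pi * Complex.I) * ((τ' : ℂ) + conj (τ : ℂ)) / ((τ' : ℂ) - conj (τ : ℂ)))
    (-(Real.pi * Complex.I) * ((τ' : ℂ) * conj (τ : ℂ)) / ((τ' : ℂ) - conj (τ : ℂ)))

/-- The Gaussian `E(x, y)`, equal to `1` on the diagonal, holomorphic in `x` for the complex
structure `τ'` and antiholomorphic in `y` for `τ`, as a section of `L ⊠ L̄`. -/
def gaussKernel (τ τ' : UpperHalfPlane) (x y : t × t) : ℂ :=
  Complex.exp (Complex.I / 2 * (omega y x : ℝ) + gaussForm τ τ' (x - y))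

theorem gaussKernel_self (τ τ' : UpperHalfPlane) (x : t × t) : gaussKernel τ τ' x x = 1 := by
  simp [gaussKernel, gaussForm, quadForm, omega, real_inner_comm]

theorem gaussForm_neg (τ τ' : UpperHalfPlane) (x : t × t) :
    gaussForm τ τ' (-x) = gaussForm τ τ' x := by
  simp [gaussForm, quadForm]

theorem norm_gaussKernel (τ τ' : UpperHalfPlane) (x y : t × t) :
    ‖gaussKernel τ τ' x y‖ = Real.exp (gaussForm τ τ' (x - y)).re := by
  rw [gaussKernel, Complex.norm_exp]
  congr 1
  simp

theorem re_gaussForm (τ τ' : UpperHalfPlane) (z : t × t) :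
    (gaussForm τ τ' z).re = -(Real.pi / Complex.normSq ((τ' : ℂ) - conj (τ : ℂ)) *
      (τ'.im * ‖z.1 + τ.re • z.2‖ ^ 2 + τ.im * ‖z.1 + τ'.re • z.2‖ ^ 2 +
        τ.im * τ'.im * (τ.im + τ'.im) * ‖z.2‖ ^ 2)) := by
  simp only [← real_inner_self_eq_norm_sq, inner_add_left, inner_add_right, real_inner_smul_left,
    real_inner_smul_right, gaussForm, quadForm]
  rw [real_inner_comm z.1 z.2]
  generalize ⟪z.1, z.1⟫_ℝ = X
  generalize ⟪z.1, z.2⟫_ℝ = Y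
  generalize ⟪z.2, z.2⟫_ℝ = Z
  simp only [div_eq_mul_inv, Complex.inv_def]
  simp
  ring

theorem exists_re_gaussForm_le (τ τ' : UpperHalfPlane) :
    ∃ c : ℝ, 0 < c ∧ ∀ z : t × t, (gaussForm τ τ' z).re ≤ -c * ‖z‖ ^ 2 := by
  have hb := τ.im_pos
  have hb' := τ'.im_pos
  have hN : 0 < Complex.normSq ((τ' : ℂ) - conj (τ : ℂ)) :=
    Complex.normSq_pos.mpr (sub_conj_ne_zero τ' τ)
  set m := τ.im * τ'.im * (τ.im + τ'.im) with hm
  have hm0 : 0 < m := by positivity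
  set M := 2 / τ'.im + (2 * τ.re ^ 2 + 1) / m with hM
  have hM0 : 0 < M := by positivity
  refine ⟨Real.pi / Complex.normSq ((τ' : ℂ) - conj (τ : ℂ)) * M⁻¹,
    by have := Real.pi_pos; positivity, fun z => ?_⟩
  rw [re_gaussForm, neg_mul, neg_le_neg_iff, mul_assoc]
  have hpi := Real.pi_pos
  gcongr
  rw [inv_mul_le_iff₀ hM0]
  have h1 : ‖z‖ ^ 2 ≤ ‖z.1‖ ^ 2 + ‖z.2‖ ^ 2 := by
    rw [Prod.norm_def]
    rcases max_choice ‖z.1‖ ‖z.2‖ with h | h <;> rw [h] <;>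
      nlinarith [sq_nonneg ‖z.1‖, sq_nonneg ‖z.2‖]
  have h2 : ‖z.1‖ ^ 2 ≤ 2 * ‖z.1 + τ.re • z.2‖ ^ 2 + 2 * τ.re ^ 2 * ‖z.2‖ ^ 2 := by
    have h3 : ‖z.1‖ ≤ ‖z.1 + τ.re • z.2‖ + |τ.re| * ‖z.2‖ := by
      calc ‖z.1‖ = ‖(z.1 + τ.re • z.2) - τ.re • z.2‖ := by congr 1; abel
        _ ≤ _ := (norm_sub_le _ _).trans (by rw [norm_smul, Real.norm_eq_abs])
    have h4 := sq_abs τ.re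
    have h5 : ‖z.1‖ ^ 2 ≤ (‖z.1 + τ.re • z.2‖ + |τ.re| * ‖z.2‖) ^ 2 := by gcongr
    rw [← h4]
    nlinarith [sq_nonneg (‖z.1 + τ.re • z.2‖ - |τ.re| * ‖z.2‖)]
  have e1 : 2 * ‖z.1 + τ.re • z.2‖ ^ 2 = 2 / τ'.im * (τ'.im * ‖z.1 + τ.re • z.2‖ ^ 2) := by
    field_simp
  have e2 : (2 * τ.re ^ 2 + 1) * ‖z.2‖ ^ 2 = (2 * τ.re ^ 2 + 1) / m * (m * ‖z.2‖ ^ 2) := by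
    field_simp
  calc ‖z‖ ^ 2 ≤ 2 * ‖z.1 + τ.re • z.2‖ ^ 2 + (2 * τ.re ^ 2 + 1) * ‖z.2‖ ^ 2 := by linarith
    _ = 2 / τ'.im * (τ'.im * ‖z.1 + τ.re • z.2‖ ^ 2) +
        (2 * τ.re ^ 2 + 1) / m * (m * ‖z.2‖ ^ 2) := by rw [e1, e2]
    _ ≤ M * (τ'.im * ‖z.1 + τ.re • z.2‖ ^ 2 + m * ‖z.2‖ ^ 2) := by
      rw [hM]
      have a1 : 0 ≤ 2 / τ'.im * (m * ‖z.2‖ ^ 2) := by positivity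
      have a2 : 0 ≤ (2 * τ.re ^ 2 + 1) / m * (τ'.im * ‖z.1 + τ.re • z.2‖ ^ 2) := by positivity
      nlinarith
    _ ≤ _ := by
      gcongr
      nlinarith [sq_nonneg ‖z.1 + τ'.re • z.2‖]

theorem contDiff_gaussKernel (τ τ' : UpperHalfPlane) :
    ContDiff ℝ ∞ fun z : (t × t) × (t × t) => gaussKernel τ τ' z.1 z.2 := by
  have h1 : ContDiff ℝ ∞ fun z : (t × t) × (t × t) => ((omega z.2 z.1 : ℝ) : ℂ) := by
    refine Complex.ofRealCLM.contDiff.comp (?_ : ContDiff ℝ ∞ fun z : (t × t) × (t × t) =>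
      2 * Real.pi * (⟪z.2.1, z.1.2⟫_ℝ - ⟪z.2.2, z.1.1⟫_ℝ))
    exact contDiff_const.mul ((contDiff_snd.fst.inner ℝ contDiff_fst.snd).sub
      (contDiff_snd.snd.inner ℝ contDiff_fst.fst))
  exact ((contDiff_const.mul h1).add
    ((contDiff_quadForm _ _ _).comp (contDiff_fst.sub contDiff_snd))).cexp

theorem norm_thetaTerm_le_one (τ : UpperHalfPlane) (k : ℕ) (γ : t) (x : t × t) :
    ‖thetaTerm τ k γ x‖ ≤ 1 := by
  rw [norm_thetaTerm, Real.exp_le_one_iff]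
  have := τ.im_pos
  have := Real.pi_pos
  have : 0 ≤ k * Real.pi * τ.im * ‖x.2 - γ‖ ^ 2 := by positivity
  linarith

theorem continuous_gaussKernel_right (τ τ' : UpperHalfPlane) (x : t × t) :
    Continuous (gaussKernel τ τ' x) :=
  (contDiff_gaussKernel τ τ').continuous.comp (Continuous.prodMk_right x)

open MeasureTheory

variable [FiniteDimensional ℝ t] [MeasurableSpace t] [BorelSpace t]

instance instIsAddHaarMeasureProd : (volume : Measure (t × t)).IsAddHaarMeasure := by
  rw [Measure.volume_eq_prod]
  infer_instance

theorem integrable_gaussKernel_pow_mul_thetaTerm (τ τ' : UpperHalfPlane) {k : ℕ} (hk : 1 ≤ k)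
    (γ : t) (x : t × t) : Integrable fun y => gaussKernel τ τ' x y ^ k * thetaTerm τ k γ y := by
  obtain ⟨c, hc, hle⟩ := exists_re_gaussForm_le (t := t) τ τ'
  have hkpos : (0 : ℝ) < k := by exact_mod_cast hk
  have h := (integrable_exp_neg_mul_sq_norm_prod (V := t) (mul_pos hkpos hc)).comp_add_right (-x)
  refine h.mono' ((((continuous_gaussKernel_right τ τ' x).pow k).mul
    (continuous_thetaTerm τ k γ)).aestronglyMeasurable) (Filter.Eventually.of_forall fun y => ?_)
  rw [norm_mul, norm_pow, norm_gaussKernel, ← Real.exp_nat_mul]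
  refine (mul_le_of_le_one_right (Real.exp_pos _).le (norm_thetaTerm_le_one _ _ _ _)).trans ?_
  rw [Real.exp_le_exp]
  have := hle (x - y)
  rw [← norm_neg, neg_sub, sub_eq_add_neg y x] at this
  nlinarith

/-- The Gaussian kernel sends the terms of the theta series for `τ` to those for `τ'`. -/
theorem integral_gaussKernel_pow_mul_thetaTerm (τ τ' : UpperHalfPlane) {k : ℕ} (hk : 1 ≤ k)
    (γ : t) (x : t × t) :
    ∫ y, gaussKernel τ τ' x y ^ k * thetaTerm τ k γ y =
      (((τ' : ℂ) - conj (τ : ℂ)) / (Complex.I * k)) ^ (Module.finrank ℝ t / 2 : ℂ) *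
        (((2 * k * τ.im)⁻¹ : ℝ) : ℂ) ^ (Module.finrank ℝ t / 2 : ℂ) * thetaTerm τ' k γ x := by
  have hkpos : (0 : ℝ) < k := by exact_mod_cast hk
  have hkC : (k : ℂ) ≠ 0 := by exact_mod_cast hkpos.ne'
  have hint := (integrable_gaussKernel_pow_mul_thetaTerm τ τ' hk γ x).comp_add_right x
  have hw0 : (τ' : ℂ) - conj (τ : ℂ) ≠ 0 := sub_conj_ne_zero τ' τ
  have hpi : (Real.pi : ℂ) ≠ 0 := by exact_mod_cast Real.pi_ne_zero
  have hττ : (τ : ℂ) - conj (τ : ℂ) = 2 * Complex.I * τ.im := by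
    rw [Complex.sub_conj]
    push_cast
    rw [UpperHalfPlane.coe_im]
    ring
  set w : ℂ := (τ' : ℂ) - conj (τ : ℂ) with hw
  have hτ' : (τ' : ℂ) = w + conj (τ : ℂ) := by rw [hw]; ring
  set β : ℂ := Real.pi * Complex.I * k / w with hβ
  have hβw : β * w = Real.pi * Complex.I * k := by rw [hβ]; field_simp
  have hβre : 0 < β.re := by
    have hwim : 0 < w.im := by
      have h1 := τ.im_pos
      have h2 := τ'.im_pos
      simp only [hw, Complex.sub_im, Complex.conj_im, UpperHalfPlane.coe_im]
      linarith
    have : β.re = Real.pi * k * w.im / Complex.normSq w := by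
      rw [hβ, Complex.div_re]
      simp
    rw [this]
    have := Complex.normSq_pos.mpr hw0
    have := Real.pi_pos
    positivity
  set u : t := x.2 - γ with hu
  set b₀ : ℂ := ((2 * Real.pi * k * τ.im : ℝ) : ℂ) with hb₀
  have hb₀re : 0 < b₀.re := by
    rw [hb₀, Complex.ofReal_re]
    have := τ.im_pos
    have := Real.pi_pos
    positivity
  have hb₀ne : b₀ ≠ 0 := fun h => by simp [h] at hb₀re
  have hb₀' : b₀ = -(Real.pi * Complex.I * k * ((τ : ℂ) - conj (τ : ℂ))) := by
    rw [hττ, hb₀]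
    push_cast
    linear_combination (2 * Real.pi * k * τ.im) * Complex.I_sq
  rw [← integral_add_right_eq_self _ x]
  rw [Measure.volume_eq_prod] at hint ⊢
  rw [integral_prod_symm _ hint]
  -- completing the square in the first variable
  have key : ∀ r s : t, gaussKernel τ τ' x ((r, s) + x) ^ k * thetaTerm τ k γ ((r, s) + x) =
      Complex.exp (-β * (⟪s, s⟫_ℝ : ℝ) * (conj (τ : ℂ)) ^ 2 + -b₀ * (⟪s, s⟫_ℝ : ℝ) +
        -2 * b₀ * (⟪u, s⟫_ℝ : ℝ) + 2 * Real.pi * Complex.I * k * conj (τ : ℂ) * (⟪u, s⟫_ℝ : ℝ)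
        + Real.pi * Complex.I * k *
          (τ * (⟪u, u⟫_ℝ : ℝ) + (⟪x.1, x.2 - (2 : ℝ) • γ⟫_ℝ : ℝ))) *
      Complex.exp (-β * (⟪r, r⟫_ℝ : ℝ) + ((-2 * β * conj (τ : ℂ)) * (⟪s, r⟫_ℝ : ℝ) +
        (2 * β * w) * (⟪u, r⟫_ℝ : ℝ))) := by
    intro r s
    rw [gaussKernel, thetaTerm, ← Complex.exp_nat_mul, ← Complex.exp_add, ← Complex.exp_add]
    congr 1
    have hg : (k : ℂ) * gaussForm τ τ' (x - ((r, s) + x)) =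
        -β * ((⟪r, r⟫_ℝ : ℝ) + (w + 2 * conj (τ : ℂ)) * (⟪r, s⟫_ℝ : ℝ) +
          (w + conj (τ : ℂ)) * conj (τ : ℂ) * (⟪s, s⟫_ℝ : ℝ)) := by
      rw [sub_add_cancel_right, gaussForm_neg, gaussForm, quadForm, ← hw, hτ', hβ]
      ring
    have hx1 : x.2 = u + γ := by rw [hu]; abel
    rw [mul_add, hg, hb₀']
    simp only [omega, Prod.fst_add, Prod.snd_add, hx1, inner_sub_left, inner_sub_right,
      inner_add_left, inner_add_right, real_inner_smul_right]
    rw [real_inner_comm s u, real_inner_comm s γ, real_inner_comm s r, real_inner_comm u r,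
      real_inner_comm x.1 u, real_inner_comm x.1 γ, real_inner_comm u γ, real_inner_comm γ r,
      real_inner_comm s x.1]
    push_cast
    linear_combination (-(2 * (⟪u, r⟫_ℝ : ℝ) + (⟪s, r⟫_ℝ : ℝ) +
      conj (τ : ℂ) * (⟪s, s⟫_ℝ : ℝ)) : ℂ) * hβw
  simp only [key, integral_const_mul, integral_cexp_neg_mul_sq_norm_add_add hβre]
  have hβ0 : β ≠ 0 := fun h => by simp [h] at hβre
  -- the remaining Gaussian in the second variable
  have key₂ : ∀ s : t, Complex.exp (-β * (⟪s, s⟫_ℝ : ℝ) * (conj (τ : ℂ)) ^ 2 +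
        -b₀ * (⟪s, s⟫_ℝ : ℝ) + -2 * b₀ * (⟪u, s⟫_ℝ : ℝ) +
        2 * Real.pi * Complex.I * k * conj (τ : ℂ) * (⟪u, s⟫_ℝ : ℝ) +
        Real.pi * Complex.I * k *
          (τ * (⟪u, u⟫_ℝ : ℝ) + (⟪x.1, x.2 - (2 : ℝ) • γ⟫_ℝ : ℝ))) *
      ((Real.pi / β) ^ (Module.finrank ℝ t / 2 : ℂ) *
        Complex.exp (((-2 * β * conj (τ : ℂ)) ^ 2 * (⟪s, s⟫_ℝ : ℝ) +
          2 * (-2 * β * conj (τ : ℂ)) * (2 * β * w) * (⟪s, u⟫_ℝ : ℝ) +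
          (2 * β * w) ^ 2 * (⟪u, u⟫_ℝ : ℝ)) / (4 * β))) =
      (Real.pi / β) ^ (Module.finrank ℝ t / 2 : ℂ) * Complex.exp (β * w ^ 2 * (⟪u, u⟫_ℝ : ℝ) +
        Real.pi * Complex.I * k *
          (τ * (⟪u, u⟫_ℝ : ℝ) + (⟪x.1, x.2 - (2 : ℝ) • γ⟫_ℝ : ℝ))) *
      Complex.exp (-b₀ * (⟪s, s⟫_ℝ : ℝ) +
        ((-2 * b₀) * (⟪u, s⟫_ℝ : ℝ) + 0 * (⟪u, s⟫_ℝ : ℝ))) := by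
    intro s
    rw [mul_left_comm, ← Complex.exp_add, mul_assoc ((Real.pi / β) ^ (Module.finrank ℝ t / 2 : ℂ)),
      ← Complex.exp_add]
    congr 2
    rw [real_inner_comm u s]
    field_simp
    linear_combination (-8 * conj (τ : ℂ) * (⟪u, s⟫_ℝ : ℝ)) * hβw
  simp only [key₂, integral_const_mul, integral_cexp_neg_mul_sq_norm_add_add hb₀re]
  have e1 : (Real.pi : ℂ) / β = w / (Complex.I * k) := by
    rw [hβ]
    field_simp
  have e2 : (Real.pi : ℂ) / b₀ = (((2 * k * τ.im)⁻¹ : ℝ) : ℂ) := by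
    rw [hb₀]
    push_cast
    field_simp
  have e3 : thetaTerm τ' k γ x = Complex.exp (β * w ^ 2 * (⟪u, u⟫_ℝ : ℝ) +
        Real.pi * Complex.I * k *
          (τ * (⟪u, u⟫_ℝ : ℝ) + (⟪x.1, x.2 - (2 : ℝ) • γ⟫_ℝ : ℝ))) *
      Complex.exp (((-2 * b₀) ^ 2 * (⟪u, u⟫_ℝ : ℝ) + 2 * (-2 * b₀) * 0 * (⟪u, u⟫_ℝ : ℝ) +
        0 ^ 2 * (⟪u, u⟫_ℝ : ℝ)) / (4 * b₀)) := by
    rw [thetaTerm, ← Complex.exp_add, ← hu]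
    congr 1
    have : ((-2 * b₀) ^ 2 * (⟪u, u⟫_ℝ : ℝ) + 2 * (-2 * b₀) * 0 * (⟪u, u⟫_ℝ : ℝ) +
        0 ^ 2 * (⟪u, u⟫_ℝ : ℝ)) / (4 * b₀) = b₀ * (⟪u, u⟫_ℝ : ℝ) := by
      field_simp
      ring
    rw [this, hb₀', hτ']
    linear_combination (-w * (⟪u, u⟫_ℝ : ℝ)) * hβw
  rw [e1, e2, e3]
  ring

/-- The constant of the Gaussian integral is the inverse of the one in the symbol. -/
theorem symbol_mul_gaussian_constant (τ τ' : UpperHalfPlane) {k : ℕ} (hk : 1 ≤ k) (n : ℕ) :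
    (((τ : ℂ) - conj (τ : ℂ)) / ((τ' : ℂ) - conj (τ : ℂ))) ^ ((n : ℂ) / 2) * (k : ℂ) ^ n *
      ((((τ' : ℂ) - conj (τ : ℂ)) / (Complex.I * k)) ^ ((n : ℂ) / 2) *
        (((2 * k * τ.im)⁻¹ : ℝ) : ℂ) ^ ((n : ℂ) / 2)) = 1 := by
  have hkpos : (0 : ℝ) < k := by exact_mod_cast hk
  have hkC : (k : ℂ) ≠ 0 := by exact_mod_cast hkpos.ne'
  have him := τ.im_pos
  have hw0 : (τ' : ℂ) - conj (τ : ℂ) ≠ 0 := sub_conj_ne_zero τ' τ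
  have hττ : (τ : ℂ) - conj (τ : ℂ) = 2 * Complex.I * τ.im := by
    rw [Complex.sub_conj]
    push_cast
    rw [UpperHalfPlane.coe_im]
    ring
  have hwim : 0 < ((τ' : ℂ) - conj (τ : ℂ)).im := by
    have h2 := τ'.im_pos
    simp only [Complex.sub_im, Complex.conj_im, UpperHalfPlane.coe_im]
    linarith
  generalize (τ' : ℂ) - conj (τ : ℂ) = w at *
  set Z : ℂ := w / (Complex.I * k) with hZ
  have hZ0 : Z ≠ 0 := by
    rw [hZ]
    exact div_ne_zero hw0 (mul_ne_zero Complex.I_ne_zero hkC)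
  have hZarg : Z.arg ≠ Real.pi := by
    have h1 : 0 < Z.re := by
      have : Z.re = w.im / k := by
        rw [hZ, div_mul_eq_div_div, Complex.div_I, Complex.div_natCast_re]
        simp
      rw [this]
      positivity
    rw [Ne, Complex.arg_eq_pi_iff]
    exact fun h => absurd h.1 (by linarith)
  have h1 : ((τ : ℂ) - conj (τ : ℂ)) / w = ((2 * τ.im / k : ℝ) : ℂ) * Z⁻¹ := by
    rw [hττ, hZ]
    push_cast
    field_simp
  have hr : (0 : ℝ) < 2 * τ.im / k := by positivity
  have hr' : (0 : ℝ) < (2 * k * τ.im)⁻¹ := by positivity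
  have h2 : ∀ {r : ℝ} (_ : 0 < r) (z : ℂ) (_ : z ≠ 0) (s : ℂ),
      ((r : ℂ) * z) ^ s = (r : ℂ) ^ s * z ^ s := fun {r} hr z hz s => by
    have hr0 : (r : ℂ) ≠ 0 := by exact_mod_cast hr.ne'
    rw [Complex.cpow_def_of_ne_zero (mul_ne_zero hr0 hz), Complex.cpow_def_of_ne_zero hr0,
      Complex.cpow_def_of_ne_zero hz, Complex.log_ofReal_mul hr hz, add_mul, Complex.exp_add,
      Complex.ofReal_log hr.le]
  have h3 : ((2 * τ.im / k : ℝ) : ℂ) ^ ((n : ℂ) / 2) * (((2 * k * τ.im)⁻¹ : ℝ) : ℂ) ^ ((n : ℂ) / 2)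
      * (k : ℂ) ^ n = 1 := by
    rw [← Complex.mul_cpow_ofReal_nonneg hr.le hr'.le, ← Complex.ofReal_mul]
    have e : 2 * τ.im / k * (2 * k * τ.im)⁻¹ = (k⁻¹ : ℝ) * (k⁻¹ : ℝ) := by field_simp
    have hk' : (0 : ℝ) ≤ (k : ℝ)⁻¹ := by positivity
    rw [e, Complex.ofReal_mul, Complex.mul_cpow_ofReal_nonneg hk' hk', ← sq,
      ← Complex.cpow_nat_mul]
    have : ((2 : ℕ) : ℂ) * ((n : ℂ) / 2) = n := by push_cast; ring
    rw [this, Complex.cpow_natCast]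
    push_cast
    rw [← mul_pow, inv_mul_cancel₀ hkC, one_pow]
  have hZp : Z ^ ((n : ℂ) / 2) ≠ 0 := by
    rw [Complex.cpow_def_of_ne_zero hZ0]
    exact Complex.exp_ne_zero _
  rw [h1, h2 hr _ (inv_ne_zero hZ0), Complex.inv_cpow _ _ hZarg]
  calc _ = (((2 * τ.im / k : ℝ) : ℂ) ^ ((n : ℂ) / 2) *
        (((2 * k * τ.im)⁻¹ : ℝ) : ℂ) ^ ((n : ℂ) / 2) * (k : ℂ) ^ n) *
        ((Z ^ ((n : ℂ) / 2))⁻¹ * Z ^ ((n : ℂ) / 2)) := by ring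
    _ = 1 := by rw [h3, inv_mul_cancel₀ hZp, one_mul]

end GaussianKernel

/-! ### The square of the lattice -/

section SquareLattice

open MeasureTheory

variable {t : Type*} [NormedAddCommGroup t] [InnerProductSpace ℝ t] {Λ : Submodule ℤ t}

theorem IsEvenLattice.one_le_norm_prod (hΛ : IsEvenLattice Λ) {γ : t × t} (h : γ ∈ Λ.prod Λ)
    (h0 : γ ≠ 0) : 1 ≤ ‖γ‖ := by
  rw [Submodule.mem_prod] at h
  by_cases h1 : γ.1 = 0
  · have h2 : γ.2 ≠ 0 := fun h2 => h0 (Prod.ext h1 h2)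
    exact (hΛ.one_le_norm h.2 h2).trans (norm_snd_le γ)
  · exact (hΛ.one_le_norm h.1 h1).trans (norm_fst_le γ)

variable [FiniteDimensional ℝ t] [DiscreteTopology Λ] [IsZLattice ℝ Λ]

/-- The basis of `t` formed by a basis of the lattice. -/
def latticeBasis (Λ : Submodule ℤ t) [DiscreteTopology Λ] [IsZLattice ℝ Λ] :
    Module.Basis (Module.Free.ChooseBasisIndex ℤ Λ) ℝ t :=
  (Module.Free.chooseBasis ℤ Λ).ofZLatticeBasis ℝ Λ

theorem span_latticeBasis : Submodule.span ℤ (Set.range (latticeBasis Λ)) = Λ :=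
  (Module.Free.chooseBasis ℤ Λ).ofZLatticeBasis_span ℝ

theorem span_latticeBasis_prod :
    Submodule.span ℤ (Set.range ((latticeBasis Λ).prod (latticeBasis Λ))) = Λ.prod Λ := by
  have h : Set.range ((latticeBasis Λ).prod (latticeBasis Λ)) =
      LinearMap.inl ℤ t t '' Set.range (latticeBasis Λ) ∪
        LinearMap.inr ℤ t t '' Set.range (latticeBasis Λ) := by
    ext z
    simp only [Set.mem_range, Set.mem_union, Set.mem_image, Sum.exists, exists_exists_eq_and,
      Module.Basis.prod_apply]
    simp
  rw [h, LinearMap.span_inl_union_inr, span_latticeBasis]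

instance instDiscreteTopologyProd : DiscreteTopology (Λ.prod Λ) := by
  rw [← span_latticeBasis_prod]
  infer_instance

instance instIsZLatticeProd : IsZLattice ℝ (Λ.prod Λ) := by
  constructor
  rw [← span_latticeBasis_prod]
  exact ZSpan.span_top _

theorem fundamentalDomain_eq : fundamentalDomain Λ = ZSpan.fundamentalDomain (latticeBasis Λ) := by
  ext v
  rw [ZSpan.mem_fundamentalDomain]
  constructor
  · rintro ⟨x, hx, rfl⟩ i
    have : ∑ i, x i • (Module.Free.chooseBasis ℤ Λ i : t) = ∑ i, x i • latticeBasis Λ i := by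
      simp [latticeBasis]
    rw [this, Module.Basis.repr_sum_self]
    exact hx i
  · intro h
    refine ⟨fun i => (latticeBasis Λ).repr v i, h, ?_⟩
    conv_lhs => rw [← (latticeBasis Λ).sum_repr v]
    simp [latticeBasis]

theorem fundamentalDomain_prod_eq : fundamentalDomain Λ ×ˢ fundamentalDomain Λ =
    ZSpan.fundamentalDomain ((latticeBasis Λ).prod (latticeBasis Λ)) := by
  ext v
  simp [fundamentalDomain_eq, ZSpan.mem_fundamentalDomain]

theorem isBounded_fundamentalDomain_prod :
    Bornology.IsBounded (fundamentalDomain Λ ×ˢ fundamentalDomain Λ) := by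
  rw [fundamentalDomain_prod_eq]
  exact ZSpan.fundamentalDomain_isBounded _

variable [MeasurableSpace t] [BorelSpace t]

theorem isAddFundamentalDomain_prod : IsAddFundamentalDomain (Λ.prod Λ)
    (fundamentalDomain Λ ×ˢ fundamentalDomain Λ) (volume : Measure (t × t)) := by
  have h := ZSpan.isAddFundamentalDomain ((latticeBasis Λ).prod (latticeBasis Λ))
    (volume : Measure (t × t))
  rw [fundamentalDomain_prod_eq]
  convert h using 1 <;> rw [span_latticeBasis_prod]

instance instVAddInvariantMeasureProd :
    VAddInvariantMeasure (Λ.prod Λ) (t × t) (volume : Measure (t × t)) :=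
  ⟨fun γ s _ => measure_preimage_add volume (γ : t × t) s⟩

/-- An integral over `t²` is the integral over a fundamental domain of the sum over the lattice. -/
theorem setIntegral_tsum_add {f : t × t → ℂ} (hf : Integrable f) (hc : Continuous f) :
    ∫ y in fundamentalDomain Λ ×ˢ fundamentalDomain Λ, ∑' γ : Λ.prod Λ, f (y + γ) = ∫ y, f y := by
  have hD := isAddFundamentalDomain_prod (Λ := Λ)
  rw [hD.integral_eq_tsum'' f hf, integral_tsum (fun γ => by fun_prop)]
  · simp only [Submodule.vadd_def, vadd_eq_add, add_comm]
  · have h := hD.lintegral_eq_tsum'' fun y => ‖f y‖ₑ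
    simp only [Submodule.vadd_def, vadd_eq_add, add_comm] at h
    rw [← h]
    exact hf.2.ne

end SquareLattice

/-! ### The norm of the half-form frame -/

section HalfForm

variable {t : Type*} [NormedAddCommGroup t] [InnerProductSpace ℝ t]

theorem tangentHermitian_eq (τ : UpperHalfPlane) (v w : t) :
    tangentHermitian τ v w = ((Real.pi / τ.im * ⟪v, w⟫_ℝ : ℝ) : ℂ) := by
  have him : (τ.im : ℂ) ≠ 0 := by exact_mod_cast τ.im_pos.ne'
  have hsub : (τ : ℂ) - conj (τ : ℂ) = 2 * Complex.I * τ.im := by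
    rw [Complex.sub_conj]
    push_cast
    rw [UpperHalfPlane.coe_im]
    ring
  have hsub' : conj (τ : ℂ) - (τ : ℂ) = -(2 * Complex.I * τ.im) := by rw [← hsub]; ring
  simp only [tangentHermitian, omegaC, tangentCoeff, map_div₀, map_neg, map_sub, Complex.conj_conj,
    map_one]
  rw [hsub', hsub]
  have hc : conj (τ : ℂ) = (τ : ℂ) - 2 * Complex.I * τ.im := by rw [← hsub]; ring
  have hI := Complex.I_ne_zero
  push_cast
  field_simp
  rw [hc]
  linear_combination (-2 * Complex.I * τ.im * (⟪v, w⟫_ℝ : ℝ)) * Complex.I_sq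

variable [FiniteDimensional ℝ t] {Λ : Submodule ℤ t} [DiscreteTopology Λ] [IsZLattice ℝ Λ]

theorem halfFormNormSq_pos (τ : UpperHalfPlane) : 0 < halfFormNormSq Λ τ := by
  classical
  refine Real.sqrt_pos.mpr ?_
  rw [canonicalNormSq, inv_pos]
  set G := Matrix.gram ℝ (latticeBasis Λ) with hG
  have hpos : 0 < G.det :=
    (Matrix.posDef_gram_of_linearIndependent (latticeBasis Λ).linearIndependent).det_pos
  have h : (Matrix.of fun i j : Module.Free.ChooseBasisIndex ℤ Λ =>
      tangentHermitian τ (Module.Free.chooseBasis ℤ Λ i : t)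
        (Module.Free.chooseBasis ℤ Λ j : t)) = ((Real.pi / τ.im) • G).map Complex.ofRealHom := by
    ext i j
    simp [tangentHermitian_eq, hG, Matrix.gram_apply, latticeBasis]
  have h2 : 0 < ((Real.pi / τ.im) • G).det := by
    rw [Matrix.det_smul]
    have := Real.pi_pos
    have := τ.im_pos
    positivity
  have h3 := (RingHom.map_det Complex.ofRealHom ((Real.pi / τ.im) • G)).symm
  rw [RingHom.mapMatrix_apply] at h3
  rw [h, h3, Complex.ofRealHom_eq_coe, Complex.ofReal_re]
  exact h2

end HalfForm

/-! ### Translates of the Gaussian kernel -/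

section Translates

variable {t : Type*} [NormedAddCommGroup t] [InnerProductSpace ℝ t]

theorem norm_latticeFactor (γ x : t × t) : ‖latticeFactor γ x‖ = 1 := by
  rw [latticeFactor, norm_mul, Complex.norm_exp, Complex.norm_exp]
  simp

theorem latticeFactor_mul_conj (γ x : t × t) :
    latticeFactor γ x * conj (latticeFactor γ x) = 1 := by
  rw [Complex.mul_conj, Complex.normSq_eq_norm_sq, norm_latticeFactor]
  simp

theorem latticeFactor_zero (x : t × t) : latticeFactor 0 x = 1 := by
  simp [latticeFactor, TorusQuantization.omega]

theorem omega_add_left (x y z : t × t) : omega (x + y) z = omega x z + omega y z := by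
  simp only [TorusQuantization.omega, Prod.fst_add, Prod.snd_add, inner_add_left]
  ring

theorem omega_add_right (x y z : t × t) : omega x (y + z) = omega x y + omega x z := by
  simp only [TorusQuantization.omega, Prod.fst_add, Prod.snd_add, inner_add_right]
  ring

theorem omega_swap (x y : t × t) : omega x y = -omega y x := by
  simp only [TorusQuantization.omega]
  rw [real_inner_comm x.1 y.2, real_inner_comm x.2 y.1]
  ring

theorem omega_neg_left (x y : t × t) : omega (-x) y = -omega x y := by
  simp [TorusQuantization.omega]
  ring

theorem IsEvenLattice.exp_inner {Λ : Submodule ℤ t} (hΛ : IsEvenLattice Λ) {x y : t} (hx : x ∈ Λ)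
    (hy : y ∈ Λ) : Complex.exp (2 * Real.pi * Complex.I * (⟪x, y⟫_ℝ : ℝ)) = 1 := by
  obtain ⟨m, hm⟩ := hΛ.inner_int x hx y hy
  rw [hm, Complex.exp_eq_one_iff]
  exact ⟨m, by push_cast; ring⟩

/-- The action of the lattice on `L` is a group action. -/
theorem latticeFactor_add {Λ : Submodule ℤ t} (hΛ : IsEvenLattice Λ) {γ δ : t × t}
    (hγ : γ ∈ Λ.prod Λ) (hδ : δ ∈ Λ.prod Λ) (x : t × t) :
    latticeFactor (γ + δ) x = latticeFactor γ (x + δ) * latticeFactor δ x := by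
  rw [Submodule.mem_prod] at hγ hδ
  rw [← mul_one (latticeFactor γ (x + δ) * latticeFactor δ x), ← hΛ.exp_inner hδ.1 hγ.2]
  simp only [latticeFactor, ← Complex.exp_add]
  congr 1
  rw [omega_add_left, omega_add_right]
  simp only [TorusQuantization.omega, Prod.fst_add, Prod.snd_add, inner_add_left, inner_add_right]
  rw [real_inner_comm δ.1 γ.2]
  push_cast
  ring

theorem exp_omega {Λ : Submodule ℤ t} (hΛ : IsEvenLattice Λ) {γ δ : t × t}
    (hγ : γ ∈ Λ.prod Λ) (hδ : δ ∈ Λ.prod Λ) :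
    Complex.exp (Complex.I * (omega γ δ : ℝ)) = 1 := by
  rw [Submodule.mem_prod] at hγ hδ
  have h1 := hΛ.exp_inner hγ.1 hδ.2
  have h2 := hΛ.exp_inner hγ.2 hδ.1
  have e : Complex.I * (omega γ δ : ℝ) = 2 * Real.pi * Complex.I * (⟪γ.1, δ.2⟫_ℝ : ℝ) -
      2 * Real.pi * Complex.I * (⟪γ.2, δ.1⟫_ℝ : ℝ) := by
    rw [TorusQuantization.omega]
    push_cast
    ring
  rw [e, Complex.exp_sub, h1, h2, div_one]

variable (τ τ' : UpperHalfPlane)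

/-- The translate of the Gaussian kernel `E` by a lattice vector acting on the second variable. -/
def gaussTerm (γ x y : t × t) : ℂ := latticeFactor γ y * gaussKernel τ τ' x (y + γ)

theorem gaussTerm_zero (x y : t × t) : gaussTerm τ τ' 0 x y = gaussKernel τ τ' x y := by
  simp [gaussTerm, latticeFactor_zero]

/-- The translate can also be obtained by acting on the first variable. -/
theorem gaussTerm_eq (γ x y : t × t) :
    gaussTerm τ τ' γ x y = latticeFactor γ x * gaussKernel τ τ' (x - γ) y := by
  simp only [gaussTerm, latticeFactor, gaussKernel, ← Complex.exp_add]
  congr 1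
  rw [sub_eq_add_neg x γ, omega_add_left, omega_add_right y x (-γ), omega_swap y (-γ),
    omega_neg_left]
  have : x - (y + γ) = x + -γ - y := by abel
  rw [this]
  push_cast
  ring

theorem norm_gaussTerm (γ x y : t × t) :
    ‖gaussTerm τ τ' γ x y‖ = Real.exp (gaussForm τ τ' (x - y - γ)).re := by
  rw [gaussTerm, norm_mul, norm_latticeFactor, one_mul, norm_gaussKernel, sub_sub]

variable {τ τ'} {Λ : Submodule ℤ t}

theorem gaussTerm_add_right (hΛ : IsEvenLattice Λ) {γ δ : t × t} (hγ : γ ∈ Λ.prod Λ)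
    (hδ : δ ∈ Λ.prod Λ) (x y : t × t) :
    gaussTerm τ τ' γ x (y + δ) = conj (latticeFactor δ y) * gaussTerm τ τ' (γ + δ) x y := by
  rw [gaussTerm, gaussTerm, latticeFactor_add hΛ hγ hδ]
  have := latticeFactor_mul_conj δ y
  have e : y + (γ + δ) = y + δ + γ := by abel
  rw [e]
  linear_combination (-latticeFactor γ (y + δ) * gaussKernel τ τ' x (y + δ + γ)) * this

theorem gaussTerm_add_left (hΛ : IsEvenLattice Λ) {γ δ : t × t} (hγ : γ ∈ Λ.prod Λ)
    (hδ : δ ∈ Λ.prod Λ) (x y : t × t) :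
    gaussTerm τ τ' γ (x + δ) y = latticeFactor δ x * gaussTerm τ τ' (γ - δ) x y := by
  rw [gaussTerm_eq, gaussTerm_eq]
  have h1 := latticeFactor_add hΛ (sub_mem hγ hδ) hδ x
  rw [sub_add_cancel] at h1
  have h2 : latticeFactor γ (x + δ) =
      latticeFactor γ x * Complex.exp (Complex.I / 2 * (omega γ δ : ℝ)) := by
    simp only [latticeFactor, omega_add_right, ← Complex.exp_add]
    congr 1
    push_cast
    ring
  have h3 : latticeFactor (γ - δ) (x + δ) =
      latticeFactor (γ - δ) x * Complex.exp (Complex.I / 2 * (omega γ δ : ℝ)) := by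
    have h0 : omega δ δ = 0 := by
      have := omega_swap δ δ
      linarith
    have : omega (γ - δ) δ = omega γ δ := by
      rw [sub_eq_add_neg, omega_add_left, omega_neg_left, h0]
      ring
    simp only [latticeFactor, omega_add_right, this, ← Complex.exp_add]
    congr 1
    push_cast
    ring
  have h4 : Complex.exp (Complex.I / 2 * (omega γ δ : ℝ)) *
      Complex.exp (Complex.I / 2 * (omega γ δ : ℝ)) = 1 := by
    rw [← Complex.exp_add, ← exp_omega hΛ hγ hδ]
    congr 1
    ring
  have e : x + δ - γ = x - (γ - δ) := by abel
  rw [h2, h1, h3, e]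
  linear_combination (latticeFactor (γ - δ) x * latticeFactor δ x *
    gaussKernel τ τ' (x - (γ - δ)) y) * h4

end Translates

/-! ### The periodized kernel -/

section PeriodizedKernel

variable {t : Type*} [NormedAddCommGroup t] [InnerProductSpace ℝ t] {Λ : Submodule ℤ t}

/-- The sum over the lattice of the translates of the `k`-th power of the Gaussian kernel. -/
def latticeKernel (Λ : Submodule ℤ t) (τ τ' : UpperHalfPlane) (k : ℕ) (x y : t × t) : ℂ :=
  ∑' γ : Λ.prod Λ, gaussTerm τ τ' γ x y ^ k

/-- The conjugate of the Gaussian kernel as a function of its second variable: the product of the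
exponential of a quadratic form and of the exponential of a complex linear form in `ζ`. -/
theorem conj_gaussKernel_pow (τ τ' : UpperHalfPlane) (k : ℕ) (z y : t × t) :
    conj (gaussKernel τ τ' z y) ^ k =
      Complex.exp (k * conj (gaussForm τ τ' z)) *
      (Complex.exp (quadForm (k * (Real.pi * Complex.I / (conj (τ' : ℂ) - τ)))
        (k * (Real.pi * Complex.I / (conj (τ' : ℂ) - τ)) * (conj (τ' : ℂ) + τ))
        (k * (Real.pi * Complex.I / (conj (τ' : ℂ) - τ)) * (conj (τ' : ℂ) * τ)) y) *
      Complex.exp ((-2 * (k * (Real.pi * Complex.I / (conj (τ' : ℂ) - τ))) : ℂ) *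
        (zetaForm τ z.1 y + conj (τ' : ℂ) * zetaForm τ z.2 y))) := by
  have hw : conj (τ' : ℂ) - τ ≠ 0 := by
    have := sub_conj_ne_zero τ τ'
    rwa [← neg_sub, neg_ne_zero]
  have hw' : (Real.pi * Complex.I / (conj (τ' : ℂ) - τ)) * (conj (τ' : ℂ) - τ) =
    Real.pi * Complex.I := by field_simp
  rw [gaussKernel, ← Complex.exp_conj, ← Complex.exp_nat_mul, ← Complex.exp_add, ← Complex.exp_add]
  congr 1
  simp only [gaussForm, quadForm, zetaForm_apply, map_add, map_mul, map_div₀, map_neg, map_sub,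
    Complex.conj_conj, Complex.conj_I, Complex.conj_ofReal, TorusQuantization.omega, map_ofNat,
    Prod.fst_sub, Prod.snd_sub, inner_sub_left, inner_sub_right]
  rw [real_inner_comm z.1 y.1, real_inner_comm z.1 y.2, real_inner_comm z.2 y.1,
    real_inner_comm z.2 y.2]
  push_cast
  simp only [mul_neg, neg_neg, neg_mul, mul_div_right_comm]
  linear_combination (k * ((⟪z.2, y.1⟫_ℝ : ℝ) - (⟪z.1, y.2⟫_ℝ : ℝ)) : ℂ) * hw'

theorem exists_norm_gaussTerm_le (τ τ' : UpperHalfPlane) : ∃ c : ℝ, 0 < c ∧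
    ∀ γ x y : t × t, ‖gaussTerm τ τ' γ x y‖ ≤ Real.exp (-c * ‖y - x + γ‖ ^ 2) := by
  obtain ⟨c, hc, h⟩ := exists_re_gaussForm_le (t := t) τ τ'
  refine ⟨c, hc, fun γ x y => ?_⟩
  rw [norm_gaussTerm, Real.exp_le_exp]
  have e : y - x + γ = -(x - y - γ) := by abel
  rw [e, norm_neg]
  exact h _

variable [FiniteDimensional ℝ t] [DiscreteTopology Λ] [IsZLattice ℝ Λ]

/-- The periodized kernel is antiholomorphic in its second variable: its conjugate is a Gaussian
section times a locally uniformly convergent sum of exponentials of linear forms in `ζ`. -/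
theorem conj_latticeKernel_mem (hΛ : IsEvenLattice Λ) (τ τ' : UpperHalfPlane) {k : ℕ} (hk : 1 ≤ k)
    (x : t × t) : (fun y => conj (latticeKernel Λ τ τ' k x y)) ∈ QuantumSpace Λ τ k := by
  have hkpos : (0 : ℝ) < k := by exact_mod_cast hk
  set β : ℂ := k * (Real.pi * Complex.I / (conj (τ' : ℂ) - τ)) with hβ
  have hw : conj (τ' : ℂ) - τ ≠ 0 := by
    have := sub_conj_ne_zero τ τ'
    rwa [← neg_sub, neg_ne_zero]
  have hw' : β * (conj (τ' : ℂ) - τ) = k * Real.pi * Complex.I := by rw [hβ]; field_simp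
  set a : Λ.prod Λ → ℂ := fun γ => conj (latticeFactor γ x) ^ k *
    Complex.exp (k * conj (gaussForm τ τ' (x - (γ : t × t)))) with ha
  set lam : Λ.prod Λ → (t × t) →L[ℝ] ℂ := fun γ => (-2 * β) •
    (zetaForm τ (x - (γ : t × t)).1 + conj (τ' : ℂ) • zetaForm τ (x - (γ : t × t)).2) with hlam
  obtain ⟨c, hc, hle⟩ := exists_re_gaussForm_le (t := t) τ τ'
  have hES : ExpSummable a lam := by
    refine expSummable_of_gaussian (Λ.prod Λ) (c := k * c) (M := 1)
      (C := ‖-2 * β‖ * ((1 + ‖(τ : ℂ)‖) + ‖(τ' : ℂ)‖ * (1 + ‖(τ : ℂ)‖))) (by positivity) (-x)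
      (fun γ => ?_) fun γ => ?_
    all_goals
      have e : ‖-x + (γ : t × t)‖ = ‖x - (γ : t × t)‖ := by rw [← norm_neg]; congr 1; abel
      rw [e]
    · have h1 := hle (x - (γ : t × t))
      rw [ha, one_mul, norm_mul, norm_pow, RCLike.norm_conj, norm_latticeFactor, one_pow, one_mul,
        Complex.norm_exp, Real.exp_le_exp, ← Complex.ofReal_natCast, Complex.re_ofReal_mul,
        Complex.conj_re]
      nlinarith
    · have h1 : ‖zetaForm τ (x - (γ : t × t)).1‖ ≤ (1 + ‖(τ : ℂ)‖) * ‖x - (γ : t × t)‖ :=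
        (norm_zetaForm_le _ _).trans (by gcongr; exact norm_fst_le _)
      have h2 : ‖zetaForm τ (x - (γ : t × t)).2‖ ≤ (1 + ‖(τ : ℂ)‖) * ‖x - (γ : t × t)‖ :=
        (norm_zetaForm_le _ _).trans (by gcongr; exact norm_snd_le _)
      calc ‖lam γ‖ = ‖-2 * β‖ *
            ‖zetaForm τ (x - (γ : t × t)).1 + conj (τ' : ℂ) • zetaForm τ (x - (γ : t × t)).2‖ :=
            norm_smul_clm _ _
        _ ≤ ‖-2 * β‖ * ((1 + ‖(τ : ℂ)‖) * ‖x - (γ : t × t)‖ +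
            ‖(τ' : ℂ)‖ * ((1 + ‖(τ : ℂ)‖) * ‖x - (γ : t × t)‖)) := by
          refine mul_le_mul_of_nonneg_left (((norm_add_le (_ : (t × t) →L[ℝ] ℂ) _).trans ?_) :
            ‖zetaForm τ (x - (γ : t × t)).1 + conj (τ' : ℂ) • zetaForm τ (x - (γ : t × t)).2‖ ≤ _)
            (norm_nonneg _)
          rw [norm_smul_clm, RCLike.norm_conj]
          gcongr
        _ = _ := by ring
  have hfun : (fun y => conj (latticeKernel Λ τ τ' k x y)) = fun y =>
      Complex.exp (quadForm β (β * (conj (τ' : ℂ) + τ)) (β * (conj (τ' : ℂ) * τ)) y) *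
        ∑' γ, a γ * Complex.exp (lam γ y) := by
    ext y
    rw [latticeKernel, Complex.conj_tsum, ← tsum_mul_left]
    congr 1
    ext γ
    rw [gaussTerm_eq, map_pow, map_mul, mul_pow, conj_gaussKernel_pow, ← hβ, ha, hlam]
    simp only [_root_.smul_apply, _root_.add_apply, smul_eq_mul]
    ring
  refine ⟨?_, ?_, ?_⟩
  · rw [hfun]
    exact (contDiff_exp_quadForm _ _ _).mul hES.contDiff
  · intro δ h1 h2 y
    have hδ : δ ∈ Λ.prod Λ := ⟨h1, h2⟩
    simp only [latticeKernel, Complex.conj_tsum]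
    rw [← (Equiv.addRight (⟨δ, hδ⟩ : Λ.prod Λ)).tsum_eq (fun γ : Λ.prod Λ =>
      conj (gaussTerm τ τ' γ x y ^ k)), ← tsum_mul_left]
    congr 1
    ext γ
    rw [gaussTerm_add_right hΛ γ.2 hδ, mul_pow, map_mul, map_pow, Complex.conj_conj]
    rfl
  · rw [hfun]
    refine IsHolomorphic.mul (isHolomorphic_exp_quadForm ?_ ?_)
      ((contDiff_exp_quadForm _ _ _).differentiable (by simp))
      (hES.contDiff.differentiable (by simp)) (hES.fderiv_holomorphic fun γ v => ?_)
    · linear_combination hw'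
    · linear_combination τ * hw'
    · simp only [hlam, _root_.smul_apply, _root_.add_apply, zetaForm_apply, smul_eq_mul,
        inner_zero_right]
      push_cast
      ring

end PeriodizedKernel

/-! ### The Schwartz kernel of the operators -/

section SchwartzKernel

open MeasureTheory

theorem exists_tsum_enorm_thetaTerm_le {t : Type*} [NormedAddCommGroup t]
    [InnerProductSpace ℝ t] [FiniteDimensional ℝ t] (Λ : Submodule ℤ t) [DiscreteTopology Λ]
    [IsZLattice ℝ Λ] (τ : UpperHalfPlane) {k : ℕ} (hk : 1 ≤ k) (μ : t) : ∃ C : ℝ, ∀ y : t × t,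
      ∑' l : Λ, ‖thetaTerm τ k (μ + l) y‖ₑ ≤ ENNReal.ofReal C := by
  have hkpos : (0 : ℝ) < k := by exact_mod_cast hk
  have hc : 0 < k * Real.pi * τ.im := by
    have := τ.im_pos
    have := Real.pi_pos
    positivity
  obtain ⟨C, hC⟩ := exists_tsum_exp_neg_sq_norm_add_le Λ hc
  refine ⟨C, fun y => ?_⟩
  have hn : ∀ l : Λ, ‖thetaTerm τ k (μ + l) y‖ =
      Real.exp (-(k * Real.pi * τ.im) * ‖μ - y.2 + l‖ ^ 2) := fun l => by
    rw [norm_thetaTerm, ← norm_neg]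
    congr 4
    abel
  have hs : Summable fun l : Λ => Real.exp (-(k * Real.pi * τ.im) * ‖μ - y.2 + l‖ ^ 2) := by
    simpa using summable_exp_neg_sq_norm_add Λ hc 0 (μ - y.2)
  have : ∀ l : Λ, ‖thetaTerm τ k (μ + l) y‖ₑ =
      ENNReal.ofReal (Real.exp (-(k * Real.pi * τ.im) * ‖μ - y.2 + l‖ ^ 2)) := fun l => by
    rw [← hn, ofReal_norm]
  simp only [this]
  rw [← ENNReal.ofReal_tsum_of_nonneg (fun _ => (Real.exp_pos _).le) hs]
  exact ENNReal.ofReal_le_ofReal (hC _)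

variable {t : Type*} [NormedAddCommGroup t] [InnerProductSpace ℝ t] [FiniteDimensional ℝ t]
  [MeasurableSpace t] [BorelSpace t] {Λ : Submodule ℤ t} [DiscreteTopology Λ] [IsZLattice ℝ Λ]

theorem integrable_gaussKernel_pow (τ τ' : UpperHalfPlane) {k : ℕ} (hk : 1 ≤ k) (x : t × t) :
    Integrable fun y => gaussKernel τ τ' x y ^ k := by
  obtain ⟨c, hc, hle⟩ := exists_re_gaussForm_le (t := t) τ τ'
  have hkpos : (0 : ℝ) < k := by exact_mod_cast hk
  have h := (integrable_exp_neg_mul_sq_norm_prod (V := t) (mul_pos hkpos hc)).comp_add_right (-x)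
  refine h.mono' ((continuous_gaussKernel_right τ τ' x).pow k).aestronglyMeasurable
    (Filter.Eventually.of_forall fun y => ?_)
  rw [norm_pow, norm_gaussKernel, ← Real.exp_nat_mul, Real.exp_le_exp]
  have := hle (x - y)
  rw [← norm_neg, neg_sub, sub_eq_add_neg y x] at this
  nlinarith

/-- The kernel on the universal cover sends the theta series for `τ` to the one for `τ'`. -/
theorem integral_theta_mul_gaussKernel_pow (Λ : Submodule ℤ t) [DiscreteTopology Λ]
    [IsZLattice ℝ Λ] (τ τ' : UpperHalfPlane) {k : ℕ} (hk : 1 ≤ k) (μ : t) (x : t × t) :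
    Integrable (fun y => (∑' l : Λ, thetaTerm τ k (μ + l) y) * gaussKernel τ τ' x y ^ k) ∧
    ∫ y, (∑' l : Λ, thetaTerm τ k (μ + l) y) * gaussKernel τ τ' x y ^ k =
      (((τ' : ℂ) - conj (τ : ℂ)) / (Complex.I * k)) ^ (Module.finrank ℝ t / 2 : ℂ) *
        (((2 * k * τ.im)⁻¹ : ℝ) : ℂ) ^ (Module.finrank ℝ t / 2 : ℂ) *
          ∑' l : Λ, thetaTerm τ' k (μ + l) x := by
  obtain ⟨C, hC⟩ := exists_tsum_enorm_thetaTerm_le Λ τ hk μ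
  have hE := integrable_gaussKernel_pow τ τ' hk x
  have hEc := continuous_gaussKernel_right τ τ' x
  have hm : ∀ l : Λ, Continuous fun y => thetaTerm τ k (μ + l) y * gaussKernel τ τ' x y ^ k :=
    fun l => (continuous_thetaTerm τ k _).mul (hEc.pow k)
  have hfin : ∑' l : Λ, ∫⁻ y, ‖thetaTerm τ k (μ + l) y * gaussKernel τ τ' x y ^ k‖ₑ ≠ ⊤ := by
    rw [← lintegral_tsum fun l => (hm l).enorm.measurable.aemeasurable]
    refine ne_top_of_le_ne_top (b := ∫⁻ y, ENNReal.ofReal C * ‖gaussKernel τ τ' x y ^ k‖ₑ) ?_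
      (lintegral_mono fun y => ?_)
    · rw [lintegral_const_mul' _ _ ENNReal.ofReal_ne_top]
      exact ENNReal.mul_ne_top ENNReal.ofReal_ne_top hE.2.ne
    · simp only [enorm_mul, ENNReal.tsum_mul_right]
      gcongr
      exact hC y
  have hint := fun l : Λ => (integrable_gaussKernel_pow_mul_thetaTerm τ τ' hk (μ + l) x)
  constructor
  · refine ⟨?_, ?_⟩
    · have hmeas : Measurable fun y => ∑' l : Λ, thetaTerm τ k (μ + l) y :=
        Measurable.tsum fun l => (continuous_thetaTerm τ k _).measurable
      exact (hmeas.mul (hEc.pow k).measurable).aestronglyMeasurable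
    · rw [← lintegral_tsum fun l => (hm l).enorm.measurable.aemeasurable] at hfin
      refine lt_of_le_of_lt (lintegral_mono fun y => ?_) (lt_top_iff_ne_top.mpr hfin)
      simp only [← tsum_mul_right]
      exact enorm_tsum_le_tsum_enorm
  · simp only [← tsum_mul_right]
    rw [integral_tsum (fun l => (hm l).aestronglyMeasurable) hfin, ← tsum_mul_left]
    congr 1
    ext l
    rw [← integral_gaussKernel_pow_mul_thetaTerm τ τ' hk]
    simp only [mul_comm]

/-- The periodized kernel sends the theta functions for `τ` to those for `τ'`. -/
theorem setIntegral_thetaSection_mul_latticeKernel (hΛ : IsEvenLattice Λ) (τ τ' : UpperHalfPlane)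
    {k : ℕ} (hk : 1 ≤ k) {μ : t} (hμ : MemScaledDual Λ k μ) (x : t × t) :
    ∫ y in fundamentalDomain Λ ×ˢ fundamentalDomain Λ,
      (thetaSection hΛ τ hk hμ : t × t → ℂ) y * latticeKernel Λ τ τ' k x y =
      (((τ' : ℂ) - conj (τ : ℂ)) / (Complex.I * k)) ^ (Module.finrank ℝ t / 2 : ℂ) *
        (((2 * k * τ.im)⁻¹ : ℝ) : ℂ) ^ (Module.finrank ℝ t / 2 : ℂ) *
          (thetaSection hΛ τ' hk hμ : t × t → ℂ) x := by
  have hcoe : ∀ (τ : UpperHalfPlane) (y : t × t), (thetaSection hΛ τ hk hμ : t × t → ℂ) y =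
      ∑' l : Λ, thetaTerm τ k (μ + l) y := fun τ y => theta_mul_baseSection Λ τ k μ y
  obtain ⟨hint, heq⟩ := integral_theta_mul_gaussKernel_pow Λ τ τ' hk μ x
  simp only [← hcoe] at hint heq
  have hc : Continuous fun y =>
      (thetaSection hΛ τ hk hμ : t × t → ℂ) y * gaussKernel τ τ' x y ^ k :=
    (thetaSection hΛ τ hk hμ).2.1.continuous.mul ((continuous_gaussKernel_right τ τ' x).pow k)
  rw [← heq, ← setIntegral_tsum_add (Λ := Λ) hint hc]
  congr 1
  ext y
  rw [latticeKernel, ← tsum_mul_left]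
  congr 1
  ext γ
  have hγ := Submodule.mem_prod.mp γ.2
  rw [(thetaSection hΛ τ hk hμ).2.2.1 γ hγ.1 hγ.2, gaussTerm]
  ring

/-- The kernel of the operator `R₂(A, e)`. -/
def schwartzKernel (Λ : Submodule ℤ t) [Module.Finite ℤ Λ] (τ : UpperHalfPlane)
    (g : Mo₂ (Module.finrank ℝ t)) (k : ℕ) (z : (t × t) × (t × t)) : ℂ :=
  ((k : ℂ) / (2 * Real.pi)) ^ Module.finrank ℝ t *
    (modularSymbol g τ / (halfFormNormSq Λ τ : ℂ)) *
      latticeKernel Λ τ (mobius g.A⁻¹ τ) k (modularAction g.A⁻¹ z.1) z.2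

/-- The kernel is exact. The theta functions spanning the quantum space, it is enough to integrate
the kernel against each of them, which is done by unfolding and evaluating a Gaussian integral. -/
theorem isSchwartzKernel_schwartzKernel (hΛ : IsEvenLattice Λ) (τ : UpperHalfPlane)
    (g : Mo₂ (Module.finrank ℝ t)) {k : ℕ} (hk : 1 ≤ k)
    {R : QuantumSpace Λ τ k →ₗ[ℂ] QuantumSpace Λ τ k} (hR : IsR₂ Λ τ g k R) :
    IsSchwartzKernel Λ τ k R (schwartzKernel Λ τ g k) := by
  set τ' := mobius g.A⁻¹ τ with hτ'
  set D : Set (t × t) := fundamentalDomain Λ ×ˢ fundamentalDomain Λ with hD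
  have hpi : (Real.pi : ℂ) ≠ 0 := by exact_mod_cast Real.pi_ne_zero
  have hh : (halfFormNormSq Λ τ : ℂ) ≠ 0 := by exact_mod_cast (halfFormNormSq_pos τ).ne'
  refine ⟨fun x => ?_, fun σ x => ?_⟩
  · have h := (QuantumSpace Λ τ k).smul_mem (conj (((k : ℂ) / (2 * Real.pi)) ^ Module.finrank ℝ t *
      (modularSymbol g τ / (halfFormNormSq Λ τ : ℂ))))
      (conj_latticeKernel_mem hΛ τ τ' hk (modularAction g.A⁻¹ x))
    convert h using 1
    ext y
    simp only [schwartzKernel, Pi.smul_apply, smul_eq_mul]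
    rw [map_mul]
  · set x' := modularAction g.A⁻¹ x with hx'
    -- both sides are linear in the section, hence it suffices to compare them on theta functions
    have hint : ∀ σ : QuantumSpace Λ τ k, IntegrableOn (fun y => (σ : t × t → ℂ) y *
        latticeKernel Λ τ τ' k x' y) D := fun σ => by
      have hc : Continuous fun y => (σ : t × t → ℂ) y * latticeKernel Λ τ τ' k x' y := by
        have h := Complex.continuous_conj.comp (conj_latticeKernel_mem hΛ τ τ' hk x').1.continuous
        simp only [Function.comp_def, Complex.conj_conj] at h
        exact σ.2.1.continuous.mul h
      exact (hc.continuousOn.integrableOn_compact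
        isBounded_fundamentalDomain_prod.isCompact_closure).mono_set subset_closure
    let S : QuantumSpace Λ τ k →ₗ[ℂ] ℂ :=
      { toFun := fun σ => (k : ℂ) ^ Module.finrank ℝ t * modularSymbol g τ *
          ∫ y in D, (σ : t × t → ℂ) y * latticeKernel Λ τ τ' k x' y
        map_add' := fun σ σ' => by
          rw [← mul_add, ← integral_add (hint σ) (hint σ')]
          simp only [Submodule.coe_add, Pi.add_apply, add_mul]
        map_smul' := fun c σ => by
          simp only [Submodule.coe_smul, Pi.smul_apply, smul_eq_mul, RingHom.id_apply, mul_assoc]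
          rw [integral_const_mul]
          ring }
    let S' : QuantumSpace Λ τ k →ₗ[ℂ] ℂ :=
      { toFun := fun σ => (R σ : t × t → ℂ) x
        map_add' := fun σ σ' => by simp
        map_smul' := fun c σ => by simp }
    have hS : S' = S := by
      refine linearMap_ext_theta hΛ hk fun μ hμ => ?_
      change (R (thetaSection hΛ τ hk hμ) : t × t → ℂ) x = (k : ℂ) ^ Module.finrank ℝ t *
        modularSymbol g τ * ∫ y in D, (thetaSection hΛ τ hk hμ : t × t → ℂ) y *
          latticeKernel Λ τ τ' k x' y
      rw [hR.apply_thetaSection hΛ hk hμ, setIntegral_thetaSection_mul_latticeKernel hΛ τ τ' hk hμ]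
      have hm : modularSymbol g τ = g.e τ' * (((τ : ℂ) - conj (τ : ℂ)) /
          ((τ' : ℂ) - conj (τ : ℂ))) ^ ((Module.finrank ℝ t : ℂ) / 2) := by
        have h := modularSymbol_mobius g τ'
        rw [hτ', mobius_mobius_inv] at h
        rw [h, modularSymbol, mobius_mobius_inv]
      have hc := symbol_mul_gaussian_constant τ τ' hk (Module.finrank ℝ t)
      rw [hm, ← hx', ← hτ']
      linear_combination (-g.e τ' * (thetaSection hΛ τ' hk hμ : t × t → ℂ) x') * hc
    have h := LinearMap.congr_fun hS σ
    change (R σ : t × t → ℂ) x = (k : ℂ) ^ Module.finrank ℝ t * modularSymbol g τ *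
      ∫ y in D, (σ : t × t → ℂ) y * latticeKernel Λ τ τ' k x' y at h
    rw [h, scalarProduct]
    have e : ∀ y, (σ : t × t → ℂ) y * conj (conj (schwartzKernel Λ τ g k (x, y))) *
        (halfFormNormSq Λ τ : ℂ) = ((k : ℂ) / (2 * Real.pi)) ^ Module.finrank ℝ t *
          modularSymbol g τ * ((σ : t × t → ℂ) y * latticeKernel Λ τ τ' k x' y) := fun y => by
      rw [Complex.conj_conj, schwartzKernel, ← hx', ← hτ']
      field_simp
    simp only [e]
    have h2 : (2 * Real.pi : ℂ) ≠ 0 := mul_ne_zero two_ne_zero hpi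
    rw [integral_const_mul, ← mul_assoc, ← mul_assoc, ← mul_pow, mul_div_cancel₀ _ h2]

end SchwartzKernel

/-! ### The phase section `F` -/

section HolomorphicKernel

variable {t : Type*} [NormedAddCommGroup t] [InnerProductSpace ℝ t]

theorem isHolomorphic_conj_gaussKernel (τ τ' : UpperHalfPlane) (z : t × t) :
    IsHolomorphic τ 1 fun y => conj (gaussKernel τ τ' z y) := by
  set β : ℂ := (1 : ℕ) * (Real.pi * Complex.I / (conj (τ' : ℂ) - τ)) with hβ
  have hw : conj (τ' : ℂ) - τ ≠ 0 := by
    have := sub_conj_ne_zero τ τ'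
    rwa [← neg_sub, neg_ne_zero]
  have hw' : β * (conj (τ' : ℂ) - τ) = (1 : ℕ) * Real.pi * Complex.I := by rw [hβ]; field_simp
  set a : Unit → ℂ := fun _ => Complex.exp ((1 : ℕ) * conj (gaussForm τ τ' z)) with ha
  set lam : Unit → (t × t) →L[ℝ] ℂ := fun _ => (-2 * β) •
    (zetaForm τ z.1 + conj (τ' : ℂ) • zetaForm τ z.2) with hlam
  have hES : ExpSummable a lam := fun R => (hasSum_fintype _).summable
  have hd : Differentiable ℝ fun y => ∑' i, a i * Complex.exp (lam i y) :=
    fun y => (hES.hasFDerivAt y).differentiableAt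
  have hfun : (fun y => conj (gaussKernel τ τ' z y)) = fun y =>
      Complex.exp (quadForm β (β * (conj (τ' : ℂ) + τ)) (β * (conj (τ' : ℂ) * τ)) y) *
        ∑' i, a i * Complex.exp (lam i y) := by
    ext y
    rw [← pow_one (conj (gaussKernel τ τ' z y)), conj_gaussKernel_pow, ← hβ, tsum_fintype]
    simp only [Finset.univ_unique, Finset.sum_singleton, ha, hlam, _root_.smul_apply,
      _root_.add_apply, smul_eq_mul]
    ring
  rw [hfun]
  refine IsHolomorphic.mul (isHolomorphic_exp_quadForm ?_ ?_)
    ((contDiff_exp_quadForm _ _ _).differentiable (by simp)) hd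
    (hES.fderiv_holomorphic fun i v => ?_)
  · linear_combination hw'
  · linear_combination τ * hw'
  · simp only [hlam, _root_.smul_apply, _root_.add_apply, zetaForm_apply, smul_eq_mul,
      inner_zero_right]
    push_cast
    ring

/-- The Gaussian kernel is Hermitian. -/
theorem conj_gaussKernel (τ τ' : UpperHalfPlane) (x y : t × t) :
    conj (gaussKernel τ' τ y x) = gaussKernel τ τ' x y := by
  rw [gaussKernel, gaussKernel, ← Complex.exp_conj, ← neg_sub x y, gaussForm_neg, omega_swap x y]
  congr 1
  have h : conj (τ : ℂ) - τ' = -((τ' : ℂ) - conj (τ : ℂ)) := by ring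
  simp only [gaussForm, quadForm, map_add, map_mul, map_div₀, map_neg, map_sub,
    Complex.conj_conj, Complex.conj_I, Complex.conj_ofReal, map_ofNat, Complex.ofReal_neg]
  rw [h]
  have h0 := sub_conj_ne_zero τ' τ
  field_simp
  ring

theorem isHolomorphic_gaussKernel (τ τ' : UpperHalfPlane) (y : t × t) :
    IsHolomorphic τ' 1 fun x => gaussKernel τ τ' x y := by
  have h := isHolomorphic_conj_gaussKernel τ' τ y
  simp only [conj_gaussKernel] at h
  exact h

theorem covDerivLeft_eq {k : ℕ} {F : (t × t) × (t × t) → ℂ} {z : (t × t) × (t × t)}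
    (hF : DifferentiableAt ℝ F z) (w : t × t) :
    covDerivLeft k F z w = covDeriv k (fun x => F (x, z.2)) z.1 w := by
  have h : HasFDerivAt (fun x => F (x, z.2))
      ((fderiv ℝ F z).comp (ContinuousLinearMap.inl ℝ (t × t) (t × t))) z.1 :=
    HasFDerivAt.comp z.1 (g := F) hF.hasFDerivAt (hasFDerivAt_prodMk_left z.1 z.2)
  rw [covDerivLeft, covDeriv, h.fderiv]
  simp

theorem covDerivRight_eq {k : ℕ} {F : (t × t) × (t × t) → ℂ} {z : (t × t) × (t × t)}
    (hF : DifferentiableAt ℝ F z) (w : t × t) :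
    covDerivRight k F z w = conj (covDeriv k (fun y => conj (F (z.1, y))) z.2 w) := by
  have h : HasFDerivAt (fun y => F (z.1, y))
      ((fderiv ℝ F z).comp (ContinuousLinearMap.inr ℝ (t × t) (t × t))) z.2 :=
    HasFDerivAt.comp z.2 (g := F) hF.hasFDerivAt (hasFDerivAt_prodMk_right z.1 z.2)
  have h' : HasFDerivAt (fun y => conj (F (z.1, y))) _ z.2 :=
    Complex.conjCLE.toContinuousLinearMap.hasFDerivAt.comp z.2 h
  rw [covDerivRight, covDeriv, h'.fderiv]
  simp

theorem contDiff_gaussTerm (τ τ' : UpperHalfPlane) (γ : t × t) :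
    ContDiff ℝ ∞ fun z : (t × t) × (t × t) => gaussTerm τ τ' γ z.1 z.2 := by
  have h1 : ContDiff ℝ ∞ fun z : (t × t) × (t × t) => ((omega γ z.2 : ℝ) : ℂ) := by
    refine Complex.ofRealCLM.contDiff.comp (?_ : ContDiff ℝ ∞ fun z : (t × t) × (t × t) =>
      2 * Real.pi * (⟪γ.1, z.2.2⟫_ℝ - ⟪γ.2, z.2.1⟫_ℝ))
    exact contDiff_const.mul ((contDiff_const.inner ℝ contDiff_snd.snd).sub
      (contDiff_const.inner ℝ contDiff_snd.fst))
  have h2 : ContDiff ℝ ∞ fun z : (t × t) × (t × t) => latticeFactor γ z.2 :=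
    contDiff_const.mul (contDiff_const.mul h1).cexp
  have h3 : ContDiff ℝ ∞ fun z : (t × t) × (t × t) => (z.1, z.2 + γ) :=
    contDiff_fst.prodMk (contDiff_snd.add contDiff_const)
  have h4 := (contDiff_gaussKernel τ τ').comp h3
  simp only [Function.comp_def] at h4
  exact h2.mul h4

end HolomorphicKernel

section Phase

variable {t : Type*} [NormedAddCommGroup t] [InnerProductSpace ℝ t] [FiniteDimensional ℝ t]

/-- A smooth cutoff function, equal to `1` near the origin, and with support in a ball of radius
`1/4`. The distance of two points of the square of an even lattice is at least `1`, so that the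
translates of the support are far apart. -/
def cutoff (t : Type*) [NormedAddCommGroup t] [InnerProductSpace ℝ t] [FiniteDimensional ℝ t] :
    ContDiffBump (0 : t × t) where
  rIn := 1 / 8
  rOut := 1 / 4
  rIn_pos := by norm_num
  rIn_lt_rOut := by norm_num

theorem cutoff_eq_one {v : t × t} (h : ‖v‖ ≤ 1 / 8) : cutoff t v = 1 :=
  (cutoff t).one_of_mem_closedBall (by rw [mem_closedBall_zero_iff]; exact h)

theorem cutoff_eq_zero {v : t × t} (h : 1 / 4 ≤ ‖v‖) : cutoff t v = 0 :=
  (cutoff t).zero_of_le_dist (by rw [dist_zero_right]; exact h)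

variable {Λ : Submodule ℤ t}

/-- Near a given point, at most one translate of the cutoff function does not vanish. -/
theorem exists_cutoff_sub_eq_zero (hΛ : IsEvenLattice Λ) (v₀ : t × t) : ∃ γ₀ : Λ.prod Λ,
    ∀ v : t × t, ‖v - v₀‖ < 1 / 4 → ∀ γ : Λ.prod Λ, γ ≠ γ₀ → cutoff t (v - γ) = 0 := by
  have key : ∀ (γ : Λ.prod Λ) (v : t × t), ‖v - v₀‖ < 1 / 4 → cutoff t (v - γ) ≠ 0 →
      ‖v₀ - (γ : t × t)‖ < 1 / 2 := fun γ v hv hne => by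
    have h1 : ‖v - (γ : t × t)‖ < 1 / 4 := by
      by_contra h
      exact hne (cutoff_eq_zero (not_lt.mp h))
    calc ‖v₀ - (γ : t × t)‖ = ‖(v - γ) - (v - v₀)‖ := by congr 1; abel
      _ ≤ ‖v - (γ : t × t)‖ + ‖v - v₀‖ := norm_sub_le _ _
      _ < 1 / 2 := by linarith
  by_cases h : ∃ γ₀ : Λ.prod Λ, ‖v₀ - (γ₀ : t × t)‖ < 1 / 2
  · obtain ⟨γ₀, h0⟩ := h
    refine ⟨γ₀, fun v hv γ hγ => ?_⟩
    by_contra hne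
    have h1 := key γ v hv hne
    have h2 := hΛ.one_le_norm_prod (γ - γ₀).2 (by simpa [sub_eq_zero] using hγ)
    have h3 : ‖((γ - γ₀ : Λ.prod Λ) : t × t)‖ ≤ ‖v₀ - (γ₀ : t × t)‖ + ‖v₀ - (γ : t × t)‖ := by
      calc _ = ‖(v₀ - (γ₀ : t × t)) - (v₀ - (γ : t × t))‖ := by
            congr 1
            rw [Submodule.coe_sub]
            abel
        _ ≤ _ := norm_sub_le _ _
    linarith
  · refine ⟨0, fun v hv γ _ => ?_⟩
    by_contra hne
    exact h ⟨γ, key γ v hv hne⟩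

/-- The sum of the translates of the Gaussian kernel, cut off near the graph of the translations. -/
def latticePhase (Λ : Submodule ℤ t) (τ τ' : UpperHalfPlane) (x y : t × t) : ℂ :=
  ∑' γ : Λ.prod Λ, (cutoff t (x - y - γ) : ℂ) * gaussTerm τ τ' γ x y

variable {τ τ' : UpperHalfPlane}

theorem exists_latticePhase_eq (hΛ : IsEvenLattice Λ) (v₀ : t × t) : ∃ γ₀ : Λ.prod Λ,
    ∀ x y : t × t, ‖x - y - v₀‖ < 1 / 4 →
      latticePhase Λ τ τ' x y = (cutoff t (x - y - γ₀) : ℂ) * gaussTerm τ τ' γ₀ x y := by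
  obtain ⟨γ₀, h⟩ := exists_cutoff_sub_eq_zero hΛ v₀
  refine ⟨γ₀, fun x y hxy => tsum_eq_single γ₀ fun γ hγ => ?_⟩
  rw [h _ hxy γ hγ, Complex.ofReal_zero, zero_mul]

theorem latticePhase_eq_gaussKernel (hΛ : IsEvenLattice Λ) {x y : t × t} (h : ‖x - y‖ ≤ 1 / 8) :
    latticePhase Λ τ τ' x y = gaussKernel τ τ' x y := by
  rw [latticePhase, tsum_eq_single 0 fun γ hγ => ?_]
  · rw [Submodule.coe_zero, sub_zero, cutoff_eq_one h, gaussTerm_zero, Complex.ofReal_one, one_mul]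
  · rw [cutoff_eq_zero, Complex.ofReal_zero, zero_mul]
    have h1 := hΛ.one_le_norm_prod γ.2 (by simpa using hγ)
    have h2 : ‖(γ : t × t)‖ ≤ ‖x - y‖ + ‖x - y - γ‖ := by
      calc _ = ‖(x - y) - (x - y - γ)‖ := by congr 1; abel
        _ ≤ _ := norm_sub_le _ _
    linarith

theorem contDiff_latticePhase (hΛ : IsEvenLattice Λ) :
    ContDiff ℝ ∞ fun z : (t × t) × (t × t) => latticePhase Λ τ τ' z.1 z.2 := by
  rw [contDiff_iff_contDiffAt]
  intro z₀
  obtain ⟨γ₀, h⟩ := exists_latticePhase_eq (τ := τ) (τ' := τ') hΛ (z₀.1 - z₀.2)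
  have hsm : ContDiff ℝ ∞ fun z : (t × t) × (t × t) =>
      (cutoff t (z.1 - z.2 - γ₀) : ℂ) * gaussTerm τ τ' γ₀ z.1 z.2 :=
    (Complex.ofRealCLM.contDiff.comp ((cutoff t).contDiff.comp
      ((contDiff_fst.sub contDiff_snd).sub contDiff_const))).mul (contDiff_gaussTerm _ _ _)
  refine hsm.contDiffAt.congr_of_eventuallyEq ?_
  have hopen : IsOpen {z : (t × t) × (t × t) | ‖z.1 - z.2 - (z₀.1 - z₀.2)‖ < 1 / 4} :=
    isOpen_lt (by fun_prop) continuous_const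
  filter_upwards [hopen.mem_nhds (by simp)] with z hz
  exact h _ _ hz

theorem norm_latticePhase_lt_one (hΛ : IsEvenLattice Λ) {x y : t × t} (h : x - y ∉ Λ.prod Λ) :
    ‖latticePhase Λ τ τ' x y‖ < 1 := by
  obtain ⟨γ₀, h0⟩ := exists_latticePhase_eq (τ := τ) (τ' := τ') hΛ (x - y)
  obtain ⟨c, hc, hle⟩ := exists_norm_gaussTerm_le (t := t) τ τ'
  rw [h0 x y (by simp), norm_mul, Complex.norm_real, Real.norm_of_nonneg (cutoff t).nonneg]
  refine (mul_le_of_le_one_left (norm_nonneg _) (cutoff t).le_one).trans_lt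
    ((hle _ _ _).trans_lt ?_)
  rw [Real.exp_lt_one_iff, neg_mul, neg_lt_zero]
  have hne : y - x + γ₀ ≠ 0 := fun h1 => h (by
    have : x - y = γ₀ := by
      rw [← sub_eq_zero, ← neg_eq_zero, ← h1]
      abel
    rw [this]
    exact γ₀.2)
  have := norm_pos_iff.mpr hne
  positivity

theorem latticePhase_add (hΛ : IsEvenLattice Λ) {δ δ' : t × t} (hδ : δ ∈ Λ.prod Λ)
    (hδ' : δ' ∈ Λ.prod Λ) (x y : t × t) : latticePhase Λ τ τ' (x + δ) (y + δ') =
      latticeFactor δ x * conj (latticeFactor δ' y) * latticePhase Λ τ τ' x y := by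
  rw [latticePhase, latticePhase, ← tsum_mul_left,
    ← (Equiv.addRight (⟨δ' - δ, sub_mem hδ' hδ⟩ : Λ.prod Λ)).tsum_eq (fun γ : Λ.prod Λ =>
      latticeFactor δ x * conj (latticeFactor δ' y) *
        ((cutoff t (x - y - γ) : ℂ) * gaussTerm τ τ' γ x y))]
  congr 1
  ext γ
  have e : (γ : t × t) - δ + δ' = γ + (δ' - δ) := by abel
  have e' : x + δ - (y + δ') - γ = x - y - (γ + (δ' - δ)) := by abel
  rw [gaussTerm_add_left hΛ γ.2 hδ, gaussTerm_add_right hΛ (sub_mem γ.2 hδ) hδ', e, e']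
  simp only [Equiv.coe_addRight, Submodule.coe_add]
  ring

variable [DiscreteTopology Λ] [IsZLattice ℝ Λ]

/-- The periodized kernel differs from the `k`-th power of the phase by an exponentially small
quantity, because the Gaussian is small away from its center. -/
theorem exists_norm_latticeKernel_sub_le (hΛ : IsEvenLattice Λ) (τ τ' : UpperHalfPlane) :
    ∃ C ε : ℝ, 0 < ε ∧ ∀ k : ℕ, 1 ≤ k → ∀ x y : t × t,
      ‖latticeKernel Λ τ τ' k x y - latticePhase Λ τ τ' x y ^ k‖ ≤ C * Real.exp (-ε * k) := by
  obtain ⟨c, hc, hle⟩ := exists_norm_gaussTerm_le (t := t) τ τ'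
  obtain ⟨C, hC⟩ := exists_tsum_exp_neg_sq_norm_add_le (Λ.prod Λ) hc
  refine ⟨Real.exp (c / 64) * C, c / 64, by positivity, fun k hk x y => ?_⟩
  have hk1 : (1 : ℝ) ≤ k := by exact_mod_cast hk
  have hs : Summable fun γ : Λ.prod Λ => Real.exp (-c * ‖y - x + γ‖ ^ 2) := by
    simpa using summable_exp_neg_sq_norm_add (Λ.prod Λ) hc 0 (y - x)
  have hT1 : ∀ γ : Λ.prod Λ, ‖gaussTerm τ τ' γ x y‖ ≤ 1 := fun γ => (hle _ _ _).trans (by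
    rw [Real.exp_le_one_iff, neg_mul, neg_nonpos]
    positivity)
  have hsum : Summable fun γ : Λ.prod Λ => gaussTerm τ τ' γ x y ^ k := by
    refine Summable.of_norm_bounded hs fun γ => ?_
    rw [norm_pow]
    exact (pow_le_of_le_one (norm_nonneg _) (hT1 γ) (by lia)).trans (hle _ _ _)
  -- only one term of the phase does not vanish, hence its powers are computed termwise
  obtain ⟨γ₀, h0⟩ := exists_cutoff_sub_eq_zero hΛ (x - y)
  have hz : ∀ γ : Λ.prod Λ, γ ≠ γ₀ →
      ((cutoff t (x - y - γ) : ℂ) * gaussTerm τ τ' γ x y) ^ k = 0 := fun γ hγ => by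
    rw [h0 (x - y) (by simp) γ hγ, Complex.ofReal_zero, zero_mul, zero_pow (by lia)]
  have hpow : latticePhase Λ τ τ' x y ^ k =
      ∑' γ : Λ.prod Λ, ((cutoff t (x - y - γ) : ℂ) * gaussTerm τ τ' γ x y) ^ k := by
    rw [tsum_eq_single γ₀ hz, latticePhase, tsum_eq_single γ₀ fun γ hγ => by
      rw [h0 (x - y) (by simp) γ hγ, Complex.ofReal_zero, zero_mul]]
  have hsum' : Summable fun γ : Λ.prod Λ =>
      ((cutoff t (x - y - γ) : ℂ) * gaussTerm τ τ' γ x y) ^ k :=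
    (hasSum_single γ₀ hz).summable
  rw [latticeKernel, hpow, ← hsum.tsum_sub hsum']
  have hterm : ∀ γ : Λ.prod Λ, ‖gaussTerm τ τ' γ x y ^ k -
      ((cutoff t (x - y - γ) : ℂ) * gaussTerm τ τ' γ x y) ^ k‖ ≤
      Real.exp (c / 64) * Real.exp (-(c / 64) * k) * Real.exp (-c * ‖y - x + γ‖ ^ 2) := by
    intro γ
    by_cases hγ : ‖x - y - (γ : t × t)‖ ≤ 1 / 8
    · rw [cutoff_eq_one hγ, Complex.ofReal_one, one_mul, sub_self, norm_zero]
      positivity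
    · have e1 : gaussTerm τ τ' γ x y ^ k - ((cutoff t (x - y - γ) : ℂ) *
          gaussTerm τ τ' γ x y) ^ k =
          ((1 - cutoff t (x - y - γ) ^ k : ℝ) : ℂ) * gaussTerm τ τ' γ x y ^ k := by
        push_cast
        ring
      have e2 : |1 - cutoff t (x - y - γ) ^ k| ≤ 1 := by
        have h1 : 0 ≤ cutoff t (x - y - γ) ^ k := pow_nonneg (cutoff t).nonneg _
        have h2 : cutoff t (x - y - γ) ^ k ≤ 1 := pow_le_one₀ (cutoff t).nonneg (cutoff t).le_one
        rw [abs_le]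
        constructor <;> linarith
      rw [e1, norm_mul, Complex.norm_real, Real.norm_eq_abs, norm_pow]
      refine (mul_le_of_le_one_left (by positivity) e2).trans ?_
      refine (pow_le_pow_left₀ (norm_nonneg _) (hle _ _ _) k).trans ?_
      rw [← Real.exp_nat_mul, ← Real.exp_add, ← Real.exp_add, Real.exp_le_exp]
      have e3 : ‖y - x + (γ : t × t)‖ = ‖x - y - (γ : t × t)‖ := by
        rw [← norm_neg]
        congr 1
        abel
      rw [e3]
      have h3 : (1 / 64 : ℝ) ≤ ‖x - y - (γ : t × t)‖ ^ 2 := by nlinarith [not_le.mp hγ]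
      nlinarith [mul_nonneg (sub_nonneg.mpr hk1) (mul_nonneg hc.le (sub_nonneg.mpr h3))]
  have hbound := (hs.mul_left (Real.exp (c / 64) * Real.exp (-(c / 64) * k)))
  calc _ ≤ ∑' γ : Λ.prod Λ, Real.exp (c / 64) * Real.exp (-(c / 64) * k) *
        Real.exp (-c * ‖y - x + γ‖ ^ 2) := tsum_of_norm_bounded hbound.hasSum hterm
    _ ≤ Real.exp (c / 64) * Real.exp (-(c / 64) * k) * C := by
      rw [tsum_mul_left]
      gcongr
      exact hC _
    _ = _ := by ring

end Phase

section PhaseSection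

variable {t : Type*} [NormedAddCommGroup t] [InnerProductSpace ℝ t]

open scoped Topology

/-- If a kernel coincides near the graph with one which is holomorphic in the first variable and
antiholomorphic in the second one, then its `∂̄` vanishes to any order along the graph. -/
theorem dbarVanishesOnGraph_of_eventuallyEq {τ : UpperHalfPlane} {Φ : t × t → t × t} {k : ℕ}
    {F F' : (t × t) × (t × t) → ℂ} (hF' : Differentiable ℝ F')
    (hl : ∀ y, IsHolomorphic τ k fun x => F' (x, y))
    (hr : ∀ x, IsHolomorphic τ k fun y => conj (F' (x, y)))
    (h : ∀ x, F =ᶠ[𝓝 (Φ x, x)] F') : DbarVanishesOnGraph τ Φ k F := by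
  have hleft : ∀ {z}, F =ᶠ[𝓝 z] F' → ∀ w, covDerivLeft k F z w =
      covDeriv k (fun x => F' (x, z.2)) z.1 w := fun hz w => by
    rw [← covDerivLeft_eq (hF' _), covDerivLeft, covDerivLeft, hz.fderiv_eq, hz.eq_of_nhds]
  have hright : ∀ {z}, F =ᶠ[𝓝 z] F' → ∀ w, covDerivRight k F z w =
      conj (covDeriv k (fun y => conj (F' (z.1, y))) z.2 w) := fun hz w => by
    rw [← covDerivRight_eq (hF' _), covDerivRight, covDerivRight, hz.fderiv_eq, hz.eq_of_nhds]
  intro v m x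
  constructor
  · have h0 : (fun z => (τ : ℂ) * covDerivLeft k F z (v, 0) - covDerivLeft k F z (0, v))
        =ᶠ[𝓝 (Φ x, x)]
        fun _ => 0 := by
      filter_upwards [(h x).eventuallyEq_nhds] with z hz
      rw [hleft hz, hleft hz]
      exact hl z.2 z.1 v
    rw [(h0.iteratedFDeriv ℝ m).eq_of_nhds, iteratedFDeriv_fun_zero]
    rfl
  · have h0 : (fun z => conj (τ : ℂ) * covDerivRight k F z (v, 0) - covDerivRight k F z (0, v))
        =ᶠ[𝓝 (Φ x, x)] fun _ => 0 := by
      filter_upwards [(h x).eventuallyEq_nhds] with z hz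
      rw [hright hz, hright hz, ← map_mul, ← map_sub, hr z.1 z.2 v, map_zero]
    rw [(h0.iteratedFDeriv ℝ m).eq_of_nhds, iteratedFDeriv_fun_zero]
    rfl

theorem iteratedFDeriv_const_norm_le {E : Type*} [NormedAddCommGroup E] [NormedSpace ℝ E] (c : ℂ)
    (m : ℕ) (z : E) : ‖iteratedFDeriv ℝ m (fun _ : E => c) z‖ ≤ ‖c‖ := by
  cases m with
  | zero => rw [norm_iteratedFDeriv_zero]
  | succ m => simp [iteratedFDeriv_succ_const]

theorem contDiff_modularAction_fst (A : SL(2, ℤ)) :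
    ContDiff ℝ ∞ fun z : (t × t) × (t × t) => (modularAction A z.1, z.2) := by
  have h := (contDiff_modularAction (t := t) A).comp (contDiff_fst (E := t × t) (F := t × t))
  exact h.prodMk contDiff_snd

variable [FiniteDimensional ℝ t] {Λ : Submodule ℤ t}

/-- The section `F` of `L ⊠ L̄`, associated to the prequantum lift of `A`. -/
def phase (Λ : Submodule ℤ t) (A : SL(2, ℤ)) (τ : UpperHalfPlane) (z : (t × t) × (t × t)) : ℂ :=
  latticePhase Λ τ (mobius A⁻¹ τ) (modularAction A⁻¹ z.1) z.2

theorem contDiff_phase (hΛ : IsEvenLattice Λ) (A : SL(2, ℤ)) (τ : UpperHalfPlane) :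
    ContDiff ℝ ∞ (phase Λ A τ) := by
  have h := (contDiff_latticePhase (τ := τ) (τ' := mobius A⁻¹ τ) hΛ).comp
    (contDiff_modularAction_fst A⁻¹)
  simp only [Function.comp_def] at h
  exact h

theorem isSection₂_phase (hΛ : IsEvenLattice Λ) (A : SL(2, ℤ)) (τ : UpperHalfPlane) :
    IsSection₂ Λ 1 (phase Λ A τ) := by
  intro γ γ' h1 h2 h1' h2' x y
  simp only [phase, pow_one]
  rw [modularAction_add, latticePhase_add hΛ (modularAction_mem A⁻¹ h1 h2) ⟨h1', h2'⟩,
    latticeFactor_modularAction hΛ A⁻¹ h1 h2]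

theorem norm_phase_lt_one (hΛ : IsEvenLattice Λ) (A : SL(2, ℤ)) (τ : UpperHalfPlane) {x y : t × t}
    (h : ¬ ((x - modularAction A y).1 ∈ Λ ∧ (x - modularAction A y).2 ∈ Λ)) :
    ‖phase Λ A τ (x, y)‖ < 1 := by
  refine norm_latticePhase_lt_one hΛ fun hmem => h ?_
  have h1 := modularAction_mem A hmem.1 hmem.2
  rwa [modularAction_sub, modularAction_modularAction_inv] at h1

theorem phase_eventuallyEq (hΛ : IsEvenLattice Λ) (A : SL(2, ℤ)) (τ : UpperHalfPlane) (x : t × t) :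
    phase Λ A τ =ᶠ[𝓝 (modularAction A x, x)]
      fun z => gaussKernel τ (mobius A⁻¹ τ) (modularAction A⁻¹ z.1) z.2 := by
  have hc : Continuous fun z : (t × t) × (t × t) => modularAction A⁻¹ z.1 - z.2 :=
    ((contDiff_modularAction A⁻¹).continuous.comp continuous_fst).sub continuous_snd
  have hopen : IsOpen {z : (t × t) × (t × t) | ‖modularAction A⁻¹ z.1 - z.2‖ < 1 / 8} :=
    isOpen_lt hc.norm continuous_const
  filter_upwards [hopen.mem_nhds (by simp [modularAction_inv_modularAction])] with z hz
  exact latticePhase_eq_gaussKernel hΛ (le_of_lt hz)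

theorem phase_graph (hΛ : IsEvenLattice Λ) (A : SL(2, ℤ)) (τ : UpperHalfPlane) (x : t × t) :
    phase Λ A τ (modularAction A x, x) = 1 := by
  rw [(phase_eventuallyEq hΛ A τ x).eq_of_nhds, modularAction_inv_modularAction, gaussKernel_self]

theorem dbarVanishesOnGraph_phase (hΛ : IsEvenLattice Λ) (A : SL(2, ℤ)) (τ : UpperHalfPlane) :
    DbarVanishesOnGraph τ (modularAction A) 1 (phase Λ A τ) := by
  have hsm := (contDiff_gaussKernel τ (mobius A⁻¹ τ)).comp (contDiff_modularAction_fst (t := t) A⁻¹)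
  simp only [Function.comp_def] at hsm
  have hl : ∀ y, IsHolomorphic τ 1 fun x =>
      gaussKernel τ (mobius A⁻¹ τ) (modularAction A⁻¹ x) y := fun y => by
    have hd := (contDiff_gaussKernel τ (mobius A⁻¹ τ)).comp
      (contDiff_prodMk_left (𝕜 := ℝ) (E := t × t) (F := t × t) y)
    simp only [Function.comp_def] at hd
    exact (isHolomorphic_gaussKernel τ (mobius A⁻¹ τ) y).comp_modularAction A⁻¹
      (hd.differentiable (by simp))
  have hr : ∀ x : t × t, IsHolomorphic τ 1 fun y =>
      conj (gaussKernel τ (mobius A⁻¹ τ) (modularAction A⁻¹ x) y) :=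
    fun x => isHolomorphic_conj_gaussKernel _ _ _
  exact dbarVanishesOnGraph_of_eventuallyEq
    (F' := fun z : (t × t) × (t × t) => gaussKernel τ (mobius A⁻¹ τ) (modularAction A⁻¹ z.1) z.2)
    (hsm.differentiable (by simp)) hl hr (phase_eventuallyEq hΛ A τ)

end PhaseSection

/-! ### The Fourier integral expansion -/

section FourierIntegralOperator

variable {t : Type*} [NormedAddCommGroup t] [InnerProductSpace ℝ t] [FiniteDimensional ℝ t]
  [MeasurableSpace t] [BorelSpace t] {Λ : Submodule ℤ t} [DiscreteTopology Λ] [IsZLattice ℝ Λ]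

theorem pow_mul_exp_neg_mul_le {ε : ℝ} (hε : 0 < ε) (m : ℕ) {r : ℝ} (hr : 0 ≤ r) :
    r ^ m * Real.exp (-ε * r) ≤ m.factorial / ε ^ m := by
  have h := Real.pow_div_factorial_le_exp (ε * r) (by positivity) m
  rw [div_le_iff₀ (by positivity), mul_pow] at h
  rw [le_div_iff₀ (by positivity), neg_mul, Real.exp_neg, mul_right_comm, ← div_eq_mul_inv,
    div_le_iff₀ (Real.exp_pos _)]
  linarith

/-- The operators `R₂(A, e)` form a Fourier integral operator whose amplitude is a constant. -/
theorem isFourierIntegralOperator (hΛ : IsEvenLattice Λ) (τ : UpperHalfPlane)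
    (g : Mo₂ (Module.finrank ℝ t)) {R : ∀ k : ℕ, QuantumSpace Λ τ k →ₗ[ℂ] QuantumSpace Λ τ k}
    (hR : ∀ k : ℕ, 1 ≤ k → IsR₂ Λ τ g k (R k)) :
    IsFourierIntegralOperator Λ τ (modularAction g.A) (fun _ => 1)
      (fun _ => modularSymbol g τ) R := by
  set g₀ : ℂ := modularSymbol g τ / (halfFormNormSq Λ τ : ℂ) with hg₀
  have hh : (halfFormNormSq Λ τ : ℂ) ≠ 0 := by exact_mod_cast (halfFormNormSq_pos τ).ne'
  refine ⟨schwartzKernel Λ τ g, phase Λ g.A τ, fun _ _ => g₀, fun l _ => if l = 0 then g₀ else 0,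
    fun k hk => isSchwartzKernel_schwartzKernel hΛ τ g hk (hR k hk),
    ⟨contDiff_phase hΛ g.A τ, isSection₂_phase hΛ g.A τ, fun x y h => norm_phase_lt_one hΛ g.A τ h,
      phase_graph hΛ g.A τ, dbarVanishesOnGraph_phase hΛ g.A τ⟩,
    fun k _ => ⟨contDiff_const, fun γ γ' _ _ _ _ x y => by simp⟩,
    fun l => ⟨contDiff_const, fun γ γ' _ _ _ _ x y => by simp, fun v m x => ?_⟩, ?_,
    fun x => ?_, fun N => ?_⟩
  · simp only [covDerivLeft, covDerivRight, fderiv_fun_const, Nat.cast_zero, zero_mul]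
    simp
  · intro N m
    refine ⟨‖g₀‖, fun k hk z => ?_⟩
    cases N with
    | zero =>
      simp only [Finset.range_zero, Finset.sum_empty, sub_zero, pow_zero, div_one]
      exact iteratedFDeriv_const_norm_le _ _ _
    | succ N =>
      have : ∑ l ∈ Finset.range (N + 1), ((k : ℂ) ^ l)⁻¹ * (if l = 0 then g₀ else 0) = g₀ := by
        simp
      simp only [this, sub_self]
      refine (iteratedFDeriv_const_norm_le _ _ _).trans ?_
      rw [norm_zero]
      positivity
  · simp only [if_true, hg₀]
    field_simp
  · obtain ⟨C, ε, hε, hle⟩ := exists_norm_latticeKernel_sub_le hΛ τ (mobius g.A⁻¹ τ)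
    have hC : 0 ≤ C := by
      have h1 := (norm_nonneg _).trans (hle 1 le_rfl 0 0)
      exact nonneg_of_mul_nonneg_left h1 (Real.exp_pos _)
    refine ⟨(2 * Real.pi)⁻¹ ^ Module.finrank ℝ t * ‖g₀‖ * C *
      ((Module.finrank ℝ t + N).factorial / ε ^ (Module.finrank ℝ t + N)), fun k hk z => ?_⟩
    have hkpos : (0 : ℝ) < k := by exact_mod_cast hk
    have hpi := Real.pi_pos
    have e : schwartzKernel Λ τ g k z -
        ((k : ℂ) / (2 * Real.pi)) ^ Module.finrank ℝ t * phase Λ g.A τ z ^ k * g₀ =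
        ((k : ℂ) / (2 * Real.pi)) ^ Module.finrank ℝ t * g₀ *
          (latticeKernel Λ τ (mobius g.A⁻¹ τ) k (modularAction g.A⁻¹ z.1) z.2 -
            latticePhase Λ τ (mobius g.A⁻¹ τ) (modularAction g.A⁻¹ z.1) z.2 ^ k) := by
      rw [schwartzKernel, phase]
      ring
    have hnorm : ‖((k : ℂ) / (2 * Real.pi)) ^ Module.finrank ℝ t‖ =
        (2 * Real.pi)⁻¹ ^ Module.finrank ℝ t * (k : ℝ) ^ Module.finrank ℝ t := by
      rw [norm_pow, ← mul_pow, norm_div, norm_mul, Complex.norm_natCast, Complex.norm_real,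
        Complex.norm_ofNat, Real.norm_of_nonneg hpi.le, div_eq_inv_mul]
    change ‖schwartzKernel Λ τ g k z -
      ((k : ℂ) / (2 * Real.pi)) ^ Module.finrank ℝ t * phase Λ g.A τ z ^ k * g₀‖ ≤ _
    rw [e, norm_mul, norm_mul, hnorm, le_div_iff₀ (by positivity)]
    calc (2 * Real.pi)⁻¹ ^ Module.finrank ℝ t * (k : ℝ) ^ Module.finrank ℝ t * ‖g₀‖ *
          ‖_‖ * (k : ℝ) ^ N
        ≤ (2 * Real.pi)⁻¹ ^ Module.finrank ℝ t * (k : ℝ) ^ Module.finrank ℝ t * ‖g₀‖ *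
          (C * Real.exp (-ε * k)) * (k : ℝ) ^ N := by
          gcongr
          exact hle k hk _ _
      _ = (2 * Real.pi)⁻¹ ^ Module.finrank ℝ t * ‖g₀‖ * C *
          ((k : ℝ) ^ (Module.finrank ℝ t + N) * Real.exp (-ε * k)) := by ring
      _ ≤ _ := by
          gcongr
          exact pow_mul_exp_neg_mul_le hε _ hkpos.le

end FourierIntegralOperator

end

end TorusQuantization

theorem mainTheorem1 {ι M t : Type*} [Finite ι] [AddCommGroup M] [Module ℝ M]
    [NormedAddCommGroup t] [InnerProductSpace ℝ t] [FiniteDimensional ℝ t]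
    [MeasurableSpace t] [BorelSpace t]
    (P : RootPairing ι ℝ M t) [P.IsRootSystem] [P.IsCrystallographic] [P.IsReduced]
    [P.IsIrreducible] (hB : TorusQuantization.IsBasicInnerProduct P)
    (τ : UpperHalfPlane) (g : TorusQuantization.Mo₂ (Module.finrank ℝ t)) :
    (∀ k : ℕ, 1 ≤ k → ∃! R, TorusQuantization.IsR₂ (P.corootSpan ℤ) τ g k R) ∧
    ∀ R : ∀ k : ℕ, TorusQuantization.QuantumSpace (P.corootSpan ℤ) τ k →ₗ[ℂ]
        TorusQuantization.QuantumSpace (P.corootSpan ℤ) τ k,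
      (∀ k : ℕ, 1 ≤ k → TorusQuantization.IsR₂ (P.corootSpan ℤ) τ g k (R k)) →
      TorusQuantization.IsFourierIntegralOperator (P.corootSpan ℤ) τ
        (TorusQuantization.modularAction g.A) (fun _ => 1)
        (fun _ => TorusQuantization.modularSymbol g τ) R := by
  have hΛ := hB.isEvenLattice
  have : DiscreteTopology (P.corootSpan ℤ) := hB.isEvenLattice.discreteTopology
  have : IsZLattice ℝ (P.corootSpan ℤ) := ⟨by
    rw [RootPairing.corootSpan, Submodule.span_span_of_tower]
    exact RootPairing.IsRootSystem.span_coroot_eq_top⟩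
  exact ⟨fun k hk => TorusQuantization.existsUnique_isR₂ hΛ τ g hk,
    fun R hR => TorusQuantization.isFourierIntegralOperator hΛ τ g hR⟩
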